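/- **Setting.** Let $n\in\{2,3\}$, $Y=(0,1]^n$, and let $D$ be a nonempty open set with $\overline D\subset(0,1)^n$ and $C^{1,\gamma}$ boundary for some $\gamma>0$. Let $L^2_\#(0,Y)$ be the space of complex $\mathbb Z^n$-periodic functions in $L^2_{loc}(\mathbb R^n)$ with $\int_Y u\,dx=0$, with the $L^2(Y)$ inner product $(u,v)=\int_Y u\overline v\,dx$, and let $H^1_\#(0,Y)$ be the space of mean-zero periodic functions in $H^1_{loc}(\mathbb R^n)$, with inner product $\langle u,v\rangle=\int_Y\nabla u\cdot\nabla\overline v\,dx$. Let $(-\Delta_0)^{-1}:L^2_\#(0,Y)\to H^1_\#(0,Y)$ be defined by $\langle(-\Delta_0)^{-1}f,v\rangle=(f,v)$ for all $v\in H^1_\#(0,Y)$. Let $W_1\subset H^1_\#(0,Y)$ be the closure of the functions with support away from $D$, let $W_2=\{\tilde u-(\int_D\tilde u\,dx)1_Y:\tilde u\in H^1_0(D)\}$ (functions of $H_0^1(D)$ extended by zero), and let $W_3=(W_1\oplus W_2)^\perp$ in $H^1_\#(0,Y)$. The self-adjoint operator $T:W_3\to W_3$ is given by $$\langle Tu,v\rangle=\tfrac12\int_{Y\setminus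 D}\nabla u\cdot\nabla\overline v\,dx-\tfrac12\int_D\nabla u\cdot\nabla\overline v\,dx .$$ For an eigenvalue $\mu$ of $T$, let $P_\mu$ be the orthogonal projection of $H^1_\#(0,Y)$ onto the eigenspace; let $P_1=Q_1+P_{1/2}$, with $Q_1$ the orthogonal projection onto $W_1$ (and $P_{1/2}=0$ if $1/2$ is not an eigenvalue), and let $P_2$ be the orthogonal projection onto $W_2$. Define on $L^2_\#(0,Y)$ the operators $$A^0(z)=\Big(zP_1+P_2+z\sum_{-\frac12<\mu<\frac12}\big[(\tfrac12+\mu)+z(\tfrac12-\mu)\big]^{-1}P_{\mu}\Big)(-\Delta_0)^{-1},$$ the sum being over the eigenvalues $\mu$ of $T$ in $(-\frac12,\frac12)$. Let $R(\zeta,z)=(A^0(z)-\zeta)^{-1}$, and write $A^0(z)=A^0(0)+\sum_{k\ge1}z^kA_k$ for the power series of $A^0$ at $z=0$. Assume that the lowest eigenvalue $\mu^-$ of $T$ satisfies $-\frac12<\mu^-<0$. Let $\beta_0\ne0$ be an element of $\sigma(A^0(0))$, and let $\Gamma$ be a closed piecewise $C^1$ contour in $\mathbb C$, with winding number $0$ or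 $1$ about each point off $\Gamma$ (for example, a positively oriented Jordan curve), that does not meet $\sigma(A^0(0))$ and that encloses $\beta_0$ but no other element of $\sigma(A^0(0))$; here the points enclosed by (exterior to) $\Gamma$ are those about which it has winding number $1$ ($0$). Set $$d=\inf_{\zeta\in\Gamma}\operatorname{dist}(\zeta,\sigma(A^0(0))),\qquad z^*=\frac{\mu^-+\frac12}{\mu^--\frac12},\qquad r^*=\frac{4\pi^2d\,|z^*|}{\frac1{1/2-\mu^-}+4\pi^2d}.$$ **Theorem.** 1. If $|z|<r^*$, then the series defining $A^0(z)$ converges in operator norm, and $\Gamma$ lies in the resolvent sets of both $A^0(0)$ and $A^0(z)$. Thus $\Gamma$ separates $\sigma(A^0(z))$ into a part $\Sigma'(z)$ enclosed by $\Gamma$ and a part $\Sigma''(z)$ exterior to $\Gamma$. 2. If $|z|<r^*$, there is exactly one bounded projection $P(z)$ on $L^2_\#(0,Y)$ that commutes with $A^0(z)$ and for which the restrictions of $A^0(z)$ to the invariant subspaces $M'(z)=P(z)L^2_\#(0,Y)$ and $\ker P(z)$ have the spectra $\Sigma'(z)$ and $\Sigma''(z)$, respectively. It is given by $$P(z)=\frac{-1}{2\pi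 i}\oint_\Gamma R(\zeta,z)\,d\zeta ,$$ and $P(z)$ is holomorphic for $|z|<r^*$. 3. For $|z|<r^*$ the spaces $M'(z)$ and $M'(0)$ are isomorphic, and they are finite-dimensional. 4. Let $m=\dim M'(0)$ and let $\hat\beta(z)=\frac1m\operatorname{tr}(A^0(z)P(z))$ be the weighted mean of the eigenvalue group enclosed by $\Gamma$. The power series $$\hat\beta(z)=\beta_0+\sum_{k=1}^\infty z^k\beta_k,\qquad \beta_k=\frac1{2\pi i\,m}\operatorname{tr}\sum_{\substack{p\ge1,\;k_1,\dots,k_p\ge1\\k_1+\cdots+k_p=k}}\frac{(-1)^p}{p}\oint_\Gamma A_{k_1}R(\zeta,0)A_{k_2}R(\zeta,0)\cdots A_{k_p}R(\zeta,0)\,d\zeta ,$$ converges uniformly to $\hat\beta$ for $|z|<r^*$. -/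

import Mathlib

open MeasureTheory Set Filter Topology
open scoped ContDiff ComplexConjugate NNReal

namespace HighContrast

noncomputable section

/-! ### Periodic function spaces

A `ℤⁿ`-periodic function is recorded by its restriction to the unit cell `Y = (0,1]ⁿ`. -/

/-- The unit period cell `Y = (0,1]ⁿ`. -/
def cell (n : ℕ) : Set (Fin n → ℝ) := {x | ∀ i, x i ∈ Ioc (0 : ℝ) 1}

/-- `L²(Y)`, that is, the complex `ℤⁿ`-periodic functions in `L²_loc(ℝⁿ)`. -/
abbrev L2 (n : ℕ) := Lp ℂ 2 (volume.restrict (cell n))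

/-- Smooth `ℤⁿ`-periodic functions on `ℝⁿ`. -/
structure IsPeriodicSmooth {n : ℕ} (φ : (Fin n → ℝ) → ℂ) : Prop where
  smooth : ContDiff ℝ ∞ φ
  periodic : ∀ (p : Fin n → ℤ) (x : Fin n → ℝ), φ (x + fun i => (p i : ℝ)) = φ x

/-- The classical partial derivative `∂φ/∂xⱼ`. -/
def partialDeriv {n : ℕ} (j : Fin n) (φ : (Fin n → ℝ) → ℂ) (x : Fin n → ℝ) : ℂ :=
  fderiv ℝ φ x (Pi.single j 1)

/-- `g` is the weak gradient on the torus of the periodic function `u`: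
`∫_Y u ∂ⱼφ = - ∫_Y gⱼ φ` for all smooth periodic `φ`. -/
def IsWeakGrad {n : ℕ} (u : L2 n) (g : Fin n → L2 n) : Prop :=
  ∀ φ : (Fin n → ℝ) → ℂ, IsPeriodicSmooth φ → ∀ j,
    ∫ x in cell n, u x * partialDeriv j φ x = - ∫ x in cell n, g j x * φ x

theorem measurableSet_cell (n : ℕ) : MeasurableSet (cell n) :=
  MeasurableSet.univ_pi' (fun _ => measurableSet_Ioc)

theorem volume_cell (n : ℕ) : volume (cell n) = 1 := by
  have : cell n = Set.pi univ (fun _ => Ioc (0 : ℝ) 1) := by ext; simp [cell]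
  rw [this, volume_pi_pi]; simp

instance (n : ℕ) : IsFiniteMeasure (volume.restrict (cell n)) :=
  ⟨by rw [Measure.restrict_apply_univ, volume_cell]; exact ENNReal.one_lt_top⟩

theorem L2.integrable {n : ℕ} (u : L2 n) : Integrable u (volume.restrict (cell n)) :=
  (Lp.memLp u).integrable (by norm_num)

/-- The mean zero functions in `L²(Y)`. -/
def meanZero (n : ℕ) : Submodule ℂ (L2 n) where
  carrier := {u | ∫ x in cell n, u x = 0}
  zero_mem' := by
    have h : ∫ x in cell n, (0 : L2 n) x = ∫ x in cell n, (0 : ℂ) :=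
      integral_congr_ae (Lp.coeFn_zero ..)
    simpa using h
  add_mem' := by
    intro u v hu hv
    have h : ∫ x in cell n, (u + v) x = ∫ x in cell n, (u x + v x) :=
      integral_congr_ae (Lp.coeFn_add u v)
    rw [Set.mem_ofPred_eq] at *
    rw [h, integral_add (L2.integrable u) (L2.integrable v), hu, hv, add_zero]
  smul_mem' := by
    intro c u hu
    have h : ∫ x in cell n, (c • u) x = ∫ x in cell n, c * u x :=
      integral_congr_ae (Lp.coeFn_smul c u)
    rw [Set.mem_ofPred_eq] at *
    rw [h, integral_const_mul, hu, mul_zero]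

/-- The space `L²_#(0,Y)`: periodic functions of mean zero in `L²_loc`, with the inner product
of `L²(Y)`. -/
abbrev L2per (n : ℕ) := ↥(meanZero n)

theorem IsPeriodicSmooth.continuous_partialDeriv {n : ℕ} {φ : (Fin n → ℝ) → ℂ}
    (h : IsPeriodicSmooth φ) (j : Fin n) : Continuous (partialDeriv j φ) :=
  (h.smooth.continuous_fderiv (by simp)).clm_apply continuous_const

theorem integrable_mul_continuous {n : ℕ} (u : L2 n) {f : (Fin n → ℝ) → ℂ} (hf : Continuous f) :
    Integrable (fun x => u x * f x) (volume.restrict (cell n)) := by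
  have hK : IsCompact (Set.pi univ (fun _ : Fin n => Icc (0 : ℝ) 1)) :=
    isCompact_univ_pi (fun _ => isCompact_Icc)
  obtain ⟨C, hC⟩ := hK.exists_bound_of_continuousOn hf.continuousOn
  refine (L2.integrable u).mul_bdd (c := C) hf.aestronglyMeasurable ?_
  refine (ae_restrict_iff' (measurableSet_cell n)).2 (Eventually.of_forall fun x hx => hC x ?_)
  exact fun i _ => Ioc_subset_Icc_self (hx i)

/-- The gradient fields `(u, ∇u)` with `u ∈ L²_#(0,Y)` and `∇u ∈ L²(Y)ⁿ`. -/
def gradGraph (n : ℕ) : Submodule ℂ (L2per n × PiLp 2 (fun _ : Fin n => L2 n)) where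
  carrier := {p | IsWeakGrad (p.1 : L2 n) (fun j => p.2 j)}
  zero_mem' := by
    intro φ _ j
    have h (f : (Fin n → ℝ) → ℂ) : ∫ x in cell n, (0 : L2 n) x * f x = 0 := by
      rw [← integral_zero (Fin n → ℝ) ℂ (μ := volume.restrict (cell n))]
      refine integral_congr_ae ?_
      filter_upwards [Lp.coeFn_zero ℂ 2 (volume.restrict (cell n))] with x hx
      rw [hx]; simp
    have h' : - ∫ x in cell n, (0 : L2 n) x * φ x = 0 := by rw [h, neg_zero]
    exact (h _).trans h'.symm
  add_mem' := by
    intro p q hp hq φ hφ j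
    have h (u v : L2 n) (f : (Fin n → ℝ) → ℂ) (hf : Continuous f) :
        ∫ x in cell n, (u + v) x * f x
          = (∫ x in cell n, u x * f x) + ∫ x in cell n, v x * f x := by
      rw [← integral_add (integrable_mul_continuous u hf) (integrable_mul_continuous v hf)]
      refine integral_congr_ae ?_
      filter_upwards [Lp.coeFn_add u v] with x hx
      rw [hx, Pi.add_apply, add_mul]
    have h1 := h (p.1 : L2 n) q.1 _ (hφ.continuous_partialDeriv j)
    have h2 := h (p.2 j) (q.2 j) _ hφ.smooth.continuous
    have h3 := hp φ hφ j
    have h4 := hq φ hφ j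
    refine h1.trans ?_
    rw [h3, h4]
    refine Eq.trans ?_ (congrArg Neg.neg h2).symm
    rw [neg_add]
  smul_mem' := by
    intro c p hp φ hφ j
    have h (u : L2 n) (f : (Fin n → ℝ) → ℂ) :
        ∫ x in cell n, (c • u) x * f x = c * ∫ x in cell n, u x * f x := by
      rw [← integral_const_mul]
      refine integral_congr_ae ?_
      filter_upwards [Lp.coeFn_smul c u] with x hx
      rw [hx, Pi.smul_apply, smul_eq_mul, mul_assoc]
    have h3 := hp φ hφ j
    refine (h (p.1 : L2 n) _).trans ?_
    rw [h3]
    refine Eq.trans ?_ (congrArg Neg.neg (h (p.2 j) _)).symm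
    rw [mul_neg]

/-- The space `H¹_#(0,Y)` of periodic `H¹_loc` functions of mean zero. -/
def H1per (n : ℕ) : Type := ↥(gradGraph n)

instance (n : ℕ) : AddCommGroup (H1per n) := inferInstanceAs (AddCommGroup ↥(gradGraph n))
instance (n : ℕ) : Module ℂ (H1per n) := inferInstanceAs (Module ℂ ↥(gradGraph n))

/-- The function underlying an element of `H¹_#(0,Y)`. -/
def H1per.fn {n : ℕ} : H1per n →ₗ[ℂ] L2per n :=
  (LinearMap.fst ℂ _ _).comp (gradGraph n).subtype

/-- The weak gradient. -/
def H1per.grad {n : ℕ} : H1per n →ₗ[ℂ] PiLp 2 (fun _ : Fin n => L2 n) :=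
  (LinearMap.snd ℂ _ _).comp (gradGraph n).subtype

theorem H1per.isWeakGrad {n : ℕ} (u : H1per n) :
    IsWeakGrad (H1per.fn u : L2 n) (fun j => H1per.grad u j) := u.2

/-- The exponential `e^{2πi k·x}`. -/
def expo {n : ℕ} (k : Fin n → ℤ) (x : Fin n → ℝ) : ℂ :=
  Complex.exp (2 * Real.pi * Complex.I * ∑ i, (k i : ℂ) * (x i : ℂ))

theorem expo_isPeriodicSmooth {n : ℕ} (k : Fin n → ℤ) : IsPeriodicSmooth (expo k) where
  smooth := by
    unfold expo
    have (i : Fin n) : ContDiff ℝ ∞ (fun x : Fin n → ℝ => ((x i : ℝ) : ℂ)) :=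
      Complex.ofRealCLM.contDiff.comp (contDiff_apply ℝ ℝ i)
    fun_prop
  periodic := by
    intro p x
    unfold expo
    rw [Complex.exp_eq_exp_iff_exists_int]
    refine ⟨∑ i, k i * p i, ?_⟩
    push_cast
    rw [Finset.sum_mul, Finset.mul_sum, Finset.mul_sum, ← Finset.sum_add_distrib]
    refine Finset.sum_congr rfl fun i _ => ?_
    simp only [Pi.add_apply]
    push_cast
    ring

theorem partialDeriv_expo {n : ℕ} (k : Fin n → ℤ) (j : Fin n) (x : Fin n → ℝ) :
    partialDeriv j (expo k) x = 2 * Real.pi * Complex.I * k j * expo k x := by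
  have h1 : HasFDerivAt (fun x : Fin n → ℝ => 2 * Real.pi * Complex.I * ∑ i, (k i : ℂ) * (x i : ℂ))
      ((2 * Real.pi * Complex.I : ℂ) • ∑ i, (k i : ℂ) •
        (Complex.ofRealCLM.comp (ContinuousLinearMap.proj (R := ℝ) i : (Fin n → ℝ) →L[ℝ] ℝ))) x := by
    refine HasFDerivAt.const_mul (HasFDerivAt.fun_sum fun i _ => HasFDerivAt.const_mul ?_ _) _
    exact (Complex.ofRealCLM.comp
      (ContinuousLinearMap.proj (R := ℝ) i : (Fin n → ℝ) →L[ℝ] ℝ)).hasFDerivAt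
  have h2 := h1.cexp
  unfold partialDeriv
  have h3 : fderiv ℝ (expo k) x = _ := h2.fderiv
  rw [h3]
  have h4 : ∑ i, (k i : ℂ) * (((Pi.single j 1 : Fin n → ℝ) i : ℝ) : ℂ) = k j := by
    rw [Finset.sum_eq_single j]
    · rw [Pi.single_eq_same]; simp
    · intro i _ hi
      rw [Pi.single_eq_of_ne hi]; simp
    · simp
  simp only [smul_apply, sum_apply, ContinuousLinearMap.comp_apply,
    ContinuousLinearMap.proj_apply, Complex.ofRealCLM_apply, smul_eq_mul]
  rw [h4, expo]
  ring

/-- The Fourier coefficient `∫_Y u e^{-2πi k·x}`. -/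
def fcoeff {n : ℕ} (u : L2 n) (k : Fin n → ℤ) : ℂ := ∫ x in cell n, u x * expo (-k) x

/-- The Haar probability measure on the torus `ℝⁿ/ℤⁿ`. -/
abbrev torusMeasure (n : ℕ) : Measure (UnitAddTorus (Fin n)) :=
  Measure.pi fun _ => AddCircle.haarAddCircle

/-- Parseval's identity on the unit cell. -/
theorem hasSum_fcoeff {n : ℕ} (u : L2 n) : HasSum (fun k => ‖fcoeff u k‖ ^ 2) (‖u‖ ^ 2) := by
  let r : UnitAddTorus (Fin n) → (Fin n → ℝ) := fun y =>
    (UnitAddTorus.measurableEquivPiIoc (fun _ : Fin n => (0 : ℝ)) y : Fin n → ℝ)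
  have hcell : {x : Fin n → ℝ | ∀ i, x i ∈ Ioc (0 : ℝ) (0 + 1)} = cell n := by
    simp only [zero_add, cell]
  have hr0 := (measurePreserving_subtype_coe (μa := (volume : Measure (Fin n → ℝ)))
    (MeasurableSet.univ_pi' (fun _ : Fin n => measurableSet_Ioc))).comp
    (UnitAddTorus.measurePreserving_equivPiIoc (fun _ : Fin n => (0 : ℝ)))
  have key (M : Measure (UnitAddTorus (Fin n)))
      (h : MeasurePreserving r M (volume.restrict {x | ∀ i, x i ∈ Ioc (0 : ℝ) (0 + 1)})) :
      MeasurePreserving r M (volume.restrict (cell n)) := by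
    rw [← hcell]
    exact h
  have hr := key (torusMeasure n) hr0
  have hme : MeasurableEmbedding (Subtype.val ∘
      UnitAddTorus.measurableEquivPiIoc (fun _ : Fin n => (0 : ℝ))) :=
    (MeasurableEmbedding.subtype_coe
      (MeasurableSet.univ_pi' (fun _ : Fin n => measurableSet_Ioc))).comp
      (MeasurableEquiv.measurableEmbedding _)
  have hm := (Lp.memLp u).comp_measurePreserving hr
  have hs := UnitAddTorus.hasSum_sq_mFourierCoeff (hm.toLp _)
  have hrx (y : UnitAddTorus (Fin n)) (i : Fin n) : ((r y i : ℝ) : UnitAddCircle) = y i :=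
    AddCircle.coe_equivIoc
  have h1 : ∫ y, ‖hm.toLp _ y‖ ^ 2 ∂torusMeasure n = ‖u‖ ^ 2 := by
    have e1 : ∫ y, ‖hm.toLp _ y‖ ^ 2 ∂torusMeasure n
        = ∫ y, ‖u (r y)‖ ^ 2 ∂torusMeasure n := by
      refine integral_congr_ae ?_
      filter_upwards [hm.coeFn_toLp] with y hy
      rw [hy]; rfl
    rw [e1]
    have e2 := hr.integral_comp hme (fun x => ‖u x‖ ^ 2)
    refine e2.trans ?_
    have e3 := L2.inner_def (𝕜 := ℂ) u u
    rw [inner_self_eq_norm_sq_to_K] at e3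
    have e4 : ∫ x in cell n, inner ℂ (u x) (u x) = ((∫ x in cell n, ‖u x‖ ^ 2 : ℝ) : ℂ) := by
      rw [← integral_complex_ofReal]
      refine integral_congr_ae (Eventually.of_forall fun x => ?_)
      simp only [inner_self_eq_norm_sq_to_K]
      push_cast
      rfl
    rw [e4] at e3
    refine (Complex.ofReal_injective ?_).symm
    rw [Complex.ofReal_pow]
    exact e3
  have h2 (k : Fin n → ℤ) : UnitAddTorus.mFourierCoeff (hm.toLp _) k = fcoeff u k := by
    have e1 : UnitAddTorus.mFourierCoeff (hm.toLp _) k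
        = ∫ y, u (r y) * expo (-k) (r y) ∂torusMeasure n := by
      unfold UnitAddTorus.mFourierCoeff
      refine integral_congr_ae ?_
      filter_upwards [hm.coeFn_toLp] with y hy
      rw [hy, smul_eq_mul, mul_comm]
      congr 1
      change ∏ i, fourier ((-k) i) (y i) = _
      simp only [expo, Finset.mul_sum, Complex.exp_sum]
      refine Finset.prod_congr rfl fun i _ => ?_
      rw [← hrx y i, fourier_coe_apply]
      congr 1
      simp
      ring
    rw [e1]
    exact hr.integral_comp hme (fun x => u x * expo (-k) x)
  simp only [h2] at hs
  rw [← h1]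
  exact hs

theorem fcoeff_grad {n : ℕ} {u : L2 n} {g : Fin n → L2 n} (h : IsWeakGrad u g) (j : Fin n)
    (k : Fin n → ℤ) : fcoeff (g j) k = 2 * Real.pi * Complex.I * k j * fcoeff u k := by
  have h1 := h _ (expo_isPeriodicSmooth (-k)) j
  rw [← neg_eq_iff_eq_neg] at h1
  unfold fcoeff
  rw [← h1, ← integral_neg, ← integral_const_mul]
  refine integral_congr_ae (Eventually.of_forall fun x => ?_)
  simp only [partialDeriv_expo, Pi.neg_apply, Int.cast_neg]
  ring

theorem fcoeff_zero {n : ℕ} (u : L2per n) : fcoeff (u : L2 n) 0 = 0 := by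
  have h : ∫ x in cell n, (u : L2 n) x = 0 := u.2
  simpa [fcoeff, expo] using h

/-- Poincaré's inequality. -/
theorem H1per.poincare {n : ℕ} (u : H1per n) :
    ‖H1per.fn u‖ ≤ 1 / (2 * Real.pi) * ‖H1per.grad u‖ := by
  have hpi := Real.pi_pos
  have h1 := hasSum_fcoeff (H1per.fn u : L2 n)
  have h2 : HasSum (fun k => ∑ j, ‖fcoeff (H1per.grad u j) k‖ ^ 2) (‖H1per.grad u‖ ^ 2) := by
    rw [PiLp.norm_sq_eq_of_L2]
    exact hasSum_sum fun j _ => hasSum_fcoeff _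
  have h3 : (2 * Real.pi) ^ 2 * ‖(H1per.fn u : L2 n)‖ ^ 2 ≤ ‖H1per.grad u‖ ^ 2 := by
    refine hasSum_le (fun k => ?_) (h1.mul_left _) h2
    by_cases hk : k = 0
    · rw [hk, fcoeff_zero]
      rw [norm_zero, zero_pow two_ne_zero, mul_zero]
      exact Finset.sum_nonneg fun _ _ => by positivity
    · obtain ⟨j, hj⟩ := Function.ne_iff.1 hk
      refine le_trans ?_ (Finset.single_le_sum (f := fun j => ‖fcoeff (H1per.grad u j) k‖ ^ 2)
        (fun _ _ => by positivity) (Finset.mem_univ j))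
      have hkj : (1 : ℝ) ≤ |(k j : ℝ)| := by
        rw [← Int.cast_abs]
        exact_mod_cast Int.one_le_abs hj
      simp only [fcoeff_grad u.isWeakGrad j k, norm_mul, Complex.norm_I, Complex.norm_real,
        Complex.norm_intCast, Real.norm_eq_abs, abs_of_pos hpi, RCLike.norm_ofNat, mul_one]
      rw [mul_pow _ ‖_‖]
      refine mul_le_mul_of_nonneg_right ?_ (by positivity)
      exact pow_le_pow_left₀ (by positivity) (le_mul_of_one_le_right (by positivity) hkj) 2
  rw [← mul_pow] at h3
  have h4 := le_of_sq_le_sq h3 (norm_nonneg _)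
  rw [one_div, inv_mul_eq_div, le_div_iff₀ (by positivity), mul_comm]
  exact h4

theorem H1per.grad_injective (n : ℕ) : Function.Injective (H1per.grad (n := n)) := by
  rw [injective_iff_map_eq_zero]
  intro u hu
  have h := H1per.poincare u
  rw [hu, norm_zero, mul_zero] at h
  exact Subtype.ext (Prod.ext (norm_le_zero_iff.1 h) hu)

instance (n : ℕ) : NormedAddCommGroup (H1per n) :=
  NormedAddCommGroup.induced (H1per n) (PiLp 2 (fun _ : Fin n => L2 n)) H1per.grad
    (H1per.grad_injective n)

instance (n : ℕ) : NormedSpace ℂ (H1per n) :=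
  NormedSpace.induced ℂ (H1per n) (PiLp 2 (fun _ : Fin n => L2 n)) H1per.grad

/-- The inner product `⟨u, v⟩ = ∫_Y ∇u · conj ∇v` of `H¹_#(0,Y)`; in Mathlib's convention this is
`inner ℂ v u`. -/
instance (n : ℕ) : InnerProductSpace ℂ (H1per n) where
  inner u v := inner ℂ (H1per.grad u) (H1per.grad v)
  norm_sq_eq_re_inner u := norm_sq_eq_re_inner (𝕜 := ℂ) (H1per.grad u)
  conj_inner_symm u v := inner_conj_symm (H1per.grad u) (H1per.grad v)
  add_left u v w := by simp only [map_add, inner_add_left]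
  smul_left u v c := by simp only [map_smul, inner_smul_left]

/-- The functional `u ↦ ∫_Y u f` on `L²(Y)`, for continuous `f`. -/
theorem continuous_integral_mul {n : ℕ} {f : (Fin n → ℝ) → ℂ} (hf : Continuous f) :
    Continuous (fun u : L2 n => ∫ x in cell n, u x * f x) := by
  have hK : IsCompact (Set.pi univ (fun _ : Fin n => Icc (0 : ℝ) 1)) :=
    isCompact_univ_pi (fun _ => isCompact_Icc)
  obtain ⟨C, hC⟩ := hK.exists_bound_of_continuousOn hf.continuousOn
  have hL : MemLp (fun x => conj (f x)) 2 (volume.restrict (cell n)) := by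
    refine MemLp.of_bound (by fun_prop : Continuous _).aestronglyMeasurable C ?_
    refine (ae_restrict_iff' (measurableSet_cell n)).2 (Eventually.of_forall fun x hx => ?_)
    rw [RCLike.norm_conj]
    exact hC x fun i _ => Ioc_subset_Icc_self (hx i)
  have h : (fun u : L2 n => ∫ x in cell n, u x * f x) = fun u => inner ℂ (hL.toLp _) u := by
    ext u
    rw [L2.inner_def]
    refine integral_congr_ae ?_
    filter_upwards [hL.coeFn_toLp] with x hx
    simp [hx]
  rw [h]
  fun_prop

theorem isClosed_meanZero (n : ℕ) : IsClosed (meanZero n : Set (L2 n)) := by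
  have h := isClosed_eq (continuous_integral_mul (n := n) (f := fun _ => 1) continuous_const)
    (continuous_const (y := (0 : ℂ)))
  simp only [mul_one] at h
  exact h

theorem isClosed_gradGraph (n : ℕ) :
    IsClosed (gradGraph n : Set (L2per n × PiLp 2 (fun _ : Fin n => L2 n))) := by
  have h : (gradGraph n : Set (L2per n × PiLp 2 (fun _ : Fin n => L2 n))) =
      ⋂ (φ : (Fin n → ℝ) → ℂ) (_ : IsPeriodicSmooth φ) (j : Fin n),
        {p | ∫ x in cell n, (p.1 : L2 n) x * partialDeriv j φ x
          = - ∫ x in cell n, p.2 j x * φ x} := by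
    ext p
    simp only [mem_iInter]
    rfl
  rw [h]
  refine isClosed_iInter fun φ => isClosed_iInter fun hφ => isClosed_iInter fun j => isClosed_eq ?_ ?_
  · exact (continuous_integral_mul (hφ.continuous_partialDeriv j)).comp
      (continuous_subtype_val.comp continuous_fst)
  · exact ((continuous_integral_mul hφ.smooth.continuous).comp
      ((PiLp.continuous_apply 2 _ j).comp continuous_snd)).neg

instance (n : ℕ) : CompleteSpace (L2per n) := (isClosed_meanZero n).completeSpace_coe

instance (n : ℕ) : CompleteSpace (H1per n) := by
  refine Metric.complete_of_cauchySeq_tendsto fun s hs => ?_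
  have h1 : ∀ a b, dist (H1per.grad (s a)) (H1per.grad (s b)) = dist (s a) (s b) := fun _ _ => rfl
  have h2 : CauchySeq (fun k => H1per.grad (s k)) := by
    rw [Metric.cauchySeq_iff] at hs ⊢
    simpa only [h1] using hs
  have h3 : CauchySeq (fun k => H1per.fn (s k)) := by
    have : LipschitzWith (Real.toNNReal (1 / (2 * Real.pi))) (H1per.fn (n := n)) :=
      (H1per.fn.mkContinuous (1 / (2 * Real.pi)) H1per.poincare).lipschitz.weaken
        (by
          rw [← NNReal.coe_le_coe, coe_nnnorm, Real.coe_toNNReal _ (by positivity)]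
          exact LinearMap.mkContinuous_norm_le _ (by positivity) _)
    exact hs.map this.uniformContinuous
  obtain ⟨g, hg⟩ := cauchySeq_tendsto_of_complete h2
  obtain ⟨u, hu⟩ := cauchySeq_tendsto_of_complete h3
  have h4 : (u, g) ∈ gradGraph n :=
    (isClosed_gradGraph n).mem_of_tendsto (hu.prodMk_nhds hg)
      (Eventually.of_forall fun k => (s k).2)
  refine ⟨(⟨(u, g), h4⟩ : ↥(gradGraph n)), ?_⟩
  have hg' := tendsto_iff_dist_tendsto_zero.1 hg
  exact tendsto_iff_dist_tendsto_zero.2 hg'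

/-- The embedding `H¹_#(0,Y) → L²_#(0,Y)`. -/
def embed (n : ℕ) : H1per n →L[ℂ] L2per n :=
  H1per.fn.mkContinuous (1 / (2 * Real.pi)) H1per.poincare

/-- The operator `(-Δ₀)⁻¹ : L²_#(0,Y) → H¹_#(0,Y)`: `w = (-Δ₀)⁻¹ f` is the solution in
`H¹_#(0,Y)` of `⟨w, v⟩ = (f, v)_{L²(Y)}` for all `v ∈ H¹_#(0,Y)`. -/
def invLaplace (n : ℕ) : L2per n →L[ℂ] H1per n := ContinuousLinearMap.adjoint (embed n)

/-! ### Inclusions and the decomposition of `H¹_#(0,Y)` -/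

/-- `D` has a `C^{1,γ}` boundary for some `γ > 0`: near each boundary point `D` is the sublevel
set of a `C^{1,γ}` function with nonvanishing derivative at that point. -/
def HasC1HolderBoundary {n : ℕ} (D : Set (Fin n → ℝ)) : Prop :=
  ∃ γ : ℝ≥0, 0 < γ ∧ ∀ p ∈ frontier D, ∃ (U : Set (Fin n → ℝ)) (ρ : (Fin n → ℝ) → ℝ) (C : ℝ≥0),
    IsOpen U ∧ p ∈ U ∧ ContDiffOn ℝ 1 ρ U ∧ HolderOnWith C γ (fderiv ℝ ρ) U ∧
    fderiv ℝ ρ p ≠ 0 ∧ D ∩ U = {x ∈ U | ρ x < 0}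

/-- The domain occupied by the inclusions: a nonempty open set with `C^{1,γ}` boundary (hence a
finite union of inclusions at positive distance from each other) that is completely contained
in the interior of the period cell. -/
structure IsInclusionDomain {n : ℕ} (D : Set (Fin n → ℝ)) : Prop where
  isOpen : IsOpen D
  nonempty : D.Nonempty
  closure_subset : closure D ⊆ {x | ∀ i, x i ∈ Ioo (0 : ℝ) 1}
  boundary : HasC1HolderBoundary D

/-- `W₁`: the closure in `H¹_#(0,Y)` of the functions with support away from `D`. -/
def W1 {n : ℕ} (D : Set (Fin n → ℝ)) : Submodule ℂ (H1per n) :=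
  (Submodule.span ℂ {u : H1per n | ∃ U : Set (Fin n → ℝ), IsOpen U ∧ closure D ⊆ U ∧
    ∀ᵐ x ∂volume.restrict (cell n), x ∈ U → (H1per.fn u : L2 n) x = 0}).topologicalClosure

/-- `H¹₀(D)` extended by zero to `Y`, as the set of pairs `(ũ, ∇ũ)`: the closure in `H¹` of the
test functions `C_c^∞(D)`. -/
def H10 {n : ℕ} (D : Set (Fin n → ℝ)) : Set (L2 n × (Fin n → L2 n)) :=
  closure {p | ∃ φ : (Fin n → ℝ) → ℂ, ContDiff ℝ ∞ φ ∧ HasCompactSupport φ ∧ tsupport φ ⊆ D ∧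
    p.1 =ᵐ[volume.restrict (cell n)] φ ∧
    ∀ j, p.2 j =ᵐ[volume.restrict (cell n)] partialDeriv j φ}

/-- `W₂ = {ũ - (∫_D ũ) 1_Y : ũ ∈ H¹₀(D)}`. (This set is already a closed subspace of
`H¹_#(0,Y)`.) -/
def W2 {n : ℕ} (D : Set (Fin n → ℝ)) : Submodule ℂ (H1per n) :=
  (Submodule.span ℂ {u : H1per n | ∃ w ∈ H10 D,
    (H1per.fn u : L2 n) =ᵐ[volume.restrict (cell n)]
      fun x => w.1 x - ∫ y in D, w.1 y}).topologicalClosure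

/-- `W₃ = (W₁ ⊕ W₂)^⊥`. -/
def W3 {n : ℕ} (D : Set (Fin n → ℝ)) : Submodule ℂ (H1per n) := (W1 D ⊔ W2 D)ᗮ

/-- `∫_{Y ∩ S} ∇u · conj ∇v`. -/
def gradForm {n : ℕ} (S : Set (Fin n → ℝ)) (u v : H1per n) : ℂ :=
  ∑ j, ∫ x in S, H1per.grad u j x * conj (H1per.grad v j x) ∂(volume.restrict (cell n))

theorem gradForm_add {n : ℕ} (S : Set (Fin n → ℝ)) (u u' v : H1per n) :
    gradForm S (u + u') v = gradForm S u v + gradForm S u' v := by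
  have hi (f g : L2 n) : Integrable (fun x => f x * conj (g x)) (volume.restrict (cell n)) := by
    refine (L2.integrable_inner (𝕜 := ℂ) g f).congr (Eventually.of_forall fun x => ?_)
    simp
  unfold gradForm
  rw [← Finset.sum_add_distrib]
  refine Finset.sum_congr rfl fun j _ => ?_
  rw [← integral_add (hi _ _).restrict (hi _ _).restrict]
  refine integral_congr_ae (ae_restrict_of_ae ?_)
  filter_upwards [Lp.coeFn_add (H1per.grad u j) (H1per.grad u' j)] with x hx
  rw [map_add, PiLp.add_apply, hx, Pi.add_apply, add_mul]

theorem gradForm_smul {n : ℕ} (S : Set (Fin n → ℝ)) (c : ℂ) (u v : H1per n) :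
    gradForm S (c • u) v = c * gradForm S u v := by
  unfold gradForm
  rw [Finset.mul_sum]
  refine Finset.sum_congr rfl fun j _ => ?_
  rw [← integral_const_mul]
  refine integral_congr_ae (ae_restrict_of_ae ?_)
  filter_upwards [Lp.coeFn_smul c (H1per.grad u j)] with x hx
  rw [map_smul, PiLp.smul_apply, hx, Pi.smul_apply, smul_eq_mul, mul_assoc]

/-- The sesquilinear form
`⟨Tu, v⟩ = ½ ∫_{Y∖D} ∇u · conj ∇v - ½ ∫_D ∇u · conj ∇v` of the operator `T`. -/
def resonanceForm {n : ℕ} (D : Set (Fin n → ℝ)) (u v : H1per n) : ℂ :=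
  1 / 2 * gradForm Dᶜ u v - 1 / 2 * gradForm D u v

/-- The eigenspace of `T : W₃ → W₃` for `μ`: all `u ∈ W₃` with `⟨Tu, v⟩ = μ ⟨u, v⟩` for all
`v ∈ W₃`. -/
def resonanceSpace {n : ℕ} (D : Set (Fin n → ℝ)) (μ : ℝ) : Submodule ℂ (H1per n) where
  carrier := {u | u ∈ W3 D ∧ ∀ v ∈ W3 D, resonanceForm D u v = μ * inner ℂ v u}
  zero_mem' := by
    refine ⟨Submodule.zero_mem _, fun v _ => ?_⟩
    have h (S : Set (Fin n → ℝ)) : gradForm S 0 v = 0 := by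
      simpa using gradForm_smul S 0 0 v
    simp [resonanceForm, h]
  add_mem' := by
    intro a b ha hb
    refine ⟨Submodule.add_mem _ ha.1 hb.1, fun v hv => ?_⟩
    have h1 := ha.2 v hv
    have h2 := hb.2 v hv
    simp only [resonanceForm, gradForm_add, inner_add_right] at *
    linear_combination h1 + h2
  smul_mem' := by
    intro c a ha
    refine ⟨Submodule.smul_mem _ c ha.1, fun v hv => ?_⟩
    have h1 := ha.2 v hv
    simp only [resonanceForm, gradForm_smul, inner_smul_right] at *
    linear_combination c * h1

/-- `μ` is a quasi-periodic resonance eigenvalue of `D` for `α = 0`, that is, an eigenvalue of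
`T : W₃ → W₃`. -/
def IsResonance {n : ℕ} (D : Set (Fin n → ℝ)) (μ : ℝ) : Prop := resonanceSpace D μ ≠ ⊥

/-! ### The operator family `A⁰(z)` -/

/-- The orthogonal projection of `H¹_#(0,Y)` onto (the closure of) a subspace. -/
def proj {n : ℕ} (W : Submodule ℂ (H1per n)) : H1per n →L[ℂ] H1per n :=
  W.topologicalClosure.starProjection

/-- `P₁ = Q₁ + P_{1/2}`, with `Q₁` the projection onto `W₁` and `P_{1/2}` the projection onto the
eigenspace of `T` for `1/2`. -/
def P1 {n : ℕ} (D : Set (Fin n → ℝ)) : H1per n →L[ℂ] H1per n :=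
  proj (W1 D) + proj (resonanceSpace D (1 / 2))

/-- `P₂`, the projection onto `W₂`. -/
def P2 {n : ℕ} (D : Set (Fin n → ℝ)) : H1per n →L[ℂ] H1per n := proj (W2 D)

/-- The resonance eigenvalues in the open interval `(-1/2, 1/2)`. -/
abbrev InnerResonance {n : ℕ} (D : Set (Fin n → ℝ)) :=
  {μ : ℝ // IsResonance D μ ∧ -1 / 2 < μ ∧ μ < 1 / 2}

/-- The term `[(1/2 + μ) + z (1/2 - μ)]⁻¹ P_μ (-Δ₀)⁻¹`, as an operator on `L²_#(0,Y)`. -/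
def resonanceTerm {n : ℕ} (D : Set (Fin n → ℝ)) (z : ℂ) (μ : InnerResonance D) :
    L2per n →L[ℂ] L2per n :=
  ((1 / 2 + (μ.1 : ℂ)) + z * (1 / 2 - (μ.1 : ℂ)))⁻¹ •
    (embed n ∘L proj (resonanceSpace D μ.1) ∘L invLaplace n)

/-- The operator on `L²_#(0,Y)`
`A⁰(z) = (z P₁ + P₂ + z ∑_{-1/2 < μ < 1/2} [(1/2 + μ) + z (1/2 - μ)]⁻¹ P_μ) (-Δ₀)⁻¹`,
that is, `A⁰(1/k) = (T_k)⁻¹ (-Δ₀)⁻¹` for `⟨T_k u, v⟩ = k ∫_{Y∖D} ∇u · conj ∇v + ∫_D ∇u · conj ∇v`,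
in the spectral form that defines it for `z = 0` as well. The series converges in operator norm
because `(-Δ₀)⁻¹` is compact. -/
def A {n : ℕ} (D : Set (Fin n → ℝ)) (z : ℂ) : L2per n →L[ℂ] L2per n :=
  z • (embed n ∘L P1 D ∘L invLaplace n) + embed n ∘L P2 D ∘L invLaplace n
    + z • ∑' μ : InnerResonance D, resonanceTerm D z μ

/-! ### Contours and spectral projections -/

/-- The contour integral `∮_Γ F(ζ) dζ` along `Γ : [0,1] → ℂ`. -/
def contourIntegral {E : Type*} [NormedAddCommGroup E] [NormedSpace ℂ E] (Γ : ℝ → ℂ)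
    (F : ℂ → E) : E :=
  ∫ t in (0 : ℝ)..1, deriv Γ t • F (Γ t)

/-- The set of points on the contour. -/
def contourSet (Γ : ℝ → ℂ) : Set ℂ := Γ '' Icc 0 1

/-- The winding number `(2πi)⁻¹ ∮_Γ (ζ - w)⁻¹ dζ`. -/
def winding (Γ : ℝ → ℂ) (w : ℂ) : ℂ :=
  (2 * Real.pi * Complex.I)⁻¹ * contourIntegral Γ (fun ζ => (ζ - w)⁻¹)

/-- The points enclosed by the contour. -/
def inside (Γ : ℝ → ℂ) : Set ℂ := {w | w ∉ contourSet Γ ∧ winding Γ w = 1}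

/-- The points exterior to the contour. -/
def outside (Γ : ℝ → ℂ) : Set ℂ := {w | w ∉ contourSet Γ ∧ winding Γ w = 0}

/-- Closed piecewise `C¹` contours that wind at most once, in the positive sense, around each
point off the contour; for example, the positively oriented piecewise `C¹` Jordan curves. -/
structure IsContour (Γ : ℝ → ℂ) : Prop where
  continuousOn : ContinuousOn Γ (Icc 0 1)
  closed : Γ 0 = Γ 1
  piecewise : ∃ (s : Finset ℝ) (C : ℝ), ∀ t ∈ Ioo (0 : ℝ) 1, t ∉ s →
    DifferentiableAt ℝ Γ t ∧ ContinuousAt (deriv Γ) t ∧ ‖deriv Γ t‖ ≤ C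
  simple : ∀ w, w ∉ contourSet Γ → w ∈ inside Γ ∪ outside Γ

section Operators

variable {K : Type*} [NormedAddCommGroup K] [NormedSpace ℂ K]

/-- `R(ζ) = (B - ζ)⁻¹` (and `0` if `B - ζ` is not invertible). -/
def resolv (B : K →L[ℂ] K) (ζ : ℂ) : K →L[ℂ] K := Ring.inverse (B - ζ • 1)

/-- `-(2πi)⁻¹ ∮_Γ (B - ζ)⁻¹ dζ`. -/
def riesz (Γ : ℝ → ℂ) (B : K →L[ℂ] K) : K →L[ℂ] K :=
  (-1 / (2 * Real.pi * Complex.I)) • contourIntegral Γ (resolv B)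

/-- `P` is the spectral projection of `B` for the part of its spectrum in `S`: a bounded projection
that commutes with `B`, such that the restrictions of `B` to the invariant subspaces `ran P` and
`ker P` have the spectra `σ(B) ∩ S` and `σ(B) ∖ S`. -/
structure IsSpectralProjection (B : K →L[ℂ] K) (S : Set ℂ) (P : K →L[ℂ] K) : Prop where
  idem : P * P = P
  comm : B * P = P * B
  inv_range : ∀ x ∈ P.range, (B : K →ₗ[ℂ] K) x ∈ P.range
  inv_ker : ∀ x ∈ P.ker, (B : K →ₗ[ℂ] K) x ∈ P.ker
  spectrum_range : spectrum ℂ ((B : K →ₗ[ℂ] K).restrict inv_range) = spectrum ℂ B ∩ S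
  spectrum_ker : spectrum ℂ ((B : K →ₗ[ℂ] K).restrict inv_ker) = spectrum ℂ B \ S

/-- The trace of an operator `F` of finite rank, as the trace of `F` on its range. -/
def finiteRankTrace (F : K →L[ℂ] K) : ℂ :=
  LinearMap.trace ℂ F.range ((F : K →ₗ[ℂ] K).restrict
    (p := F.range) (q := F.range) (fun x _ => LinearMap.mem_range_self _ x))

/-- The coefficients of the power series `B(z) = ∑ zᵏ Bₖ`. -/
def powerCoeff (B : ℂ → K →L[ℂ] K) (k : ℕ) : K →L[ℂ] K :=
  ((k.factorial : ℂ)⁻¹) • iteratedDeriv k B 0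

/-- The weighted mean `β̂(z) = m⁻¹ tr (B(z) P(z))` of the group of the `m = dim ran P(0)` eigenvalues
of `B(z)` enclosed by `Γ`. -/
def weightedMean (Γ : ℝ → ℂ) (B : ℂ → K →L[ℂ] K) (z : ℂ) : ℂ :=
  (Module.finrank ℂ (riesz Γ (B 0)).range : ℂ)⁻¹ * finiteRankTrace (B z * riesz Γ (B z))

/-- The coefficient
`βₙ = (2πi m)⁻¹ tr ∑_{k₁+⋯+kₚ=n} ((-1)ᵖ/p) ∮_Γ B_{k₁} R(ζ,0) B_{k₂} ⋯ R(ζ,0) B_{kₚ} R(ζ,0) dζ`,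
the sum being over all `p ≥ 1` and all `k₁, …, kₚ ≥ 1` with sum `n`. -/
def meanCoeff (Γ : ℝ → ℂ) (B : ℂ → K →L[ℂ] K) (n : ℕ) : ℂ :=
  (2 * Real.pi * Complex.I * (Module.finrank ℂ (riesz Γ (B 0)).range : ℂ))⁻¹ *
    finiteRankTrace (∑ c : Composition n, ((-1 : ℂ) ^ c.length / (c.length : ℂ)) •
      contourIntegral Γ (fun ζ =>
        (c.blocks.map (fun k => powerCoeff B k * resolv (B 0) ζ)).prod))

end Operators

end

end HighContrast

open MeasureTheory Set Filter Topology
open scoped ContDiff ComplexConjugate NNReal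

namespace HighContrast

set_option linter.unusedSectionVars false

noncomputable section

/-! ### Contour integration as a continuous linear map -/

section Contour

variable {Γ : ℝ → ℂ} {E : Type*} [NormedAddCommGroup E] [NormedSpace ℂ E]

/-! Let `E` be the embedding of H¹ into L². Then (-Δ₀)⁻¹ is the adjoint `E*`, and A⁰(0) = E P₂ E* is
compact and selfadjoint. The proof shows that Γ stays in the resolvent set of A⁰(z) on a disc
strictly larger than |z| < r*; analytic perturbation theory on that disc gives the rest.

Size of the perturbation. Put τ = 1/2 + μ⁻ and κ = 1/2 - μ⁻. Then A⁰(z) - A⁰(0) = z E (P₁ + ∑ c_ν(z)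
P_ν) E*, where |c_ν(z)| ≤ C = (τ - |z|κ)⁻¹. The ranges are mutually orthogonal, the eigenspaces lie
in W₃, and the coefficient on W₁ is only 1. Hence the sum factors as S M S with S = P_{W₃} + √τ Q₁
and ‖M‖ ≤ C, so the perturbation is at most |z| C θ² with θ = ‖E S‖
(`norm_comp_sum_comp_adjoint_le`, `norm_A_sub_le`). Poincaré's inequality gives θ ≤ 1/(2π), and for
θ = 1/(2π) the condition |z| C θ² < d reads |z| < r*. The resolvent bound 1/dist for selfadjoint
operators and a Neumann series then keep Γ in the resolvent set.

Strictness. Uniform convergence on the whole open disc needs a larger disc, that is, θ < 1/(2π)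
(`norm_embed_comp_weightOp_lt`). The compact operator E S attains its norm; if θ were 1/(2π),
Poincaré's inequality would be an equality for some nonzero a ∈ W₃. Such an a is a trigonometric
polynomial with frequencies |k| = 1, and an eigenfunction of E*E. As a ⟂ W₂ in H¹, it is orthogonal
to W₂ in L² too, so it vanishes on D, and by analyticity everywhere (`eq_zero_of_mem_W3`).

Contours. Only the winding numbers of Γ are known, so Cauchy's theorem is proved by Dixon's
argument: a function of w given by one formula near the enclosed points and by another outside is
entire and vanishes at infinity. The same device shows that the Riesz integral is idempotent
(`rieszElem_mul_self`). Integrands are elements of the Banach algebra of continuous functions on the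
parameter interval, so holomorphy in a parameter passes through the integral as through any
continuous linear map.

Coefficients. With b(z) = tr(A(z)P(z)) one has b' = tr(A'P). Expanding the resolvent in P gives the
n-th coefficient of b as n⁻¹ times a sum over compositions of n in which a term carries its first
block k₁ as weight. The traces are invariant under cyclic rotation of the blocks, so k₁ may be
replaced by its mean n/p, which yields the factor 1/p. Cyclicity is not automatic, since the
integrands need not have finite rank. It holds because A(0)P(0) = β₀P(0) makes the pole at β₀
simple, and a product of p resolvents integrates to a derivative of order p - 1, each Leibniz term
of which retains a factor with P(0). -/

theorem IsContour.exists_ae_bound (hΓ : IsContour Γ) :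
    ∃ C : ℝ, ∀ᵐ t ∂volume.restrict (uIoc (0 : ℝ) 1), ‖deriv Γ t‖ ≤ C := by
  obtain ⟨s, C, h⟩ := hΓ.piecewise
  refine ⟨C, ?_⟩
  rw [uIoc_of_le zero_le_one, ae_restrict_iff' measurableSet_Ioc]
  have hs : ∀ᵐ t ∂(volume : Measure ℝ), t ∉ (insert 1 (s : Set ℝ)) :=
    measure_eq_zero_iff_ae_notMem.1 ((s.finite_toSet.insert 1).measure_zero volume)
  filter_upwards [hs] with t ht h01
  rw [mem_insert_iff, not_or] at ht
  exact (h t ⟨h01.1, lt_of_le_of_ne h01.2 ht.1⟩ ht.2).2.2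

/-- The restriction of an integrand to the contour. -/
def extendUnit (F : C(unitInterval, E)) (t : ℝ) : E := F (projIcc 0 1 zero_le_one t)

theorem continuous_extendUnit (F : C(unitInterval, E)) : Continuous (extendUnit F) :=
  F.continuous.comp continuous_projIcc

theorem norm_extendUnit_le (F : C(unitInterval, E)) (t : ℝ) : ‖extendUnit F t‖ ≤ ‖F‖ :=
  F.norm_coe_le_norm _

theorem IsContour.intervalIntegrable (hΓ : IsContour Γ) (F : C(unitInterval, E)) :
    IntervalIntegrable (fun t => deriv Γ t • extendUnit F t) volume 0 1 := by
  obtain ⟨C, hC⟩ := hΓ.exists_ae_bound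
  rw [intervalIntegrable_iff]
  refine Measure.integrableOn_of_bounded (M := C * ‖F‖) (by simp) ?_ ?_
  · exact (measurable_deriv Γ).aestronglyMeasurable.smul
      (continuous_extendUnit F).aestronglyMeasurable
  · filter_upwards [hC] with t ht
    rw [norm_smul]
    exact mul_le_mul ht (norm_extendUnit_le F t) (norm_nonneg _) ((norm_nonneg _).trans ht)

/-- Integration along the contour, on the space of continuous integrands. -/
def contourCLM (hΓ : IsContour Γ) : C(unitInterval, E) →L[ℂ] E :=
  LinearMap.mkContinuousOfExistsBound
    { toFun := fun F => ∫ t in (0 : ℝ)..1, deriv Γ t • extendUnit F t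
      map_add' := fun F G => by
        rw [← intervalIntegral.integral_add (hΓ.intervalIntegrable F) (hΓ.intervalIntegrable G)]
        simp only [extendUnit, ContinuousMap.add_apply, smul_add]
      map_smul' := fun c F => by
        rw [RingHom.id_apply, ← intervalIntegral.integral_smul]
        simp only [extendUnit, ContinuousMap.smul_apply, smul_comm c] }
    (by
      obtain ⟨C, hC⟩ := hΓ.exists_ae_bound
      refine ⟨C, fun F => ?_⟩
      have h : ∀ᵐ t ∂volume.restrict (uIoc (0 : ℝ) 1), ‖deriv Γ t • extendUnit F t‖ ≤ C * ‖F‖ := by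
        filter_upwards [hC] with t ht
        rw [norm_smul]
        exact mul_le_mul ht (norm_extendUnit_le F t) (norm_nonneg _) ((norm_nonneg _).trans ht)
      have := intervalIntegral.norm_integral_le_of_norm_le_const_ae
        ((ae_restrict_iff' measurableSet_uIoc).1 h)
      simpa using this)

theorem contourCLM_apply (hΓ : IsContour Γ) (F : C(unitInterval, E)) :
    contourCLM hΓ F = ∫ t in (0 : ℝ)..1, deriv Γ t • extendUnit F t := rfl

theorem contourIntegral_eq (hΓ : IsContour Γ) {f : ℂ → E} {F : C(unitInterval, E)}
    (h : ∀ t : unitInterval, f (Γ t) = F t) : contourIntegral Γ f = contourCLM hΓ F := by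
  rw [contourCLM_apply, contourIntegral]
  refine intervalIntegral.integral_congr fun t ht => ?_
  rw [uIcc_of_le zero_le_one] at ht
  simp only [extendUnit]
  rw [projIcc_of_mem _ ht, ← h]

theorem map_contourCLM [CompleteSpace E] {E' : Type*} [NormedAddCommGroup E'] [NormedSpace ℂ E']
    [CompleteSpace E'] (hΓ : IsContour Γ) (L : E →L[ℂ] E') {F : C(unitInterval, E)}
    {F' : C(unitInterval, E')} (h : ∀ t, F' t = L (F t)) :
    contourCLM hΓ F' = L (contourCLM hΓ F) := by
  rw [contourCLM_apply, contourCLM_apply,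
    ← ContinuousLinearMap.intervalIntegral_comp_comm L (hΓ.intervalIntegrable F)]
  simp only [extendUnit, map_smul, h]

end Contour

/-! ### Winding numbers and Cauchy's theorem -/

section Winding

variable {Γ : ℝ → ℂ} {R : Type*} [NormedRing R] [NormedAlgebra ℂ R] [CompleteSpace R]

theorem map_ringInverse_of_isUnit {S T : Type*} [MonoidWithZero S] [MonoidWithZero T] (f : S →* T)
    {u : S} (hu : IsUnit u) : f (Ring.inverse u) = Ring.inverse (f u) := by
  obtain ⟨u, rfl⟩ := hu
  rw [Ring.inverse_unit]
  exact (Ring.inverse_unit (Units.map f u)).symm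

theorem ringInverse_neg {S : Type*} [Ring S] (u : S) : Ring.inverse (-u) = -Ring.inverse u := by
  by_cases hu : IsUnit u
  · obtain ⟨u, rfl⟩ := hu
    rw [← Units.val_neg, Ring.inverse_unit, Ring.inverse_unit, inv_neg, Units.val_neg]
  · rw [Ring.inverse_non_unit _ hu, Ring.inverse_non_unit _ (by rwa [IsUnit.neg_iff]), neg_zero]

theorem ringInverse_apply {X : Type*} [TopologicalSpace X] [CompactSpace X] {u : C(X, R)}
    (hu : IsUnit u) (x : X) : Ring.inverse u x = Ring.inverse (u x) :=
  map_ringInverse_of_isUnit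
    ({ toFun := fun f => f x, map_one' := rfl, map_mul' := fun _ _ => rfl } : C(X, R) →* R) hu

/-- The constant functions, as a continuous linear map. -/
def constCLM : R →L[ℂ] C(unitInterval, R) :=
  LinearMap.mkContinuous
    { toFun := fun a => ContinuousMap.const _ a
      map_add' := fun _ _ => rfl
      map_smul' := fun _ _ => rfl } 1
    (fun a => by
      rw [one_mul]
      exact (ContinuousMap.norm_le _ (norm_nonneg a)).2 fun _ => le_rfl)

@[simp] theorem constCLM_apply (a : R) (t : unitInterval) : constCLM a t = a := rfl

theorem constCLM_mul (a b : R) : constCLM (a * b) = constCLM a * constCLM b := rfl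

theorem constCLM_one : constCLM (1 : R) = 1 := rfl

theorem contourCLM_const_mul (hΓ : IsContour Γ) (a : R) (F : C(unitInterval, R)) :
    contourCLM hΓ (constCLM a * F) = a * contourCLM hΓ F :=
  map_contourCLM hΓ (ContinuousLinearMap.mul ℂ R a) fun _ => rfl

theorem contourCLM_mul_const (hΓ : IsContour Γ) (F : C(unitInterval, R)) (a : R) :
    contourCLM hΓ (F * constCLM a) = contourCLM hΓ F * a :=
  map_contourCLM hΓ ((ContinuousLinearMap.mul ℂ R).flip a) fun _ => rfl

variable (R) in
/-- The function `ζ ↦ ζ • 1` on the contour. -/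
def contourVar (hΓ : IsContour Γ) : C(unitInterval, R) :=
  ⟨fun t => algebraMap ℂ R (Γ t),
    (algebraMapCLM ℂ R).continuous.comp (continuousOn_iff_continuous_domRestrict.1 hΓ.continuousOn)⟩

theorem contourVar_commute (hΓ : IsContour Γ) (F : C(unitInterval, R)) :
    Commute (contourVar R hΓ) F := by
  ext t
  exact Algebra.commutes (Γ t) (F t)

theorem isUnit_contourVar_sub (hΓ : IsContour Γ) {w : ℂ} (hw : w ∉ contourSet Γ) :
    IsUnit (contourVar R hΓ - algebraMap ℂ _ w) := by
  rw [ContinuousMap.isUnit_iff_forall_isUnit]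
  intro t
  have h : Γ t - w ≠ 0 := fun h => hw ⟨t, t.2, sub_eq_zero.1 h⟩
  have h2 : (contourVar R hΓ - algebraMap ℂ C(unitInterval, R) w) t
      = algebraMap ℂ R (Γ t - w) := by
    rw [map_sub]; rfl
  rw [h2]
  exact (IsUnit.mk0 _ h).map _

variable (R) in
/-- The Cauchy kernel `ζ ↦ (ζ - w)⁻¹` on the contour. -/
def cauchyKernel (hΓ : IsContour Γ) (w : ℂ) : C(unitInterval, R) :=
  Ring.inverse (contourVar R hΓ - algebraMap ℂ _ w)

theorem cauchyKernel_apply (hΓ : IsContour Γ) {w : ℂ} (hw : w ∉ contourSet Γ) (t : unitInterval) :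
    cauchyKernel R hΓ w t = algebraMap ℂ R (Γ t - w)⁻¹ := by
  rw [cauchyKernel, ringInverse_apply (isUnit_contourVar_sub hΓ hw)]
  have h2 : (contourVar R hΓ - algebraMap ℂ C(unitInterval, R) w) t
      = algebraMap ℂ R (Γ t - w) := by
    rw [map_sub]; rfl
  have h : Γ t - w ≠ 0 := fun h => hw ⟨t, t.2, sub_eq_zero.1 h⟩
  rw [h2, ← Ring.inverse_eq_inv']
  exact (map_ringInverse_of_isUnit (algebraMap ℂ R : ℂ →* R) (IsUnit.mk0 _ h)).symm

theorem isCompact_contourSet (hΓ : IsContour Γ) : IsCompact (contourSet Γ) :=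
  isCompact_Icc.image_of_continuousOn hΓ.continuousOn

theorem isOpen_compl_contourSet (hΓ : IsContour Γ) : IsOpen (contourSet Γ)ᶜ :=
  (isCompact_contourSet hΓ).isClosed.isOpen_compl

theorem differentiableAt_cauchyKernel (hΓ : IsContour Γ) {w : ℂ} (hw : w ∉ contourSet Γ) :
    DifferentiableAt ℂ (cauchyKernel R hΓ) w := by
  unfold cauchyKernel
  refine DifferentiableAt.inverse (𝕜 := ℂ) (h := fun w => contourVar R hΓ - algebraMap ℂ _ w) ?_
    (isUnit_contourVar_sub hΓ hw)
  exact (differentiableAt_const _).sub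
    (algebraMapCLM ℂ C(unitInterval, R)).differentiableAt

/-- Up to sign the kernel is the resolvent of `contourVar`, regarded as an element of a Banach
algebra, and resolvents vanish at infinity. -/
theorem tendsto_cauchyKernel (hΓ : IsContour Γ) :
    Tendsto (cauchyKernel R hΓ) (cocompact ℂ) (𝓝 0) := by
  have h := spectrum.resolvent_tendsto_cobounded (𝕜 := ℂ) (contourVar R hΓ)
  rw [Metric.cobounded_eq_cocompact] at h
  have h2 : cauchyKernel R hΓ = fun w => -(resolvent (contourVar R hΓ) w) := by
    ext1 w
    rw [cauchyKernel, resolvent, ← neg_sub]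
    exact ringInverse_neg _
  rw [h2]
  simpa using h.neg

theorem contourCLM_cauchyKernel (hΓ : IsContour Γ) {w : ℂ} (hw : w ∉ contourSet Γ) :
    contourCLM hΓ (cauchyKernel R hΓ w)
      = algebraMap ℂ R (2 * Real.pi * Complex.I * winding Γ w) := by
  have h1 : contourIntegral Γ (fun ζ => (ζ - w)⁻¹) = contourCLM hΓ (cauchyKernel ℂ hΓ w) :=
    contourIntegral_eq hΓ fun t => by rw [cauchyKernel_apply hΓ hw]; rfl
  rw [winding, mul_inv_cancel_left₀ Complex.two_pi_I_ne_zero, h1]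
  exact map_contourCLM hΓ (algebraMapCLM ℂ R) fun t => by
    rw [cauchyKernel_apply hΓ hw, cauchyKernel_apply hΓ hw]; rfl

theorem winding_eq_contourCLM (hΓ : IsContour Γ) {w : ℂ} (hw : w ∉ contourSet Γ) :
    winding Γ w = (2 * Real.pi * Complex.I)⁻¹ * contourCLM hΓ (cauchyKernel ℂ hΓ w) := by
  rw [contourCLM_cauchyKernel hΓ hw]
  exact (inv_mul_cancel_left₀ Complex.two_pi_I_ne_zero _).symm

theorem continuousOn_winding (hΓ : IsContour Γ) :
    ContinuousOn (winding Γ) (contourSet Γ)ᶜ := by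
  have h : ContinuousOn (fun w => (2 * Real.pi * Complex.I)⁻¹ *
      contourCLM hΓ (cauchyKernel ℂ hΓ w)) (contourSet Γ)ᶜ := fun w hw =>
    (continuousAt_const.mul ((contourCLM hΓ).continuous.continuousAt.comp
      (differentiableAt_cauchyKernel hΓ hw).continuousAt)).continuousWithinAt
  exact h.congr fun w hw => winding_eq_contourCLM hΓ hw

/-- Off the contour the winding number takes only the values 0 and 1. This form exhibits the
enclosed points as the preimage of an open set, which gives openness from continuity of the winding
number. -/
theorem inside_eq (hΓ : IsContour Γ) : inside Γ = (contourSet Γ)ᶜ ∩ winding Γ ⁻¹' {0}ᶜ := by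
  ext w
  constructor
  · rintro ⟨h1, h2⟩
    exact ⟨h1, by simp [h2]⟩
  · rintro ⟨h1, h2⟩
    exact (hΓ.simple w h1).resolve_right fun h => h2 h.2

theorem outside_eq (hΓ : IsContour Γ) : outside Γ = (contourSet Γ)ᶜ ∩ winding Γ ⁻¹' {1}ᶜ := by
  ext w
  constructor
  · rintro ⟨h1, h2⟩
    exact ⟨h1, by simp [h2]⟩
  · rintro ⟨h1, h2⟩
    exact (hΓ.simple w h1).resolve_left fun h => h2 h.2

theorem isOpen_inside (hΓ : IsContour Γ) : IsOpen (inside Γ) := by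
  rw [inside_eq hΓ]
  exact (continuousOn_winding hΓ).isOpen_inter_preimage (isOpen_compl_contourSet hΓ)
    isOpen_compl_singleton

theorem isOpen_outside (hΓ : IsContour Γ) : IsOpen (outside Γ) := by
  rw [outside_eq hΓ]
  exact (continuousOn_winding hΓ).isOpen_inter_preimage (isOpen_compl_contourSet hΓ)
    isOpen_compl_singleton

theorem disjoint_inside_outside (Γ : ℝ → ℂ) : Disjoint (inside Γ) (outside Γ) := by
  rw [Set.disjoint_left]
  rintro w ⟨_, h1⟩ ⟨_, h2⟩
  exact zero_ne_one (h2.symm.trans h1)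

/-- The winding number tends to 0 at infinity, so it eventually differs from 1, the only other
admissible value. -/
theorem eventually_mem_outside (hΓ : IsContour Γ) : ∀ᶠ w in cocompact ℂ, w ∈ outside Γ := by
  have h1 : ∀ᶠ w in cocompact ℂ, w ∉ contourSet Γ :=
    (isCompact_contourSet hΓ).compl_mem_cocompact
  have h2 : Tendsto (fun w => (2 * Real.pi * Complex.I)⁻¹ *
      contourCLM hΓ (cauchyKernel ℂ hΓ w)) (cocompact ℂ) (𝓝 0) := by
    have := (((contourCLM hΓ).continuous.tendsto 0).comp
      (tendsto_cauchyKernel (R := ℂ) hΓ)).const_mul ((2 * Real.pi * Complex.I)⁻¹)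
    simpa using this
  have h3 := h2.eventually (isOpen_compl_singleton.mem_nhds (zero_ne_one (α := ℂ)))
  filter_upwards [h1, h3] with w hw hw'
  rw [outside_eq hΓ]
  refine ⟨hw, ?_⟩
  rw [mem_preimage, winding_eq_contourCLM hΓ hw]
  exact hw'

/-- **Cauchy's theorem** for a function `f` with a divided difference `φ w ζ = (f ζ - f w)/(ζ - w)`
that depends holomorphically on `w`. -/
theorem contourCLM_slope_eq_zero (hΓ : IsContour Γ) {Ω : Set ℂ} (hΩ : IsOpen Ω)
    (hout : Ωᶜ ⊆ outside Γ) {F : C(unitInterval, R)} {f : ℂ → R} {φ : ℂ → C(unitInterval, R)}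
    (hdiff : DifferentiableOn ℂ φ Ω)
    (hφ : ∀ w ∈ Ω, (contourVar R hΓ - algebraMap ℂ _ w) * φ w = F - constCLM (f w)) {w : ℂ}
    (hw : w ∈ Ω) : contourCLM hΓ (φ w) = 0 := by
  classical
  -- Dixon's function. The two definitions agree on `Ω ∩ outside Γ`, because the term with `f w` is
  -- multiplied by the winding number 0. Thus `G` is entire and tends to 0 at infinity, and
  -- Liouville's theorem applies.
  let k : ℂ → R := fun w => contourCLM hΓ (cauchyKernel R hΓ w * F)
  let G : ℂ → R := fun w => if w ∈ Ω then contourCLM hΓ (φ w) else k w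
  have hk : ∀ w ∈ outside Γ, G w = k w := by
    intro w hw
    by_cases hwΩ : w ∈ Ω
    · have h1 : φ w = cauchyKernel R hΓ w * (F - constCLM (f w)) := by
        rw [← hφ w hwΩ, cauchyKernel,
          Ring.inverse_mul_cancel_left _ _ (isUnit_contourVar_sub hΓ hw.1)]
      simp only [G, if_pos hwΩ, k]
      rw [h1, mul_sub, map_sub, contourCLM_mul_const, contourCLM_cauchyKernel hΓ hw.1, hw.2]
      simp
    · simp only [G, if_neg hwΩ]
  have hkd : ∀ w ∈ outside Γ, DifferentiableAt ℂ k w := fun w hw =>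
    (contourCLM hΓ).differentiableAt.comp w
      ((differentiableAt_cauchyKernel hΓ hw.1).mul (differentiableAt_const F))
  have hG : Differentiable ℂ G := by
    intro w
    by_cases hwΩ : w ∈ Ω
    · have h1 : G =ᶠ[𝓝 w] fun w => contourCLM hΓ (φ w) := by
        filter_upwards [hΩ.mem_nhds hwΩ] with v hv
        simp only [G, if_pos hv]
      refine DifferentiableAt.congr_of_eventuallyEq ?_ h1
      exact (contourCLM hΓ).differentiableAt.comp w (hdiff.differentiableAt (hΩ.mem_nhds hwΩ))
    · have hwo := hout hwΩ
      refine (hkd w hwo).congr_of_eventuallyEq ?_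
      filter_upwards [(isOpen_outside hΓ).mem_nhds hwo] with v hv using hk v hv
  have hlim : Tendsto G (cocompact ℂ) (𝓝 0) := by
    have h1 : Tendsto k (cocompact ℂ) (𝓝 0) := by
      have := ((contourCLM hΓ).continuous.tendsto 0).comp
        (by simpa using (tendsto_cauchyKernel (R := R) hΓ).mul_const F)
      rw [map_zero] at this
      exact this
    refine h1.congr' ?_
    filter_upwards [eventually_mem_outside hΓ] with v hv using (hk v hv).symm
  have h0 := hG.apply_eq_of_tendsto_cocompact w hlim
  simpa only [G, if_pos hw] using h0

/-- **Cauchy's formula** for a function with a holomorphic divided difference. -/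
theorem contourCLM_cauchyKernel_mul (hΓ : IsContour Γ) {Ω : Set ℂ} (hΩ : IsOpen Ω)
    (hout : Ωᶜ ⊆ outside Γ) {F : C(unitInterval, R)} {f : ℂ → R} {φ : ℂ → C(unitInterval, R)}
    (hdiff : DifferentiableOn ℂ φ Ω)
    (hφ : ∀ w ∈ Ω, (contourVar R hΓ - algebraMap ℂ _ w) * φ w = F - constCLM (f w)) {w : ℂ}
    (hw : w ∈ Ω) (hwΓ : w ∉ contourSet Γ) :
    contourCLM hΓ (cauchyKernel R hΓ w * F) = (2 * Real.pi * Complex.I * winding Γ w) • f w := by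
  have h1 : φ w = cauchyKernel R hΓ w * (F - constCLM (f w)) := by
    rw [← hφ w hw, cauchyKernel, Ring.inverse_mul_cancel_left _ _ (isUnit_contourVar_sub hΓ hwΓ)]
  have h2 := contourCLM_slope_eq_zero hΓ hΩ hout hdiff hφ hw
  rw [h1, mul_sub, map_sub, contourCLM_mul_const, contourCLM_cauchyKernel hΓ hwΓ,
    sub_eq_zero] at h2
  rw [h2, Algebra.smul_def]

end Winding

/-! ### The Riesz projection -/

section Riesz

variable {Γ : ℝ → ℂ} {R : Type*} [NormedRing R] [NormedAlgebra ℂ R] [CompleteSpace R]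

/-- The resolvent `ζ ↦ (B - ζ)⁻¹` on the contour. -/
def contourResolvent (hΓ : IsContour Γ) (B : R) : C(unitInterval, R) :=
  Ring.inverse (constCLM B - contourVar R hΓ)

theorem isUnit_constCLM_sub_contourVar (hΓ : IsContour Γ) {B : R}
    (hB : contourSet Γ ⊆ resolventSet ℂ B) : IsUnit (constCLM B - contourVar R hΓ) := by
  rw [ContinuousMap.isUnit_iff_forall_isUnit]
  intro t
  have h : IsUnit (algebraMap ℂ R (Γ t) - B) := hB ⟨t, t.2, rfl⟩
  rw [← IsUnit.neg_iff, neg_sub] at h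
  exact h

theorem contourResolvent_apply (hΓ : IsContour Γ) {B : R} (hB : contourSet Γ ⊆ resolventSet ℂ B)
    (t : unitInterval) :
    contourResolvent hΓ B t = Ring.inverse (B - algebraMap ℂ R (Γ t)) := by
  rw [contourResolvent, ringInverse_apply (isUnit_constCLM_sub_contourVar hΓ hB)]
  rfl

theorem commute_ringInverse {S : Type*} [MonoidWithZero S] {a b : S} (h : Commute a b)  :
    Commute a (Ring.inverse b) := by
  by_cases hb : IsUnit b
  · obtain ⟨u, rfl⟩ := hb
    rw [Ring.inverse_unit]
    exact h.units_inv_right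
  · rw [Ring.inverse_non_unit _ hb]
    exact Commute.zero_right _

theorem commute_contourResolvent (hΓ : IsContour Γ) {B X : R} (h : Commute X B) :
    Commute (constCLM X) (contourResolvent hΓ B) := by
  refine commute_ringInverse (Commute.sub_right ?_ (contourVar_commute hΓ _).symm)
  ext t
  exact h

theorem commute_cauchyKernel (hΓ : IsContour Γ) (w : ℂ) (F : C(unitInterval, R)) :
    Commute F (cauchyKernel R hΓ w) :=
  commute_ringInverse
    ((contourVar_commute hΓ F).symm.sub_right (Algebra.commutes w F).symm)

theorem commute_contourCLM (hΓ : IsContour Γ) {X : R} {F : C(unitInterval, R)}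
    (h : Commute (constCLM X) F) : Commute X (contourCLM hΓ F) := by
  rw [commute_iff_eq, ← contourCLM_const_mul, h.eq, contourCLM_mul_const]

/-- The Riesz projection, as an element of a Banach algebra. -/
def rieszElem (hΓ : IsContour Γ) (B : R) : R :=
  (-1 / (2 * Real.pi * Complex.I) : ℂ) • contourCLM hΓ (contourResolvent hΓ B)

theorem contourCLM_contourResolvent (hΓ : IsContour Γ) (B : R) :
    contourCLM hΓ (contourResolvent hΓ B) = -(2 * Real.pi * Complex.I) • rieszElem hΓ B := by
  rw [rieszElem, smul_smul, neg_mul, mul_div_cancel₀ _ Complex.two_pi_I_ne_zero, neg_neg,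
    one_smul]

theorem commute_rieszElem (hΓ : IsContour Γ) {B X : R} (h : Commute X B) :
    Commute X (rieszElem hΓ B) :=
  (commute_contourCLM hΓ (commute_contourResolvent hΓ h)).smul_right _

/-- The Cauchy transform of the resolvent. -/
def resolventTransform (hΓ : IsContour Γ) (B : R) (w : ℂ) : R :=
  contourCLM hΓ (cauchyKernel R hΓ w * contourResolvent hΓ B)

theorem commute_resolventTransform (hΓ : IsContour Γ) {B X : R} (h : Commute X B) (w : ℂ) :
    Commute X (resolventTransform hΓ B w) :=
  commute_contourCLM hΓ ((commute_cauchyKernel hΓ w _).mul_right (commute_contourResolvent hΓ h))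

/-- Writing B - w = (B - ζ) + (ζ - w) under the integral cancels one factor of the integrand in each
term. So K(w) inverts B - w up to the factor 2πi(wind(w) - P). Inside Γ this is an inverse on the
kernel of P, outside Γ on its range, even where w is in the spectrum. -/
theorem sub_mul_resolventTransform (hΓ : IsContour Γ) {B : R}
    (hB : contourSet Γ ⊆ resolventSet ℂ B) {w : ℂ} (hw : w ∉ contourSet Γ) :
    (B - algebraMap ℂ R w) * resolventTransform hΓ B w
      = (2 * Real.pi * Complex.I) • (algebraMap ℂ R (winding Γ w) - rieszElem hΓ B) := by
  have h1 : constCLM (B - algebraMap ℂ R w)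
      = (constCLM B - contourVar R hΓ) + (contourVar R hΓ - algebraMap ℂ _ w) := by
    ext t; simp [Algebra.algebraMap_eq_smul_one]
  have h2 : constCLM (B - algebraMap ℂ R w) * (cauchyKernel R hΓ w * contourResolvent hΓ B)
      = cauchyKernel R hΓ w + contourResolvent hΓ B := by
    rw [h1, add_mul, ← mul_assoc, (commute_cauchyKernel hΓ w _).eq, mul_assoc, contourResolvent,
      Ring.mul_inverse_cancel _ (isUnit_constCLM_sub_contourVar hΓ hB), mul_one,
      cauchyKernel, ← mul_assoc, Ring.mul_inverse_cancel _ (isUnit_contourVar_sub hΓ hw), one_mul]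
  rw [resolventTransform, ← contourCLM_const_mul, h2, map_add, contourCLM_cauchyKernel hΓ hw,
    contourCLM_contourResolvent, smul_sub, map_mul, ← Algebra.smul_def, neg_smul, sub_eq_add_neg]

theorem differentiableAt_resolventTransform (hΓ : IsContour Γ) (B : R) {w : ℂ}
    (hw : w ∉ contourSet Γ) : DifferentiableAt ℂ (resolventTransform hΓ B) w := by
  have h := (differentiableAt_cauchyKernel (R := R) hΓ hw).mul_const (contourResolvent hΓ B)
  exact (contourCLM hΓ).differentiableAt.comp w h

theorem mem_resolventSet_iff {B : R} {w : ℂ} :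
    w ∈ resolventSet ℂ B ↔ IsUnit (B - algebraMap ℂ R w) := by
  rw [← IsUnit.neg_iff, neg_sub]; rfl

theorem differentiableAt_ringInverse_sub {B : R} {w : ℂ} (hw : w ∈ resolventSet ℂ B) :
    DifferentiableAt ℂ (fun w => Ring.inverse (B - algebraMap ℂ R w)) w :=
  DifferentiableAt.inverse (𝕜 := ℂ) (h := fun w => B - algebraMap ℂ R w)
    ((differentiableAt_const _).sub (algebraMapCLM ℂ R).differentiableAt)
    (mem_resolventSet_iff.1 hw)

theorem tendsto_ringInverse_sub (B : R) :
    Tendsto (fun w => Ring.inverse (B - algebraMap ℂ R w)) (cocompact ℂ) (𝓝 0) := by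
  have h := spectrum.resolvent_tendsto_cobounded (𝕜 := ℂ) B
  rw [Metric.cobounded_eq_cocompact] at h
  have h2 : (fun w => Ring.inverse (B - algebraMap ℂ R w)) = fun w => -(resolvent B w) := by
    ext1 w
    rw [resolvent, ← neg_sub]
    exact ringInverse_neg _
  rw [h2]
  simpa using h.neg

theorem eventually_mem_resolventSet (B : R) : ∀ᶠ w in cocompact ℂ, w ∈ resolventSet ℂ B := by
  have := (spectrum.isCompact (𝕜 := ℂ) B).compl_mem_cocompact
  filter_upwards [this] with w hw
  simpa [spectrum] using hw

/-- Liouville's theorem replaces the usual pair of nested contours: P(1 - P)(B - w)⁻¹ extends from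
the resolvent set to an entire function that vanishes at infinity, hence P(1 - P) = 0. -/
theorem rieszElem_mul_self (hΓ : IsContour Γ) {B : R} (hB : contourSet Γ ⊆ resolventSet ℂ B) :
    rieszElem hΓ B * rieszElem hΓ B = rieszElem hΓ B := by
  classical
  set P := rieszElem hΓ B with hP
  set c : ℂ := 2 * Real.pi * Complex.I with hc
  have hc0 : c ≠ 0 := Complex.two_pi_I_ne_zero
  set K := resolventTransform hΓ B with hK
  set r : ℂ → R := fun w => Ring.inverse (B - algebraMap ℂ R w) with hr
  have hPB : Commute P B := (commute_rieszElem hΓ (Commute.refl B)).symm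
  have hPr (w : ℂ) : Commute P (r w) :=
    commute_ringInverse (hPB.sub_right (Algebra.commutes w P).symm)
  -- On the resolvent set K = 2πi(wind - P)r. Inside Γ this gives P K = 2πi P(1 - P)r, and outside Γ
  -- it gives (1 - P)K = -2πi P(1 - P)r. Since K is holomorphic off Γ, these formulas continue P(1 -
  -- P)r across the spectrum.
  let H : ℂ → R := fun w => if w ∈ resolventSet ℂ B then P * (1 - P) * r w else
    if w ∈ inside Γ then c⁻¹ • (P * K w) else -(c⁻¹ • ((1 - P) * K w))
  have hrK {w : ℂ} (h1 : w ∈ resolventSet ℂ B) (h2 : w ∉ contourSet Γ) :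
      K w = c • (algebraMap ℂ R (winding Γ w) - P) * r w := by
    have hcomm : Commute (c • (algebraMap ℂ R (winding Γ w) - P)) (r w) :=
      ((show Commute (algebraMap ℂ R (winding Γ w)) (r w) from
        Algebra.commutes _ _).sub_left (hPr w)).smul_left _
    rw [hcomm.eq, ← sub_mul_resolventTransform hΓ hB h2,
      Ring.inverse_mul_cancel_left _ _ (mem_resolventSet_iff.1 h1)]
  have hin : ∀ w ∈ inside Γ, H w = c⁻¹ • (P * K w) := by
    intro w hw
    by_cases h : w ∈ resolventSet ℂ B
    · simp only [H, if_pos h]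
      rw [hrK h hw.1, hw.2, map_one, smul_mul_assoc, mul_smul_comm, smul_smul,
        inv_mul_cancel₀ hc0, one_smul, mul_assoc]
    · simp only [H, if_neg h, if_pos hw]
  have hout : ∀ w ∈ outside Γ, H w = -(c⁻¹ • ((1 - P) * K w)) := by
    intro w hw
    by_cases h : w ∈ resolventSet ℂ B
    · simp only [H, if_pos h]
      rw [hrK h hw.1, hw.2, map_zero, smul_mul_assoc, mul_smul_comm, smul_smul,
        inv_mul_cancel₀ hc0, one_smul]
      noncomm_ring
    · have h' : w ∉ inside Γ := fun h => (disjoint_inside_outside Γ).le_bot ⟨h, hw⟩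
      simp only [H, if_neg h, if_neg h']
  have hH : Differentiable ℂ H := by
    intro w
    by_cases h : w ∈ resolventSet ℂ B
    · have h1 : H =ᶠ[𝓝 w] fun w => P * (1 - P) * r w := by
        filter_upwards [(spectrum.isOpen_resolventSet (𝕜 := ℂ) B).mem_nhds h] with v hv
        simp only [H, if_pos hv]
      exact ((differentiableAt_const _).mul (differentiableAt_ringInverse_sub h)).congr_of_eventuallyEq
        h1
    · have hwΓ : w ∉ contourSet Γ := fun h' => h (hB h')
      have hKd : DifferentiableAt ℂ K w := differentiableAt_resolventTransform hΓ B hwΓ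
      rcases hΓ.simple w hwΓ with hw | hw
      · have h1 : H =ᶠ[𝓝 w] fun w => c⁻¹ • (P * K w) := by
          filter_upwards [(isOpen_inside hΓ).mem_nhds hw] with v hv using hin v hv
        exact ((hKd.const_mul P).const_smul c⁻¹).congr_of_eventuallyEq h1
      · have h1 : H =ᶠ[𝓝 w] fun w => -(c⁻¹ • ((1 - P) * K w)) := by
          filter_upwards [(isOpen_outside hΓ).mem_nhds hw] with v hv using hout v hv
        exact ((hKd.const_mul (1 - P)).const_smul c⁻¹).neg.congr_of_eventuallyEq h1
  have hlim : Tendsto H (cocompact ℂ) (𝓝 0) := by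
    have h1 : Tendsto (fun w => P * (1 - P) * r w) (cocompact ℂ) (𝓝 0) := by
      simpa using (tendsto_ringInverse_sub B).const_mul (P * (1 - P))
    refine h1.congr' ?_
    filter_upwards [eventually_mem_resolventSet B] with w hw
    simp only [H, if_pos hw]
  obtain ⟨w, hw⟩ := (eventually_mem_resolventSet B).exists
  have h0 := hH.apply_eq_of_tendsto_cocompact w hlim
  simp only [H, if_pos hw] at h0
  have h1 : P * (1 - P) = 0 := by
    have := congrArg (· * (B - algebraMap ℂ R w)) h0
    simpa only [zero_mul, mul_assoc, hr, Ring.inverse_mul_cancel _ (mem_resolventSet_iff.1 hw),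
      mul_one] using this
  rw [mul_sub, mul_one, sub_eq_zero] at h1
  exact h1.symm

end Riesz

/-! ### Spectral projections of bounded operators -/

section Operators

variable {Γ : ℝ → ℂ} {K : Type*} [NormedAddCommGroup K] [NormedSpace ℂ K] [CompleteSpace K]

theorem resolv_eq (B : K →L[ℂ] K) (ζ : ℂ) :
    resolv B ζ = Ring.inverse (B - algebraMap ℂ (K →L[ℂ] K) ζ) := by
  rw [resolv, Algebra.algebraMap_eq_smul_one]

theorem riesz_eq (hΓ : IsContour Γ) {B : K →L[ℂ] K} (hB : contourSet Γ ⊆ resolventSet ℂ B) :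
    riesz Γ B = rieszElem hΓ B := by
  rw [riesz, rieszElem]
  congr 1
  exact contourIntegral_eq hΓ fun t => by rw [contourResolvent_apply hΓ hB, resolv_eq]

/-- `B - w` maps the subspace `W` bijectively onto itself. -/
def BijectiveOn (B : K →L[ℂ] K) (W : Submodule ℂ K) (w : ℂ) : Prop :=
  (∀ x ∈ W, B x - w • x = 0 → x = 0) ∧ ∀ y ∈ W, ∃ x ∈ W, B x - w • x = y

/-- The spectrum of the restriction is taken among linear endomorphisms, where invertibility is mere
bijectivity. On the whole space the open mapping theorem makes the bounded notion agree with it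
(`notMem_spectrum_iff`), so all spectra are compared through `BijectiveOn`. -/
theorem notMem_spectrum_restrict_iff {B : K →L[ℂ] K} {W : Submodule ℂ K}
    (hW : ∀ x ∈ W, (B : K →ₗ[ℂ] K) x ∈ W) {w : ℂ} :
    w ∉ spectrum ℂ ((B : K →ₗ[ℂ] K).restrict hW) ↔ BijectiveOn B W w := by
  rw [spectrum.notMem_iff, ← IsUnit.neg_iff, neg_sub, Module.End.isUnit_iff]
  have h (x : W) : (((B : K →ₗ[ℂ] K).restrict hW - algebraMap ℂ (Module.End ℂ W) w) x : K)
      = B x - w • (x : K) := rfl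
  constructor
  · rintro ⟨h1, h2⟩
    refine ⟨fun x hx hx0 => ?_, fun y hy => ?_⟩
    · have : (⟨x, hx⟩ : W) = 0 := h1 (by rw [map_zero]; exact Subtype.ext hx0)
      exact congrArg Subtype.val this
    · obtain ⟨x, hx⟩ := h2 ⟨y, hy⟩
      exact ⟨x, x.2, congrArg Subtype.val hx⟩
  · rintro ⟨h1, h2⟩
    refine ⟨(injective_iff_map_eq_zero _).2 fun x hx => ?_, fun y => ?_⟩
    · exact Subtype.ext (h1 x x.2 (congrArg Subtype.val hx))
    · obtain ⟨x, hx, hxy⟩ := h2 y y.2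
      exact ⟨⟨x, hx⟩, Subtype.ext hxy⟩

theorem notMem_spectrum_iff {B : K →L[ℂ] K} {w : ℂ} :
    w ∉ spectrum ℂ B ↔ BijectiveOn B ⊤ w := by
  rw [spectrum.notMem_iff, ← IsUnit.neg_iff, neg_sub, ContinuousLinearMap.isUnit_iff_bijective]
  have h (x : K) : (B - algebraMap ℂ (K →L[ℂ] K) w) x = B x - w • x := rfl
  constructor
  · rintro ⟨h1, h2⟩
    refine ⟨fun x _ hx0 => h1 (by rw [map_zero, h, hx0]), fun y _ => ?_⟩
    obtain ⟨x, hx⟩ := h2 y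
    exact ⟨x, trivial, hx⟩
  · rintro ⟨h1, h2⟩
    refine ⟨(injective_iff_map_eq_zero _).2 fun x hx => h1 x trivial hx, fun y => ?_⟩
    obtain ⟨x, -, hxy⟩ := h2 y trivial
    exact ⟨x, hxy⟩

theorem mem_range_iff_of_idem {P : K →L[ℂ] K} (hP : P * P = P) {x : K} :
    x ∈ P.range ↔ P x = x := by
  constructor
  · rintro ⟨y, rfl⟩
    exact congrArg (fun Q : K →L[ℂ] K => Q y) hP
  · intro h
    exact ⟨x, h⟩

/-- The restriction of a bijective `B - w` to the range of a commuting projection. -/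
theorem BijectiveOn.range {B : K →L[ℂ] K} {W : Submodule ℂ K} {w : ℂ} (h : BijectiveOn B W w)
    {P : K →L[ℂ] K} (hP : P * P = P) (hPB : Commute B P) (hPW : P.range ≤ W) :
    BijectiveOn B P.range w := by
  refine ⟨fun x hx => h.1 x (hPW hx), fun y hy => ?_⟩
  obtain ⟨x, -, hxy⟩ := h.2 y (hPW hy)
  refine ⟨P x, ⟨x, rfl⟩, ?_⟩
  have h1 : B (P x) = P (B x) := congrArg (fun Q : K →L[ℂ] K => Q x) hPB.eq
  rw [h1, ← map_smul, ← map_sub, hxy, (mem_range_iff_of_idem hP).1 hy]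

/-- An operator `V` with `(B - w) V = V (B - w) = c P` inverts `B - w` on the range of `P`. -/
theorem bijectiveOn_range_of_inverse {B P V : K →L[ℂ] K} (hP : P * P = P) {w c : ℂ} (hc : c ≠ 0)
    (hPV : Commute P V) (h1 : (B - algebraMap ℂ _ w) * V = c • P)
    (h2 : V * (B - algebraMap ℂ _ w) = c • P) : BijectiveOn B P.range w := by
  constructor
  · intro x hx h0
    have h3 := congrArg (fun Q : K →L[ℂ] K => Q x) h2
    have h4 : V (B x - w • x) = c • P x := h3
    rw [h0, map_zero, (mem_range_iff_of_idem hP).1 hx] at h4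
    exact (smul_eq_zero.1 h4.symm).resolve_left hc
  · intro y hy
    refine ⟨c⁻¹ • V y, Submodule.smul_mem _ _ ?_, ?_⟩
    · refine (mem_range_iff_of_idem hP).2 ?_
      have h3 : P (V y) = V (P y) := congrArg (fun Q : K →L[ℂ] K => Q y) hPV.eq
      rw [h3, (mem_range_iff_of_idem hP).1 hy]
    · have h3 : B (V y) - w • V y = c • P y := congrArg (fun Q : K →L[ℂ] K => Q y) h1
      rw [map_smul, smul_comm w, ← smul_sub, h3, smul_smul, inv_mul_cancel₀ hc, one_smul,
        (mem_range_iff_of_idem hP).1 hy]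

theorem idem_one_sub {P : K →L[ℂ] K} (hP : P * P = P) : (1 - P) * (1 - P) = 1 - P := by
  rw [mul_sub, mul_one, sub_mul, one_mul, hP, sub_self, sub_zero]

theorem ker_eq_range_one_sub {P : K →L[ℂ] K} (hP : P * P = P) :
    P.ker = (1 - P).range := by
  ext x
  rw [mem_range_iff_of_idem (idem_one_sub hP)]
  change P x = 0 ↔ x - P x = x
  rw [sub_eq_self]

theorem bijectiveOn_top {B P : K →L[ℂ] K} {w : ℂ} (hP : P * P = P) (hPB : Commute B P)
    (h1 : BijectiveOn B P.range w) (h2 : BijectiveOn B (1 - P).range w) :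
    BijectiveOn B ⊤ w := by
  have hc (x : K) : B (P x) = P (B x) := congrArg (fun Q : K →L[ℂ] K => Q x) hPB.eq
  have hs (x : K) : (1 - P) x = x - P x := rfl
  constructor
  · intro x _ hx
    have h3 : P x = 0 := h1.1 _ ⟨x, rfl⟩ (by rw [hc, ← map_smul, ← map_sub, hx, map_zero])
    have h4 : x ∈ (1 - P).range := by rw [← ker_eq_range_one_sub hP]; exact h3
    exact h2.1 x h4 hx
  · intro y _
    obtain ⟨x1, -, h3⟩ := h1.2 (P y) ⟨y, rfl⟩
    obtain ⟨x2, -, h4⟩ := h2.2 ((1 - P) y) ⟨y, rfl⟩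
    refine ⟨x1 + x2, trivial, ?_⟩
    rw [map_add, smul_add, add_sub_add_comm, h3, h4, hs, add_sub_cancel]

variable {B : K →L[ℂ] K}

theorem bijectiveOn_range_rieszElem (hΓ : IsContour Γ) (hB : contourSet Γ ⊆ resolventSet ℂ B)
    {w : ℂ} (hw : w ∈ outside Γ) : BijectiveOn B (rieszElem hΓ B).range w := by
  have h := sub_mul_resolventTransform hΓ hB hw.1
  rw [hw.2, map_zero, zero_sub, smul_neg, ← neg_smul] at h
  have hc : Commute (B - algebraMap ℂ _ w) (resolventTransform hΓ B w) :=
    commute_resolventTransform hΓ ((Commute.refl B).sub_left (Algebra.commutes w B)) w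
  exact bijectiveOn_range_of_inverse (rieszElem_mul_self hΓ hB)
    (neg_ne_zero.2 Complex.two_pi_I_ne_zero)
    (commute_resolventTransform hΓ (commute_rieszElem hΓ (Commute.refl B)).symm w) h (hc.eq ▸ h)

theorem bijectiveOn_range_one_sub_rieszElem (hΓ : IsContour Γ)
    (hB : contourSet Γ ⊆ resolventSet ℂ B) {w : ℂ} (hw : w ∈ inside Γ) :
    BijectiveOn B (1 - rieszElem hΓ B).range w := by
  have h := sub_mul_resolventTransform hΓ hB hw.1
  rw [hw.2, map_one] at h
  have hc : Commute (B - algebraMap ℂ _ w) (resolventTransform hΓ B w) :=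
    commute_resolventTransform hΓ ((Commute.refl B).sub_left (Algebra.commutes w B)) w
  refine bijectiveOn_range_of_inverse (idem_one_sub (rieszElem_mul_self hΓ hB))
    Complex.two_pi_I_ne_zero ?_ h (hc.eq ▸ h)
  exact (Commute.one_left _).sub_left
    (commute_resolventTransform hΓ (commute_rieszElem hΓ (Commute.refl B)).symm w)

theorem isSpectralProjection_rieszElem (hΓ : IsContour Γ)
    (hB : contourSet Γ ⊆ resolventSet ℂ B) :
    IsSpectralProjection B (inside Γ) (rieszElem hΓ B) := by
  have hP := rieszElem_mul_self hΓ hB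
  have hBP : Commute B (rieszElem hΓ B) := commute_rieszElem hΓ (Commute.refl B)
  have hBP' : Commute B (1 - rieszElem hΓ B) := (Commute.one_right B).sub_right hBP
  have hinv {Q : K →L[ℂ] K} (hQ : Commute B Q) (x : K) (hx : x ∈ Q.range) :
      (B : K →ₗ[ℂ] K) x ∈ Q.range := by
    obtain ⟨y, rfl⟩ := hx
    exact ⟨B y, (congrArg (fun Q : K →L[ℂ] K => Q y) hQ.eq).symm⟩
  have hw {w : ℂ} (hw : w ∈ spectrum ℂ B) : w ∈ inside Γ ∪ outside Γ :=
    hΓ.simple w fun h => hw (hB h)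
  refine ⟨hP, hBP.eq, hinv hBP, fun x hx => ?_, ?_, ?_⟩
  · rw [ker_eq_range_one_sub hP] at hx ⊢
    exact hinv hBP' x hx
  · ext w
    rw [← not_iff_not, notMem_spectrum_restrict_iff]
    constructor
    -- A point inside Γ at which B - w is bijective on the range of P is regular for B, since on the
    -- kernel of P it is bijective throughout the inside.
    · rintro h ⟨h1, h2⟩
      exact notMem_spectrum_iff.2 (bijectiveOn_top hP hBP h
        (bijectiveOn_range_one_sub_rieszElem hΓ hB h2)) h1
    · intro h
      by_cases h1 : w ∈ spectrum ℂ B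
      · rcases hw h1 with h2 | h2
        · exact absurd ⟨h1, h2⟩ h
        · exact bijectiveOn_range_rieszElem hΓ hB h2
      · exact (notMem_spectrum_iff.1 h1).range hP hBP le_top
  · ext w
    rw [← not_iff_not, notMem_spectrum_restrict_iff, ker_eq_range_one_sub hP]
    constructor
    · rintro h ⟨h1, h2⟩
      exact notMem_spectrum_iff.2 (bijectiveOn_top hP hBP
        (bijectiveOn_range_rieszElem hΓ hB ((hw h1).resolve_left h2)) h) h1
    · intro h
      by_cases h1 : w ∈ spectrum ℂ B
      · by_cases h2 : w ∈ inside Γ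
        · exact bijectiveOn_range_one_sub_rieszElem hΓ hB h2
        · exact absurd ⟨h1, h2⟩ h
      · exact (notMem_spectrum_iff.1 h1).range (idem_one_sub hP) hBP' le_top

theorem isClosed_range_of_idem {Q : K →L[ℂ] K} (hQ : Q * Q = Q) :
    IsClosed (Q.range : Set K) := by
  have h : (Q.range : Set K) = {x | Q x = x} := by
    ext x; exact mem_range_iff_of_idem hQ
  rw [h]
  exact isClosed_eq Q.continuous continuous_id

/-- A bounded operator on a nonzero complex Banach space has nonempty spectrum, and the range of a
bounded projection is such a space unless the projection vanishes. -/
theorem eq_zero_of_bijectiveOn {Q : K →L[ℂ] K} (hQ : Q * Q = Q) (hBQ : Commute B Q)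
    (h : ∀ w, BijectiveOn B Q.range w) : Q = 0 := by
  by_contra hne
  have : CompleteSpace Q.range := (isClosed_range_of_idem hQ).completeSpace_coe
  have hnt : Nontrivial Q.range := by
    obtain ⟨x, hx⟩ := DFunLike.ne_iff.1 hne
    exact ⟨⟨⟨Q x, x, rfl⟩, 0, fun h => hx (congrArg Subtype.val h)⟩⟩
  have hinv : ∀ x ∈ Q.range, B x ∈ Q.range := by
    rintro x ⟨y, rfl⟩
    exact ⟨B y, (congrArg (fun Q : K →L[ℂ] K => Q y) hBQ.eq).symm⟩
  let B' : Q.range →L[ℂ] Q.range := (B ∘L Q.range.subtypeL).codRestrict Q.range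
    fun x => hinv x x.2
  obtain ⟨w, hw⟩ := spectrum.nonempty B'
  refine hw (not_not.1 fun h' => h' ?_)
  rw [mem_resolventSet_iff, ContinuousLinearMap.isUnit_iff_bijective]
  refine ⟨(injective_iff_map_eq_zero _).2 fun x hx => ?_, fun y => ?_⟩
  · exact Subtype.ext ((h w).1 x x.2 (congrArg Subtype.val hx))
  · obtain ⟨x, hx, hxy⟩ := (h w).2 y y.2
    exact ⟨⟨x, hx⟩, Subtype.ext hxy⟩

/-- The range of Q = P(1 - P') lies both in the range of P, where the spectrum of B is inside S, and
in the kernel of P', where it avoids S. So B has no spectrum on the range of Q. -/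
theorem IsSpectralProjection.mul_one_sub_eq_zero {S : Set ℂ} {P P' : K →L[ℂ] K}
    (hP : IsSpectralProjection B S P) (hP' : IsSpectralProjection B S P') (hc : Commute P P') :
    P * (1 - P') = 0 := by
  have hc' : Commute P (1 - P') := (Commute.one_right P).sub_right hc
  have hQ : P * (1 - P') * (P * (1 - P')) = P * (1 - P') := by
    rw [mul_assoc, ← mul_assoc (1 - P'), ← hc'.eq, mul_assoc, idem_one_sub hP'.idem, ← mul_assoc,
      hP.idem]
  have hBP : Commute B P := hP.comm
  have hBP' : Commute B P' := hP'.comm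
  have hBQ : Commute B (P * (1 - P')) := hBP.mul_right ((Commute.one_right B).sub_right hBP')
  refine eq_zero_of_bijectiveOn hQ hBQ fun w => ?_
  by_cases hw : w ∈ spectrum ℂ B ∩ S
  · have h1 : w ∉ spectrum ℂ ((B : K →ₗ[ℂ] K).restrict hP'.inv_ker) := by
      rw [hP'.spectrum_ker]
      exact fun h => h.2 hw.2
    rw [notMem_spectrum_restrict_iff] at h1
    refine h1.range hQ hBQ ?_
    rw [ker_eq_range_one_sub hP'.idem]
    rintro x ⟨y, rfl⟩
    exact ⟨P y, (congrArg (fun Q : K →L[ℂ] K => Q y) hc'.eq).symm⟩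
  · rw [← hP.spectrum_range, notMem_spectrum_restrict_iff] at hw
    refine hw.range hQ hBQ ?_
    rintro x ⟨y, rfl⟩
    exact ⟨(1 - P') y, rfl⟩

/-- For uniqueness, the Riesz projection commutes with everything that commutes with B. Two
commuting spectral projections for the same set satisfy P = PP' and P' = P'P, hence are equal. -/
theorem isSpectralProjection_iff (hΓ : IsContour Γ) (hB : contourSet Γ ⊆ resolventSet ℂ B)
    {P : K →L[ℂ] K} : IsSpectralProjection B (inside Γ) P ↔ P = riesz Γ B := by
  rw [riesz_eq hΓ hB]
  have h0 := isSpectralProjection_rieszElem hΓ hB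
  constructor
  · intro hP
    have hc : Commute P (rieszElem hΓ B) := commute_rieszElem hΓ hP.comm.symm
    have h1 := hP.mul_one_sub_eq_zero h0 hc
    have h2 := h0.mul_one_sub_eq_zero hP hc.symm
    rw [mul_sub, mul_one, sub_eq_zero] at h1 h2
    rw [h1, hc.eq, ← h2]
  · rintro rfl
    exact h0

/-- With 0 exterior to Γ, the Cauchy transform at 0 inverts B on the range of P. The factor B makes
P compact when B is, and a compact projection has finite-dimensional range. -/
theorem rieszElem_eq_mul_resolventTransform (hΓ : IsContour Γ)
    (hB : contourSet Γ ⊆ resolventSet ℂ B) (h0 : (0 : ℂ) ∈ outside Γ) :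
    rieszElem hΓ B = B * (-(2 * Real.pi * Complex.I)⁻¹ • resolventTransform hΓ B 0) := by
  have h := sub_mul_resolventTransform hΓ hB h0.1
  rw [h0.2, map_zero, sub_zero, zero_sub, smul_neg] at h
  rw [mul_smul_comm, h, neg_smul, smul_neg, neg_neg, smul_smul,
    inv_mul_cancel₀ Complex.two_pi_I_ne_zero, one_smul]

theorem finiteDimensional_range_of_isCompactOperator {P : K →L[ℂ] K} (hP : P * P = P)
    (hc : IsCompactOperator P) : FiniteDimensional ℂ P.range := by
  refine FiniteDimensional.of_isCompactOperator_id (𝕜 := ℂ) ?_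
  have h1 : IsCompactOperator (P ∘ P.range.subtypeL) := hc.comp_clm _
  have h2 := h1.codRestrict (V := P.range) (fun x => ⟨x, rfl⟩) (isClosed_range_of_idem hP)
  refine (congrArg IsCompactOperator (funext fun x => ?_)).mp h2
  exact Subtype.ext ((mem_range_iff_of_idem hP).1 x.2)

theorem finiteDimensional_range_rieszElem (hΓ : IsContour Γ)
    (hB : contourSet Γ ⊆ resolventSet ℂ B) (h0 : (0 : ℂ) ∈ outside Γ)
    (hc : IsCompactOperator B) : FiniteDimensional ℂ (rieszElem hΓ B).range := by
  refine finiteDimensional_range_of_isCompactOperator (rieszElem_mul_self hΓ hB) ?_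
  rw [rieszElem_eq_mul_resolventTransform hΓ hB h0]
  exact hc.comp_clm _

end Operators

/-! ### Operators of finite rank and their traces -/

section Trace

variable {K : Type*} [NormedAddCommGroup K] [NormedSpace ℂ K]

/-- Operators with finite-dimensional range. -/
def FiniteRank (F : K →L[ℂ] K) : Prop := FiniteDimensional ℂ F.range

theorem FiniteRank.of_range_le {F : K →L[ℂ] K} {W : Submodule ℂ K} [FiniteDimensional ℂ W]
    (h : F.range ≤ W) : FiniteRank F := Submodule.finiteDimensional_of_le h

theorem FiniteRank.zero : FiniteRank (0 : K →L[ℂ] K) :=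
  FiniteRank.of_range_le (W := ⊥) (by rintro _ ⟨x, rfl⟩; rfl)

theorem FiniteRank.add {F G : K →L[ℂ] K} (hF : FiniteRank F) (hG : FiniteRank G) :
    FiniteRank (F + G) := by
  have : FiniteDimensional ℂ F.range := hF
  have : FiniteDimensional ℂ G.range := hG
  refine FiniteRank.of_range_le (W := F.range ⊔ G.range) ?_
  rintro _ ⟨x, rfl⟩
  exact Submodule.add_mem_sup ⟨x, rfl⟩ ⟨x, rfl⟩

theorem FiniteRank.smul {F : K →L[ℂ] K} (hF : FiniteRank F) (c : ℂ) : FiniteRank (c • F) := by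
  have : FiniteDimensional ℂ F.range := hF
  refine FiniteRank.of_range_le (W := F.range) ?_
  rintro _ ⟨x, rfl⟩
  exact Submodule.smul_mem _ c ⟨x, rfl⟩

theorem FiniteRank.mul_right {F : K →L[ℂ] K} (hF : FiniteRank F) (X : K →L[ℂ] K) :
    FiniteRank (F * X) := by
  have : FiniteDimensional ℂ F.range := hF
  refine FiniteRank.of_range_le (W := F.range) ?_
  rintro _ ⟨x, rfl⟩
  exact ⟨X x, rfl⟩

theorem FiniteRank.mul_left {F : K →L[ℂ] K} (hF : FiniteRank F) (X : K →L[ℂ] K) :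
    FiniteRank (X * F) := by
  have : FiniteDimensional ℂ F.range := hF
  refine FiniteRank.of_range_le (W := F.range.map (X : K →ₗ[ℂ] K)) ?_
  rintro _ ⟨x, rfl⟩
  exact ⟨F x, ⟨x, rfl⟩, rfl⟩

theorem FiniteRank.sum {ι : Type*} {s : Finset ι} {F : ι → K →L[ℂ] K}
    (h : ∀ i ∈ s, FiniteRank (F i)) : FiniteRank (∑ i ∈ s, F i) := by
  classical
  induction s using Finset.induction_on with
  | empty => exact FiniteRank.zero
  | insert i s hi ih =>
    rw [Finset.sum_insert hi]
    exact (h i (Finset.mem_insert_self _ _)).add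
      (ih fun j hj => h j (Finset.mem_insert_of_mem hj))

/-- The two restrictions are `b ∘ a` and `a ∘ b` for the inclusion `a` of the range into W and the
map `b` induced by F. This freedom in W lets several operators be compared on one common space. -/
theorem finiteRankTrace_eq_trace {F : K →L[ℂ] K} {W : Submodule ℂ K} [FiniteDimensional ℂ W]
    (h : F.range ≤ W) :
    finiteRankTrace F = LinearMap.trace ℂ W ((F : K →ₗ[ℂ] K).restrict
      (p := W) (q := W) (fun x _ => h (LinearMap.mem_range_self _ x))) := by
  have : FiniteDimensional ℂ F.range := FiniteRank.of_range_le h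
  let a : F.range →ₗ[ℂ] W := Submodule.inclusion h
  let b : W →ₗ[ℂ] F.range := (F : K →ₗ[ℂ] K).rangeRestrict.comp W.subtype
  have h1 : b.comp a = (F : K →ₗ[ℂ] K).restrict (p := F.range) (q := F.range)
      (fun x _ => LinearMap.mem_range_self _ x) := rfl
  have h2 : a.comp b = (F : K →ₗ[ℂ] K).restrict
      (p := W) (q := W) (fun x _ => h (LinearMap.mem_range_self _ x)) := rfl
  rw [finiteRankTrace, ← h1, ← h2, LinearMap.trace_comp_comm']

theorem finiteRankTrace_add {F G : K →L[ℂ] K} (hF : FiniteRank F) (hG : FiniteRank G) :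
    finiteRankTrace (F + G) = finiteRankTrace F + finiteRankTrace G := by
  have : FiniteDimensional ℂ F.range := hF
  have : FiniteDimensional ℂ G.range := hG
  have h : (F + G).range ≤ F.range ⊔ G.range := by
    rintro _ ⟨x, rfl⟩
    exact Submodule.add_mem_sup ⟨x, rfl⟩ ⟨x, rfl⟩
  rw [finiteRankTrace_eq_trace h, finiteRankTrace_eq_trace (le_sup_left : F.range ≤ _ ⊔ G.range),
    finiteRankTrace_eq_trace (le_sup_right : G.range ≤ F.range ⊔ _), ← map_add]
  rfl

theorem finiteRankTrace_smul {F : K →L[ℂ] K} (hF : FiniteRank F) (c : ℂ) :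
    finiteRankTrace (c • F) = c * finiteRankTrace F := by
  have : FiniteDimensional ℂ F.range := hF
  have h : (c • F).range ≤ F.range := by
    rintro _ ⟨x, rfl⟩
    exact Submodule.smul_mem _ c ⟨x, rfl⟩
  rw [finiteRankTrace_eq_trace h, finiteRankTrace_eq_trace (le_refl F.range), ← smul_eq_mul,
    ← map_smul]
  rfl

theorem finiteRankTrace_zero : finiteRankTrace (0 : K →L[ℂ] K) = 0 := by
  simpa using finiteRankTrace_smul (FiniteRank.zero (K := K)) 0

theorem finiteRankTrace_sum {ι : Type*} {s : Finset ι} {F : ι → K →L[ℂ] K}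
    (h : ∀ i ∈ s, FiniteRank (F i)) :
    finiteRankTrace (∑ i ∈ s, F i) = ∑ i ∈ s, finiteRankTrace (F i) := by
  classical
  induction s using Finset.induction_on with
  | empty => exact finiteRankTrace_zero
  | insert i s hi ih =>
    have h' : ∀ j ∈ s, FiniteRank (F j) := fun j hj => h j (Finset.mem_insert_of_mem hj)
    rw [Finset.sum_insert hi, Finset.sum_insert hi,
      finiteRankTrace_add (h i (Finset.mem_insert_self _ _)) (FiniteRank.sum h'), ih h']

theorem finiteRankTrace_mul_comm {F : K →L[ℂ] K} (hF : FiniteRank F) (X : K →L[ℂ] K) :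
    finiteRankTrace (X * F) = finiteRankTrace (F * X) := by
  have : FiniteDimensional ℂ F.range := hF
  let N := F.range.map (X : K →ₗ[ℂ] K)
  have h1 : (X * F).range ≤ N := by
    rintro _ ⟨x, rfl⟩
    exact ⟨F x, ⟨x, rfl⟩, rfl⟩
  have h2 : (F * X).range ≤ F.range := by
    rintro _ ⟨x, rfl⟩
    exact ⟨X x, rfl⟩
  let a : F.range →ₗ[ℂ] N := (X : K →ₗ[ℂ] K).restrict fun x hx => ⟨x, hx, rfl⟩
  let b : N →ₗ[ℂ] F.range := (F : K →ₗ[ℂ] K).restrict fun x _ => ⟨x, rfl⟩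
  rw [finiteRankTrace_eq_trace h1, finiteRankTrace_eq_trace h2]
  exact LinearMap.trace_comp_comm' b a

theorem finiteRankTrace_idem {P : K →L[ℂ] K} (hP : P * P = P) (hf : FiniteRank P) :
    finiteRankTrace P = Module.finrank ℂ P.range := by
  have : FiniteDimensional ℂ P.range := hf
  have h : (P : K →ₗ[ℂ] K).restrict (p := P.range) (q := P.range)
      (fun x _ => LinearMap.mem_range_self _ x) = LinearMap.id := by
    ext ⟨_, y, rfl⟩
    exact congrArg (fun Q : K →L[ℂ] K => Q y) hP
  rw [finiteRankTrace, h, LinearMap.trace_id]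

/-- The functional `Y ↦ tr (P Y P)` is continuous if `P` is a projection of finite rank. -/
theorem exists_clm_finiteRankTrace {P : K →L[ℂ] K} (hP : P * P = P) (hf : FiniteRank P) :
    ∃ θ : (K →L[ℂ] K) →L[ℂ] ℂ, ∀ Y, θ Y = finiteRankTrace (P * Y * P) := by
  have : FiniteDimensional ℂ P.range := hf
  let b := Module.finBasis ℂ P.range
  let π : K →L[ℂ] P.range := P.codRestrict P.range fun x => ⟨x, rfl⟩
  let ℓ (i) : K →L[ℂ] ℂ := (LinearMap.toContinuousLinearMap (b.coord i)).comp π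
  refine ⟨∑ i, (ℓ i).comp (ContinuousLinearMap.apply ℂ K (b i : K)), fun Y => ?_⟩
  have h : (P * Y * P).range ≤ P.range := by
    rintro _ ⟨x, rfl⟩
    exact ⟨Y (P x), rfl⟩
  rw [finiteRankTrace_eq_trace h, LinearMap.trace_eq_matrix_trace ℂ b, Matrix.trace,
    sum_apply]
  refine Finset.sum_congr rfl fun i _ => ?_
  rw [Matrix.diag_apply, LinearMap.toMatrix_apply]
  have h1 : P (b i : K) = b i := by
    obtain ⟨y, hy⟩ := (b i).2
    rw [← hy]
    exact congrArg (fun Q : K →L[ℂ] K => Q y) hP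
  have h2 : (P : K →ₗ[ℂ] K).rangeRestrict (Y (b i : K))
      = ((P * Y * P : K →L[ℂ] K) : K →ₗ[ℂ] K).restrict
        (p := P.range) (q := P.range) (fun x _ => h (LinearMap.mem_range_self _ x)) (b i) := by
    refine Subtype.ext ?_
    change P (Y (b i : K)) = P (Y (P (b i : K)))
    rw [h1]
  rw [← h2]
  rfl

theorem iteratedDeriv_mul_eq_sum {R : Type*} [NormedRing R] [NormedAlgebra ℂ R] {f g : ℂ → R}
    {x : ℂ} {k : ℕ} (hf : ContDiffAt ℂ k f x) (hg : ContDiffAt ℂ k g x) :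
    iteratedDeriv k (f * g) x = ∑ i ∈ Finset.range (k + 1),
      (k.choose i : ℂ) • (iteratedDeriv i f x * iteratedDeriv (k - i) g x) := by
  rw [iteratedDeriv_mul hf hg]
  refine Finset.sum_congr rfl fun i _ => ?_
  rw [mul_assoc, ← nsmul_eq_mul, Nat.cast_smul_eq_nsmul]

theorem finiteRank_iteratedDeriv_mul {f g : ℂ → K →L[ℂ] K} {x : ℂ} {k : ℕ}
    (hf : ContDiffAt ℂ k f x) (hg : ContDiffAt ℂ k g x)
    (h : ∀ i j, i + j = k → FiniteRank (iteratedDeriv i f x) ∨ FiniteRank (iteratedDeriv j g x)) :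
    FiniteRank (iteratedDeriv k (f * g) x) := by
  rw [iteratedDeriv_mul_eq_sum hf hg]
  refine FiniteRank.sum fun i hi => FiniteRank.smul ?_ _
  rcases h i (k - i) (by have := Finset.mem_range.1 hi; omega) with h | h
  · exact h.mul_right _
  · exact h.mul_left _

/-- Neither f nor g need have finite rank: it suffices that each Leibniz term has one factor of
finite rank, since tr(XF) = tr(FX) for bounded X. -/
theorem finiteRankTrace_iteratedDeriv_mul_comm {f g : ℂ → K →L[ℂ] K} {x : ℂ} {k : ℕ}
    (hf : ContDiffAt ℂ k f x) (hg : ContDiffAt ℂ k g x)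
    (h : ∀ i j, i + j = k → FiniteRank (iteratedDeriv i f x) ∨ FiniteRank (iteratedDeriv j g x)) :
    finiteRankTrace (iteratedDeriv k (f * g) x) = finiteRankTrace (iteratedDeriv k (g * f) x) := by
  rw [iteratedDeriv_mul_eq_sum hf hg, iteratedDeriv_mul_eq_sum hg hf]
  have h1 (i : ℕ) (hi : i ∈ Finset.range (k + 1)) :
      FiniteRank (iteratedDeriv i f x * iteratedDeriv (k - i) g x) := by
    rcases h i (k - i) (by have := Finset.mem_range.1 hi; omega) with h | h
    · exact h.mul_right _
    · exact h.mul_left _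
  have h2 (i : ℕ) (hi : i ∈ Finset.range (k + 1)) :
      FiniteRank (iteratedDeriv i g x * iteratedDeriv (k - i) f x) := by
    rcases h (k - i) i (by have := Finset.mem_range.1 hi; omega) with h | h
    · exact h.mul_left _
    · exact h.mul_right _
  rw [finiteRankTrace_sum fun i hi => (h1 i hi).smul _,
    finiteRankTrace_sum fun i hi => (h2 i hi).smul _, ← Finset.sum_flip]
  refine Finset.sum_congr rfl fun i hi => ?_
  have hik : i ≤ k := Nat.lt_succ_iff.1 (Finset.mem_range.1 hi)
  have hi' : k - i ∈ Finset.range (k + 1) := Finset.mem_range.2 (by omega)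
  rw [finiteRankTrace_smul (h1 _ hi'), finiteRankTrace_smul (h2 _ hi), Nat.choose_symm hik,
    Nat.sub_sub_self hik]
  congr 1
  rcases h (k - i) i (by omega) with h | h
  · exact (finiteRankTrace_mul_comm h _).symm
  · exact finiteRankTrace_mul_comm h _

end Trace

/-! ### Contour integrals of products of resolvents -/

section Slope

variable {Γ : ℝ → ℂ} {R : Type*} [NormedRing R] [NormedAlgebra ℂ R] [CompleteSpace R]

/-- `f` is holomorphic on `Ω`, restricts to `F` on the contour, and its divided difference
`(f ζ - f w) / (ζ - w)` depends holomorphically on `w ∈ Ω`, uniformly for `ζ` on the contour. -/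
structure HasHolomorphicSlope (hΓ : IsContour Γ) (Ω : Set ℂ) (f : ℂ → R)
    (F : C(unitInterval, R)) : Prop where
  differentiableOn : DifferentiableOn ℂ f Ω
  exists_slope : ∃ φ : ℂ → C(unitInterval, R), DifferentiableOn ℂ φ Ω ∧
    ∀ w ∈ Ω, (contourVar R hΓ - algebraMap ℂ _ w) * φ w = F - constCLM (f w)

variable {hΓ : IsContour Γ} {Ω : Set ℂ}

theorem HasHolomorphicSlope.const (a : R) :
    HasHolomorphicSlope hΓ Ω (fun _ => a) (constCLM a) :=
  ⟨differentiableOn_const a, fun _ => 0, differentiableOn_const 0, fun w _ => by simp⟩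

theorem HasHolomorphicSlope.id :
    HasHolomorphicSlope hΓ Ω (fun w => algebraMap ℂ R w) (contourVar R hΓ) :=
  ⟨(algebraMapCLM ℂ R).differentiable.differentiableOn, fun _ => 1, differentiableOn_const 1,
    fun w _ => by rw [mul_one]; rfl⟩

theorem HasHolomorphicSlope.sub {f g : ℂ → R} {F G : C(unitInterval, R)}
    (hf : HasHolomorphicSlope hΓ Ω f F) (hg : HasHolomorphicSlope hΓ Ω g G) :
    HasHolomorphicSlope hΓ Ω (fun w => f w - g w) (F - G) := by
  obtain ⟨φ, h1, h2⟩ := hf.exists_slope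
  obtain ⟨ψ, h3, h4⟩ := hg.exists_slope
  refine ⟨hf.differentiableOn.sub hg.differentiableOn, fun w => φ w - ψ w, h1.sub h3,
    fun w hw => ?_⟩
  rw [mul_sub, h2 w hw, h4 w hw, map_sub]
  abel

theorem HasHolomorphicSlope.mul {f g : ℂ → R} {F G : C(unitInterval, R)}
    (hf : HasHolomorphicSlope hΓ Ω f F) (hg : HasHolomorphicSlope hΓ Ω g G) :
    HasHolomorphicSlope hΓ Ω (fun w => f w * g w) (F * G) := by
  obtain ⟨φ, h1, h2⟩ := hf.exists_slope
  obtain ⟨ψ, h3, h4⟩ := hg.exists_slope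
  refine ⟨hf.differentiableOn.mul hg.differentiableOn,
    fun w => φ w * G + constCLM (f w) * ψ w, ?_, fun w hw => ?_⟩
  · exact (h1.mul (differentiableOn_const G)).add
      ((constCLM.differentiable.comp_differentiableOn hf.differentiableOn).mul h3)
  · have hc : Commute (contourVar R hΓ - algebraMap ℂ _ w) (constCLM (f w)) :=
      (contourVar_commute hΓ _).sub_left (Algebra.commutes w _)
    rw [mul_add, ← mul_assoc, h2 w hw, ← mul_assoc, hc.eq, mul_assoc, h4 w hw, constCLM_mul,
      sub_mul, mul_sub]
    abel

theorem HasHolomorphicSlope.list_prod {ι : Type*} (l : List ι) {f : ι → ℂ → R}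
    {F : ι → C(unitInterval, R)} (h : ∀ i ∈ l, HasHolomorphicSlope hΓ Ω (f i) (F i)) :
    HasHolomorphicSlope hΓ Ω (fun w => (l.map fun i => f i w).prod) (l.map F).prod := by
  induction l with
  | nil => exact HasHolomorphicSlope.const 1
  | cons i l ih =>
    simp only [List.map_cons, List.prod_cons]
    exact (h i List.mem_cons_self).mul (ih fun j hj => h j (List.mem_cons_of_mem _ hj))

/-- The divided differences of the inverse of an affine family. -/
theorem HasHolomorphicSlope.ringInverse_affine (hout : Ωᶜ ⊆ outside Γ) {B Q : R}
    (hunit : ∀ w ∈ Ω, IsUnit (B - w • Q)) :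
    HasHolomorphicSlope hΓ Ω (fun w => Ring.inverse (B - w • Q))
      (Ring.inverse (constCLM B - contourVar R hΓ * constCLM Q)) := by
  have hdiff : DifferentiableOn ℂ (fun w : ℂ => Ring.inverse (B - w • Q)) Ω := fun w hw =>
    (DifferentiableAt.inverse (𝕜 := ℂ) (h := fun w : ℂ => B - w • Q)
      ((differentiableAt_const _).sub (differentiableAt_id.smul_const Q))
      (hunit w hw)).differentiableWithinAt
  have hu : IsUnit (constCLM B - contourVar R hΓ * constCLM Q) := by
    rw [ContinuousMap.isUnit_iff_forall_isUnit]
    intro t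
    have h1 : Γ t ∈ Ω := by
      by_contra h
      exact (hout h).1 ⟨t, t.2, rfl⟩
    have h2 := hunit _ h1
    rwa [Algebra.smul_def] at h2
  refine ⟨hdiff, fun w => constCLM (Ring.inverse (B - w • Q)) * constCLM Q *
      Ring.inverse (constCLM B - contourVar R hΓ * constCLM Q), ?_, fun w hw => ?_⟩
  · exact ((constCLM.differentiable.comp_differentiableOn hdiff).mul
      (differentiableOn_const _)).mul (differentiableOn_const _)
  · set V := Ring.inverse (B - w • Q) with hV
    set F := Ring.inverse (constCLM B - contourVar R hΓ * constCLM Q) with hF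
    have hc : Commute (contourVar R hΓ - algebraMap ℂ _ w) (constCLM V) :=
      (contourVar_commute hΓ _).sub_left (Algebra.commutes w _)
    -- The second resolvent identity: (ζ - w)Q is the difference of the two operators being
    -- inverted, so V Q F is the divided difference.
    have h1 : (contourVar R hΓ - algebraMap ℂ _ w) * constCLM Q
        = constCLM (B - w • Q) - (constCLM B - contourVar R hΓ * constCLM Q) := by
      ext t
      change (algebraMap ℂ R (Γ t) - algebraMap ℂ R w) * Q
        = (B - w • Q) - (B - algebraMap ℂ R (Γ t) * Q)
      rw [Algebra.smul_def, sub_mul]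
      abel
    rw [← mul_assoc, ← mul_assoc, hc.eq, mul_assoc (constCLM V), h1, mul_sub, sub_mul,
      ← constCLM_mul, hV, Ring.inverse_mul_cancel _ (hunit w hw), constCLM_one, one_mul,
      mul_assoc, hF, Ring.mul_inverse_cancel _ hu, mul_one]

theorem hasDerivAt_cauchyKernel (hΓ : IsContour Γ) {w : ℂ} (hw : w ∉ contourSet Γ) :
    HasDerivAt (cauchyKernel R hΓ) (cauchyKernel R hΓ w * cauchyKernel R hΓ w) w := by
  obtain ⟨u, hu⟩ := isUnit_contourVar_sub (R := R) hΓ hw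
  have h1 : HasDerivAt (fun w => contourVar R hΓ - algebraMap ℂ C(unitInterval, R) w) (-1) w := by
    have := ((algebraMapCLM ℂ C(unitInterval, R)).hasDerivAt (x := w)).const_sub (contourVar R hΓ)
    simpa using this
  have h2 := hasFDerivAt_ringInverse (𝕜 := ℂ) u
  rw [hu] at h2
  have h3 := h2.comp_hasDerivAt w h1
  have h4 : cauchyKernel R hΓ w = ↑u⁻¹ := by rw [cauchyKernel, ← hu, Ring.inverse_unit]
  rw [h4]
  refine h3.congr_deriv ?_
  have h5 {S : Type _} [Ring S] (a : S) : -(a * (-1) * a) = a * a := by simp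
  exact h5 (↑u⁻¹ : C(unitInterval, R))

theorem hasDerivAt_cauchyKernel_pow (hΓ : IsContour Γ) {w : ℂ} (hw : w ∉ contourSet Γ) (j : ℕ) :
    HasDerivAt (fun w => cauchyKernel R hΓ w ^ (j + 1))
      (((j + 1 : ℕ) : ℂ) • cauchyKernel R hΓ w ^ (j + 2)) w := by
  induction j with
  | zero => simpa [pow_succ] using hasDerivAt_cauchyKernel hΓ hw
  | succ j ih =>
    have h := ih.mul (hasDerivAt_cauchyKernel (R := R) hΓ hw)
    have h' : (fun w => cauchyKernel R hΓ w ^ (j + 1 + 1))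
        = (fun w => cauchyKernel R hΓ w ^ (j + 1)) * cauchyKernel R hΓ := by
      ext1 w
      exact pow_succ _ _
    rw [h']
    refine h.congr_deriv ?_
    rw [smul_mul_assoc, ← pow_succ, ← mul_assoc, ← pow_succ, ← pow_succ, Nat.cast_succ (j + 1)]
    have h5 {M : Type _} [AddCommGroup M] [Module ℂ M] (c : ℂ) (a : M) :
        c • a + a = (c + 1) • a := by rw [add_smul, one_smul]
    exact h5 _ (cauchyKernel R hΓ w ^ (j + 1 + 2))

/-- **Cauchy's formula** for derivatives. -/
theorem HasHolomorphicSlope.contourCLM_cauchyKernel_pow (hΩ : IsOpen Ω)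
    (hout : Ωᶜ ⊆ outside Γ) {f : ℂ → R} {F : C(unitInterval, R)}
    (hf : HasHolomorphicSlope hΓ Ω f F) (j : ℕ) :
    ∀ w ∈ inside Γ ∩ Ω, contourCLM hΓ (cauchyKernel R hΓ w ^ (j + 1) * F)
      = (2 * Real.pi * Complex.I / (j.factorial : ℂ)) • iteratedDeriv j f w := by
  induction j with
  | zero =>
    intro w hw
    obtain ⟨φ, h1, h2⟩ := hf.exists_slope
    have h := contourCLM_cauchyKernel_mul hΓ hΩ hout h1 h2 hw.2 hw.1.1
    rw [hw.1.2, mul_one] at h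
    simpa using h
  | succ j ih =>
    intro w hw
    have hopen : IsOpen (inside Γ ∩ Ω) := (isOpen_inside hΓ).inter hΩ
    -- Differentiating the formula for j in w raises the power of the kernel and produces the factor
    -- j + 1.
    have h1 : HasDerivAt (fun w => contourCLM hΓ (cauchyKernel R hΓ w ^ (j + 1) * F))
        (((j + 1 : ℕ) : ℂ) • contourCLM hΓ (cauchyKernel R hΓ w ^ (j + 2) * F)) w := by
      have := (contourCLM (E := R) hΓ).hasFDerivAt.comp_hasDerivAt w
        ((hasDerivAt_cauchyKernel_pow (R := R) hΓ hw.1.1 j).mul_const F)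
      refine this.congr_deriv ?_
      rw [smul_mul_assoc, map_smul]
    have h2 : (fun w => contourCLM hΓ (cauchyKernel R hΓ w ^ (j + 1) * F)) =ᶠ[𝓝 w]
        fun w => (2 * Real.pi * Complex.I / (j.factorial : ℂ)) • iteratedDeriv j f w := by
      filter_upwards [hopen.mem_nhds hw] with v hv using ih v hv
    have h3 := h2.deriv_eq
    rw [h1.deriv, deriv_fun_const_smul_field, ← iteratedDeriv_succ] at h3
    have hj : ((j + 1 : ℕ) : ℂ) ≠ 0 := Nat.cast_ne_zero.2 (Nat.succ_ne_zero j)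
    rw [← inv_smul_smul₀ hj (contourCLM hΓ (cauchyKernel R hΓ w ^ (j + 1 + 1) * F)), h3, smul_smul]
    congr 1
    rw [Nat.factorial_succ, Nat.cast_mul]
    field_simp

end Slope

/-! ### Removing the pole of the resolvent at an eigenvalue -/

section RegularResolvent

variable {Γ : ℝ → ℂ} {R : Type*} [NormedRing R] [NormedAlgebra ℂ R] [CompleteSpace R]

/-- The set on which the reduced resolvent is defined. -/
def reducedSet (B P : R) : Set ℂ := {w | IsUnit (B * (1 - P) + P - w • (1 - P))}

theorem isOpen_reducedSet (B P : R) : IsOpen (reducedSet B P) :=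
  Units.isOpen.preimage (by fun_prop : Continuous fun w : ℂ => B * (1 - P) + P - w • (1 - P))

/-- The function `ζ ↦ (ζ - β) (B - ζ)⁻¹` on a neighborhood of the points enclosed by the contour. -/
def regularResolvent (β : ℂ) (B P : R) (ζ : ℂ) : R :=
  (algebraMap ℂ R ζ - algebraMap ℂ R β) *
    (Ring.inverse (B * (1 - P) + P - ζ • (1 - P)) * (1 - P)) - P

theorem regularResolvent_self (β : ℂ) (B P : R) : regularResolvent β B P β = -P := by
  rw [regularResolvent, sub_self, zero_mul, zero_sub]

/-- Decomposition of the inverse of `u` along a projection `p` on which `u` acts as `-c`. -/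
theorem mul_ringInverse_eq {S : Type*} [Ring S] {u c p d : S} (hu : IsUnit u) (hd : IsUnit d)
    (hp : p * p = p) (hcc : ∀ x, Commute c x) (hdef : d = u * (1 - p) + p) (hup : Commute p u)
    (hc : u * p = -(c * p)) :
    c * Ring.inverse u = c * (Ring.inverse d * (1 - p)) - p := by
  have hq : (1 - p) * (1 - p) = 1 - p := by
    rw [mul_sub, mul_one, sub_mul, one_mul, hp, sub_self, sub_zero]
  have hpq : p * (1 - p) = 0 := by rw [mul_sub, mul_one, hp, sub_self]
  have hpd : Commute p d := by
    rw [hdef]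
    exact (hup.mul_right ((Commute.one_right p).sub_right (Commute.refl p))).add_right
      (Commute.refl p)
  have hpv : Commute p (Ring.inverse d) := commute_ringInverse hpd
  have hqv : Commute (1 - p) (Ring.inverse d) := (Commute.one_left _).sub_left hpv
  -- Here d agrees with u on the kernel of p and is the identity on its range; thus d⁻¹(1 - p)
  -- inverts u on the kernel. On the range of p, u acts as -c, which contributes the term -p.
  have e1 : u * (Ring.inverse d * (1 - p)) = 1 - p := by
    have e3 : (u * (1 - p) + p) * Ring.inverse d * (1 - p) = 1 - p := by
      rw [← hdef, Ring.mul_inverse_cancel _ hd, one_mul]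
    rw [add_mul, add_mul, hpv.eq, mul_assoc (Ring.inverse d), hpq, mul_zero, add_zero, mul_assoc u,
      hqv.eq, mul_assoc, mul_assoc, hq] at e3
    exact e3
  have e5 : u * (c * (Ring.inverse d * (1 - p)) - p) = c := by
    rw [mul_sub, ← mul_assoc, ← (hcc u).eq, mul_assoc, e1, hc, sub_neg_eq_add, ← mul_add,
      sub_add_cancel, mul_one]
  have e6 := congrArg (Ring.inverse u * ·) e5
  simp only [Ring.inverse_mul_cancel_left _ _ hu] at e6
  rw [e6]
  exact (hcc _).eq

variable (hΓ : IsContour Γ) {B P : R} {β : ℂ}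

theorem hasHolomorphicSlope_regularResolvent (hB : contourSet Γ ⊆ resolventSet ℂ B)
    (hout : (reducedSet B P)ᶜ ⊆ outside Γ) (hP : P * P = P) (hBP : Commute B P)
    (hβ : B * P = β • P) :
    HasHolomorphicSlope hΓ (reducedSet B P) (regularResolvent β B P)
      ((contourVar R hΓ - algebraMap ℂ _ β) * contourResolvent hΓ B) := by
  have h1 : HasHolomorphicSlope hΓ (reducedSet B P)
      (fun ζ => Ring.inverse (B * (1 - P) + P - ζ • (1 - P)))
      (Ring.inverse (constCLM (B * (1 - P) + P) - contourVar R hΓ * constCLM (1 - P))) :=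
    HasHolomorphicSlope.ringInverse_affine hout fun w hw => hw
  have h2 := ((HasHolomorphicSlope.id.sub (HasHolomorphicSlope.const (algebraMap ℂ R β))).mul
    (h1.mul (HasHolomorphicSlope.const (1 - P)))).sub (HasHolomorphicSlope.const P)
  have h3 : (contourVar R hΓ - algebraMap ℂ _ β) * contourResolvent hΓ B
      = (contourVar R hΓ - constCLM (algebraMap ℂ R β)) *
        (Ring.inverse (constCLM (B * (1 - P) + P) - contourVar R hΓ * constCLM (1 - P)) *
          constCLM (1 - P)) - constCLM P := by
    have hd : IsUnit (constCLM (B * (1 - P) + P) - contourVar R hΓ * constCLM (1 - P)) := by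
      rw [ContinuousMap.isUnit_iff_forall_isUnit]
      intro t
      have h1 : Γ t ∈ reducedSet B P := by
        by_contra h
        exact (hout h).1 ⟨t, t.2, rfl⟩
      have h2 : IsUnit (B * (1 - P) + P - Γ t • (1 - P)) := h1
      rwa [Algebra.smul_def] at h2
    have hb : constCLM (algebraMap ℂ R β) = algebraMap ℂ C(unitInterval, R) β := rfl
    rw [hb, map_sub constCLM 1 P, constCLM_one]
    rw [map_sub constCLM 1 P, constCLM_one] at hd
    refine mul_ringInverse_eq (isUnit_constCLM_sub_contourVar hΓ hB) hd ?_
      (fun X => (contourVar_commute hΓ X).sub_left (Algebra.commutes β X)) ?_ ?_ ?_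
    · rw [← constCLM_mul, hP]
    · rw [map_add, constCLM_mul, map_sub, constCLM_one, sub_mul]
      abel
    · exact Commute.sub_right (congrArg constCLM hBP.symm.eq) (contourVar_commute hΓ _).symm
    · have : constCLM (B * P) = algebraMap ℂ C(unitInterval, R) β * constCLM P := by
        rw [hβ, map_smul]
        exact Algebra.smul_def β (constCLM P)
      rw [sub_mul, ← constCLM_mul, this, sub_mul]
      abel
  rw [h3]
  exact h2

/-- The function `ζ ↦ (ζ - β)ᵖ X₁ R(ζ) ⋯ Xₚ R(ζ)`. -/
def regularProd (β : ℂ) (B P : R) (l : List R) (ζ : ℂ) : R :=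
  (l.map fun X => X * regularResolvent β B P ζ).prod

/-- The integrand `ζ ↦ X₁ R(ζ) ⋯ Xₚ R(ζ)` on the contour. -/
def resolventProd (B : R) (l : List R) : C(unitInterval, R) :=
  (l.map fun X => constCLM X * contourResolvent hΓ B).prod

theorem hasHolomorphicSlope_regularProd (hB : contourSet Γ ⊆ resolventSet ℂ B)
    (hout : (reducedSet B P)ᶜ ⊆ outside Γ) (hP : P * P = P) (hBP : Commute B P)
    (hβ : B * P = β • P) (l : List R) :
    HasHolomorphicSlope hΓ (reducedSet B P) (regularProd β B P l)
      ((l.map fun X => constCLM X * ((contourVar R hΓ - algebraMap ℂ _ β) *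
        contourResolvent hΓ B)).prod) :=
  HasHolomorphicSlope.list_prod l fun X _ =>
    (HasHolomorphicSlope.const X).mul (hasHolomorphicSlope_regularResolvent hΓ hB hout hP hBP hβ)

theorem prod_map_central_mul {S ι : Type*} [Monoid S] (c : S) (hc : ∀ X, Commute c X)
    (l : List ι) (f : ι → S) : (l.map fun i => c * f i).prod = c ^ l.length * (l.map f).prod := by
  induction l with
  | nil => simp
  | cons i l ih =>
    simp only [List.map_cons, List.prod_cons, List.length_cons]
    rw [ih, pow_succ', mul_assoc, mul_assoc, ← mul_assoc (f i), ← mul_assoc (c ^ _),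
      ((hc (f i)).pow_left _).eq]

/-- Each resolvent contributes one central factor (ζ - β)⁻¹; what is left of the product is
holomorphic at β, so Cauchy's formula for derivatives evaluates the integral. -/
theorem resolventProd_eq (hβΓ : β ∉ contourSet Γ) (l : List R) :
    resolventProd hΓ B l = cauchyKernel R hΓ β ^ l.length *
      (l.map fun X => constCLM X * ((contourVar R hΓ - algebraMap ℂ _ β) *
        contourResolvent hΓ B)).prod := by
  rw [← prod_map_central_mul _ fun X => (commute_cauchyKernel hΓ β X).symm, resolventProd]
  congr 2
  ext1 X
  rw [← mul_assoc, ← (commute_cauchyKernel hΓ β (constCLM X)).eq, mul_assoc, cauchyKernel,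
    Ring.inverse_mul_cancel_left _ _ (isUnit_contourVar_sub hΓ hβΓ)]

theorem contourCLM_resolventProd (hB : contourSet Γ ⊆ resolventSet ℂ B)
    (hout : (reducedSet B P)ᶜ ⊆ outside Γ) (hP : P * P = P) (hBP : Commute B P)
    (hβ : B * P = β • P) (hβΓ : β ∈ inside Γ ∩ reducedSet B P) (X : R) (l : List R) :
    contourCLM hΓ (resolventProd hΓ B (X :: l))
      = (2 * Real.pi * Complex.I / (l.length.factorial : ℂ)) •
        iteratedDeriv l.length (regularProd β B P (X :: l)) β := by
  rw [resolventProd_eq hΓ hβΓ.1.1]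
  exact (hasHolomorphicSlope_regularProd hΓ hB hout hP hBP hβ
    (X :: l)).contourCLM_cauchyKernel_pow (isOpen_reducedSet _ _) hout l.length β hβΓ

theorem regularProd_append (β : ℂ) (B P : R) (l l' : List R) :
    regularProd β B P (l ++ l') = regularProd β B P l * regularProd β B P l' := by
  ext1 ζ
  simp [regularProd]

theorem regularProd_cons (β : ℂ) (B P X : R) (l : List R) :
    regularProd β B P (X :: l) = regularProd β B P [X] * regularProd β B P l :=
  regularProd_append β B P [X] l

end RegularResolvent

/-! ### Finite rank and cyclicity of integrals of resolvent products -/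

section Laurent

variable {Γ : ℝ → ℂ} {K : Type*} [NormedAddCommGroup K] [NormedSpace ℂ K] [CompleteSpace K]

/-- The operator is block diagonal: the identity on the range of P and B - w on its kernel. -/
theorem BijectiveOn.isUnit {B P : K →L[ℂ] K} (hP : P * P = P) (hPB : Commute B P) {w : ℂ}
    (h : BijectiveOn B (1 - P).range w) : IsUnit (B * (1 - P) + P - w • (1 - P)) := by
  have hc (x : K) : B (P x) = P (B x) := congrArg (fun Q : K →L[ℂ] K => Q x) hPB.eq
  have hPP (x : K) : P (P x) = P x := congrArg (fun Q : K →L[ℂ] K => Q x) hP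
  have hD (x : K) : (B * (1 - P) + P - w • (1 - P)) x = B (x - P x) + P x - w • (x - P x) := rfl
  have hmem {x : K} (hx : P x = 0) : x ∈ (1 - P).range := by
    rw [← ker_eq_range_one_sub hP]; exact hx
  rw [ContinuousLinearMap.isUnit_iff_bijective]
  refine ⟨(injective_iff_map_eq_zero _).2 fun x hx => ?_, fun y => ?_⟩
  · rw [hD] at hx
    have h0 := congrArg P hx
    rw [map_sub, map_add, map_smul, ← hc, map_sub, hPP, sub_self, map_zero, map_zero, smul_zero,
      zero_add, sub_zero] at h0
    rw [h0, sub_zero, add_zero] at hx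
    exact h.1 x (hmem h0) hx
  · obtain ⟨x, hx, hxy⟩ := h.2 ((1 - P) y) ⟨y, rfl⟩
    have hx0 : P x = 0 := by rwa [← ker_eq_range_one_sub hP] at hx
    refine ⟨P y + x, ?_⟩
    rw [hD, map_add P, hPP, hx0, add_zero, add_sub_cancel_left, add_sub_right_comm, hxy]
    exact sub_add_cancel y (P y)

variable (hΓ : IsContour Γ) {B : K →L[ℂ] K} (hB : contourSet Γ ⊆ resolventSet ℂ B) {β : ℂ}

include hB in
-- On the kernel of P the operator B - w is bijective for w inside Γ by the Riesz projection, and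
-- for w on Γ because such w are regular. So the reduced resolvent is defined where Cauchy's formula
-- needs it.
theorem compl_reducedSet_subset : (reducedSet B (rieszElem hΓ B))ᶜ ⊆ outside Γ := by
  intro w hw
  have hP := rieszElem_mul_self hΓ hB
  have hBP : Commute B (rieszElem hΓ B) := commute_rieszElem hΓ (Commute.refl B)
  have h1 : w ∉ contourSet Γ := by
    intro h
    refine hw (BijectiveOn.isUnit hP hBP ((notMem_spectrum_iff.1 ?_).range (idem_one_sub hP)
      ((Commute.one_right B).sub_right hBP) le_top))
    exact fun h' => h' (hB h)
  refine (hΓ.simple w h1).resolve_left fun h => hw ?_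
  exact BijectiveOn.isUnit hP hBP (bijectiveOn_range_one_sub_rieszElem hΓ hB h)

include hB in
theorem mem_reducedSet (hβΓ : β ∈ inside Γ) : β ∈ reducedSet B (rieszElem hΓ B) := by
  by_contra h
  exact (disjoint_inside_outside Γ).le_bot ⟨hβΓ, compl_reducedSet_subset hΓ hB h⟩

include hB in
theorem contourCLM_resolventProd_cons (hβΓ : β ∈ inside Γ)
    (hβ : B * rieszElem hΓ B = β • rieszElem hΓ B) (X : K →L[ℂ] K) (l : List (K →L[ℂ] K)) :
    contourCLM hΓ (resolventProd hΓ B (X :: l))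
      = (2 * Real.pi * Complex.I / (l.length.factorial : ℂ)) •
        iteratedDeriv l.length (regularProd β B (rieszElem hΓ B) (X :: l)) β :=
  contourCLM_resolventProd hΓ hB (compl_reducedSet_subset hΓ hB) (rieszElem_mul_self hΓ hB)
    (commute_rieszElem hΓ (Commute.refl B)) hβ ⟨hβΓ, mem_reducedSet hΓ hB hβΓ⟩ X l

include hB in
theorem contDiffAt_regularProd (hβΓ : β ∈ inside Γ)
    (hβ : B * rieszElem hΓ B = β • rieszElem hΓ B) (l : List (K →L[ℂ] K)) (k : ℕ) :
    ContDiffAt ℂ k (regularProd β B (rieszElem hΓ B) l) β :=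
  ((hasHolomorphicSlope_regularProd hΓ hB (compl_reducedSet_subset hΓ hB)
    (rieszElem_mul_self hΓ hB) (commute_rieszElem hΓ (Commute.refl B)) hβ l).differentiableOn.contDiffOn
    (isOpen_reducedSet _ _)).contDiffAt
    ((isOpen_reducedSet _ _).mem_nhds (mem_reducedSet hΓ hB hβΓ))

theorem finiteRank_regularProd_singleton {P : K →L[ℂ] K} (hf : FiniteRank P) (X : K →L[ℂ] K) :
    FiniteRank (regularProd β B P [X] β) := by
  simp only [regularProd, List.map_cons, List.map_nil, List.prod_cons, List.prod_nil, mul_one,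
    regularResolvent_self]
  rw [← neg_one_smul ℂ P]
  exact (hf.smul _).mul_left X

include hB in
-- Fewer derivatives than factors leave at least one factor undifferentiated in each Leibniz term,
-- and at β that factor is -XP.
theorem finiteRank_iteratedDeriv_regularProd (hβΓ : β ∈ inside Γ)
    (hβ : B * rieszElem hΓ B = β • rieszElem hΓ B) (hf : FiniteRank (rieszElem hΓ B))
    (l : List (K →L[ℂ] K)) :
    ∀ j < l.length, FiniteRank (iteratedDeriv j (regularProd β B (rieszElem hΓ B) l) β) := by
  induction l with
  | nil => intro j hj; simp at hj
  | cons X l ih =>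
    intro j hj
    rw [regularProd_cons]
    refine finiteRank_iteratedDeriv_mul (contDiffAt_regularProd hΓ hB hβΓ hβ _ _)
      (contDiffAt_regularProd hΓ hB hβΓ hβ _ _) fun i i' hi => ?_
    rcases Nat.eq_zero_or_pos i with rfl | h
    · left
      rw [iteratedDeriv_zero]
      exact finiteRank_regularProd_singleton hf X
    · right
      rw [List.length_cons] at hj
      exact ih i' (by omega)

include hB in
theorem finiteRank_contourCLM_resolventProd (hβΓ : β ∈ inside Γ)
    (hβ : B * rieszElem hΓ B = β • rieszElem hΓ B) (hf : FiniteRank (rieszElem hΓ B))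
    {l : List (K →L[ℂ] K)} (hl : l ≠ []) :
    FiniteRank (contourCLM hΓ (resolventProd hΓ B l)) := by
  obtain ⟨X, l, rfl⟩ := List.exists_cons_of_ne_nil hl
  rw [contourCLM_resolventProd_cons hΓ hB hβΓ hβ]
  exact (finiteRank_iteratedDeriv_regularProd hΓ hB hβΓ hβ hf _ _ (by simp)).smul _

include hB in
/-- The trace of `∮ X₁ R(ζ) ⋯ Xₚ R(ζ) dζ` is invariant under cyclic permutations. -/
theorem finiteRankTrace_contourCLM_resolventProd (hβΓ : β ∈ inside Γ)
    (hβ : B * rieszElem hΓ B = β • rieszElem hΓ B) (hf : FiniteRank (rieszElem hΓ B))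
    (X : K →L[ℂ] K) (l : List (K →L[ℂ] K)) :
    finiteRankTrace (contourCLM hΓ (resolventProd hΓ B (X :: l)))
      = finiteRankTrace (contourCLM hΓ (resolventProd hΓ B (l ++ [X]))) := by
  rcases l with _ | ⟨Y, l⟩
  · rfl
  rw [List.cons_append, contourCLM_resolventProd_cons hΓ hB hβΓ hβ, contourCLM_resolventProd_cons hΓ hB hβΓ hβ,
    finiteRankTrace_smul (finiteRank_iteratedDeriv_regularProd hΓ hB hβΓ hβ hf _ _ (by simp)),
    finiteRankTrace_smul (finiteRank_iteratedDeriv_regularProd hΓ hB hβΓ hβ hf _ _ (by simp))]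
  have hlen : (l ++ [X]).length = (Y :: l).length := by simp
  rw [hlen, regularProd_cons, ← List.cons_append, regularProd_append]
  congr 1
  refine finiteRankTrace_iteratedDeriv_mul_comm (contDiffAt_regularProd hΓ hB hβΓ hβ _ _)
    (contDiffAt_regularProd hΓ hB hβΓ hβ _ _) fun i i' hi => ?_
  -- The order of the derivative is the length of `Y :: l`. Either the factor with X is
  -- undifferentiated, or fewer derivatives than factors fall on the rest.
  rcases Nat.eq_zero_or_pos i with rfl | h
  · left
    rw [iteratedDeriv_zero]
    exact finiteRank_regularProd_singleton hf X
  · right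
    exact finiteRank_iteratedDeriv_regularProd hΓ hB hβΓ hβ hf _ i' (by omega)

end Laurent

/-! ### Sums over compositions -/

section Compositions

/-- Splitting off the first block of a composition. -/
theorem sum_composition_succ {M : Type*} [AddCommMonoid M] (n : ℕ) (g : List ℕ → M) :
    ∑ c : Composition (n + 1), g c.blocks
      = ∑ p ∈ Finset.HasAntidiagonal.antidiagonal n, ∑ c : Composition p.2, g ((p.1 + 1) :: c.blocks) := by
  rw [Finset.sum_sigma']
  symm
  refine Finset.sum_bij (fun x hx => ⟨(x.1.1 + 1) :: x.2.blocks, ?_, ?_⟩) ?_ ?_ ?_ ?_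
  · intro i hi
    rcases List.mem_cons.1 hi with rfl | hi
    · exact Nat.succ_pos _
    · exact x.2.blocks_pos hi
  · have h := Finset.HasAntidiagonal.mem_antidiagonal.1 (Finset.mem_sigma.1 hx).1
    rw [List.sum_cons, x.2.blocks_sum, ← h]
    omega
  · intro _ _
    exact Finset.mem_univ _
  · rintro ⟨⟨i, j⟩, c⟩ _ ⟨⟨i', j'⟩, c'⟩ _ h
    have h1 := congrArg Composition.blocks h
    simp only [List.cons.injEq, add_left_inj] at h1
    obtain ⟨rfl, h2⟩ := h1
    have h3 : j = j' := c.blocks_sum.symm.trans ((congrArg List.sum h2).trans c'.blocks_sum)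
    subst h3
    rw [Composition.ext h2]
  · intro c _
    obtain ⟨b, l, hbl⟩ : ∃ b l, c.blocks = b :: l :=
      List.exists_cons_of_ne_nil (by rw [ne_eq, Composition.blocks_eq_nil]; omega)
    have hb : 0 < b := c.blocks_pos (by rw [hbl]; exact List.mem_cons_self)
    have hs : b + l.sum = n + 1 := by rw [← List.sum_cons, ← hbl, c.blocks_sum]
    -- Blocks are positive, so the first one is stored as its predecessor; this turns the sum n + 1
    -- into an antidiagonal of n.
    refine ⟨⟨(b - 1, l.sum), ⟨l, fun hi => c.blocks_pos (hbl ▸ List.mem_cons_of_mem b hi), rfl⟩⟩, ?_, ?_⟩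
    · rw [Finset.mem_sigma, Finset.HasAntidiagonal.mem_antidiagonal]
      exact ⟨by dsimp only; omega, Finset.mem_univ _⟩
    · refine Composition.ext ?_
      exact (congrArg (· :: l) (Nat.sub_add_cancel hb)).trans hbl.symm
  · intro _ _
    rfl

/-- Cyclic rotation of the blocks of a composition. -/
def rotateComposition {n : ℕ} (i : ℕ) (c : Composition n) : Composition n where
  blocks := c.blocks.rotate i
  blocks_pos := fun h => c.blocks_pos (List.mem_rotate.1 h)
  blocks_sum := by rw [(List.rotate_perm c.blocks i).sum_eq, c.blocks_sum]

theorem bijective_rotateComposition {n : ℕ} (i : ℕ) :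
    Function.Bijective (rotateComposition (n := n) i) := by
  refine Finite.injective_iff_bijective.1 fun c c' h => Composition.ext ?_
  exact List.rotate_injective i (congrArg Composition.blocks h)

theorem length_rotateComposition {n : ℕ} (i : ℕ) (c : Composition n) :
    (rotateComposition i c).length = c.length := List.length_rotate ..

/-- For fixed i, rotation by i permutes the compositions and preserves their length. Summation over
i is therefore taken outside, over the common range `i < n`, with a cutoff at the length. -/
theorem sum_rotateComposition {n : ℕ} (f : Composition n → ℂ) :
    ∑ c, ∑ i ∈ Finset.range c.length, f (rotateComposition i c)
      = ∑ c : Composition n, (c.length : ℂ) * f c := by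
  have h1 (g : Composition n → ℕ → ℂ) :
      ∑ c, ∑ i ∈ Finset.range c.length, g c i
        = ∑ i ∈ Finset.range n, ∑ c, if i < c.length then g c i else 0 := by
    rw [Finset.sum_comm]
    refine Finset.sum_congr rfl fun c _ => ?_
    rw [← Finset.sum_filter]
    refine Finset.sum_congr ?_ fun _ _ => rfl
    ext i
    have := c.length_le
    simp only [Finset.mem_range, Finset.mem_filter]
    omega
  rw [h1]
  have h2 (i : ℕ) : ∑ c : Composition n, (if i < c.length then f (rotateComposition i c) else 0)
      = ∑ c : Composition n, if i < c.length then f c else 0 := by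
    refine Fintype.sum_bijective _ (bijective_rotateComposition i) _ _ fun c => ?_
    rw [length_rotateComposition]
  rw [Finset.sum_congr rfl fun i _ => h2 i, ← h1 fun c _ => f c]
  refine Finset.sum_congr rfl fun c _ => ?_
  rw [Finset.sum_const, Finset.card_range, nsmul_eq_mul]

/-- For a function of compositions that is invariant under cyclic rotations, the first block
has mean `n / p` over the compositions of `n` with `p` blocks. -/
theorem sum_head_mul_composition {n : ℕ} (hn : 0 < n) {F : List ℕ → ℂ}
    (hF : ∀ a l, F (a :: l) = F (l ++ [a])) :
    ∑ c : Composition n, (c.blocks.headI : ℂ) * F c.blocks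
      = n * ∑ c : Composition n, (c.length : ℂ)⁻¹ * F c.blocks := by
  have hrot (l : List ℕ) (i : ℕ) : F (l.rotate i) = F l := by
    induction i generalizing l with
    | zero => rw [List.rotate_zero]
    | succ i ih =>
      rcases l with _ | ⟨a, l⟩
      · rfl
      · rw [List.rotate_cons_succ, ih, ← hF]
  have hlen (c : Composition n) : (c.length : ℂ) ≠ 0 :=
    Nat.cast_ne_zero.2 (c.length_pos_of_pos hn).ne'
  have h1 := sum_rotateComposition (n := n)
    fun c => (c.length : ℂ)⁻¹ * ((c.blocks.headI : ℂ) * F c.blocks)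
  have h2 : ∑ c : Composition n, (c.length : ℂ) *
      ((c.length : ℂ)⁻¹ * ((c.blocks.headI : ℂ) * F c.blocks))
      = ∑ c : Composition n, (c.blocks.headI : ℂ) * F c.blocks :=
    Finset.sum_congr rfl fun c _ => mul_inv_cancel_left₀ (hlen c) _
  rw [← h2, ← h1, Finset.mul_sum]
  refine Finset.sum_congr rfl fun c _ => ?_
  have h3 : ∀ i ∈ Finset.range c.length,
      ((rotateComposition i c).length : ℂ)⁻¹ * (((rotateComposition i c).blocks.headI : ℂ) *
        F (rotateComposition i c).blocks)
      = (c.blocks.getD i 0 : ℂ) * ((c.length : ℂ)⁻¹ * F c.blocks) := by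
    intro i hi
    have hi' : i < c.blocks.length := Finset.mem_range.1 hi
    -- Rotation by i brings the i-th block to the front, so over all rotations the weights add up to
    -- the sum n of the blocks.
    have h4 : (rotateComposition i c).blocks.headI = c.blocks.getD i 0 := by
      change (c.blocks.rotate i).headI = _
      have h5 := List.head?_rotate hi'
      rw [List.getD_eq_getElem?_getD, ← h5]
      rcases c.blocks.rotate i with _ | ⟨a, l⟩ <;> rfl
    rw [length_rotateComposition, h4, show (rotateComposition i c).blocks = c.blocks.rotate i from
      rfl, hrot]
    ring
  rw [Finset.sum_congr rfl h3, ← Finset.sum_mul]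
  congr 1
  rw [← Nat.cast_sum]
  congr 1
  conv_rhs => rw [← c.blocks_sum]
  rw [← Fin.sum_univ_getElem, Finset.sum_range]
  refine Finset.sum_congr rfl fun i _ => ?_
  exact List.getD_eq_getElem _ _ i.2

end Compositions

/-! ### Taylor coefficients -/

section Taylor

variable {E E' : Type*} [NormedAddCommGroup E] [NormedSpace ℂ E] [NormedAddCommGroup E']
  [NormedSpace ℂ E']

/-- The Taylor coefficients of `f` at `0`. -/
def taylorCoeff (k : ℕ) (f : ℂ → E) : E := (k.factorial : ℂ)⁻¹ • iteratedDeriv k f 0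

theorem iteratedDeriv_clm_comp (L : E →L[ℂ] E') {f : ℂ → E} {x : ℂ} {k : ℕ}
    (hf : ContDiffAt ℂ k f x) :
    iteratedDeriv k (fun z => L (f z)) x = L (iteratedDeriv k f x) := by
  have h := L.iteratedFDeriv_comp_left hf le_rfl
  rw [iteratedDeriv_eq_iteratedFDeriv, iteratedDeriv_eq_iteratedFDeriv]
  exact congrArg (fun m => m fun _ => 1) h

theorem taylorCoeff_clm_comp (L : E →L[ℂ] E') {f : ℂ → E} {k : ℕ} (hf : ContDiffAt ℂ k f 0) :
    taylorCoeff k (fun z => L (f z)) = L (taylorCoeff k f) := by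
  rw [taylorCoeff, iteratedDeriv_clm_comp L hf, taylorCoeff, map_smul]

theorem taylorCoeff_zero (f : ℂ → E) : taylorCoeff 0 f = f 0 := by simp [taylorCoeff]

theorem taylorCoeff_deriv (k : ℕ) (f : ℂ → E) :
    taylorCoeff k (deriv f) = ((k + 1 : ℕ) : ℂ) • taylorCoeff (k + 1) f := by
  rw [taylorCoeff, taylorCoeff, ← iteratedDeriv_succ', smul_smul, Nat.factorial_succ, Nat.cast_mul,
    mul_inv, mul_inv_cancel_left₀ (Nat.cast_ne_zero.2 (Nat.succ_ne_zero k))]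

theorem taylorCoeff_congr {f g : ℂ → E} (h : f =ᶠ[𝓝 0] g) (k : ℕ) :
    taylorCoeff k f = taylorCoeff k g := by
  rw [taylorCoeff, taylorCoeff, h.iteratedDeriv_eq]

theorem taylorCoeff_mul {R : Type*} [NormedRing R] [NormedAlgebra ℂ R] {f g : ℂ → R} {k : ℕ}
    (hf : ContDiffAt ℂ k f 0) (hg : ContDiffAt ℂ k g 0) :
    taylorCoeff k (f * g) = ∑ p ∈ Finset.HasAntidiagonal.antidiagonal k,
      taylorCoeff p.1 f * taylorCoeff p.2 g := by
  rw [taylorCoeff, iteratedDeriv_mul_eq_sum hf hg, Finset.smul_sum,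
    Finset.Nat.sum_antidiagonal_eq_sum_range_succ_mk]
  refine Finset.sum_congr rfl fun i hi => ?_
  have hik : i ≤ k := Nat.lt_succ_iff.1 (Finset.mem_range.1 hi)
  rw [taylorCoeff, taylorCoeff, smul_mul_smul_comm, smul_smul, Nat.cast_choose ℂ hik]
  congr 1
  have h1 : (k.factorial : ℂ) ≠ 0 := Nat.cast_ne_zero.2 k.factorial_ne_zero
  field_simp

theorem taylorCoeff_const (c : E) {k : ℕ} (hk : k ≠ 0) : taylorCoeff k (fun _ : ℂ => c) = 0 := by
  rw [taylorCoeff, iteratedDeriv_const, if_neg hk, smul_zero]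

theorem taylorCoeff_sub_const {f : ℂ → E} {k : ℕ} (hk : k ≠ 0)
    (hf : ContDiffAt ℂ k f 0) (c : E) :
    taylorCoeff k (fun z => f z - c) = taylorCoeff k f := by
  have h : iteratedDeriv k (f - fun _ => c) 0 = _ := iteratedDeriv_sub hf contDiffAt_const
  rw [iteratedDeriv_const, if_neg hk, sub_zero] at h
  rw [taylorCoeff, taylorCoeff, ← h]
  rfl

theorem contDiffAt_of_differentiableOn [CompleteSpace E] {f : ℂ → E} {U : Set ℂ} (hU : IsOpen U)
    (hf : DifferentiableOn ℂ f U) {z : ℂ} (hz : z ∈ U) (k : ℕ) : ContDiffAt ℂ k f z :=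
  (hf.contDiffOn hU).contDiffAt (hU.mem_nhds hz)

/-- The Taylor series of a holomorphic function on a disc converges uniformly on smaller discs. -/
theorem tendstoUniformlyOn_taylor {g : ℂ → ℂ} {r s : ℝ} (hs : 0 < s) (hsr : s < r)
    (hg : DifferentiableOn ℂ g (Metric.ball 0 r)) :
    TendstoUniformlyOn (fun N z => g 0 + ∑ k ∈ Finset.Icc 1 N, z ^ k * taylorCoeff k g) g atTop
      (Metric.ball 0 s) := by
  -- A closed disc of radius q strictly between s and r supplies the Cauchy power series; uniform
  -- convergence then holds on the smaller disc of radius s.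
  obtain ⟨q, hsq, hqr⟩ := exists_between hsr
  have hq : 0 < q := hs.trans hsq
  lift q to ℝ≥0 using hq.le
  lift s to ℝ≥0 using hs.le
  have h1 := (hg.mono (Metric.closedBall_subset_ball hqr)).hasFPowerSeriesOnBall hq
  have h2 := (hg.analyticAt (Metric.ball_mem_nhds 0 (hs.trans hsr))).hasFPowerSeriesAt
  have h3 := h1.hasFPowerSeriesAt.eq_formalMultilinearSeries h2
  rw [h3] at h1
  have h4 := h1.tendstoUniformlyOn (r' := s) (by exact_mod_cast hsq)
  have h6 : TendstoUniformlyOn _ _ atTop _ := fun u hu => (tendsto_add_atTop_nat 1).eventually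
    (h4 u hu)
  simp only [zero_add] at h6
  refine h6.congr (Eventually.of_forall fun N z _ => ?_)
  simp only [FormalMultilinearSeries.partialSum]
  rw [Finset.sum_range_succ']
  have h8 : Finset.Icc 1 N = (Finset.range N).map (addRightEmbedding 1) := by
    ext i
    simp only [Finset.mem_Icc, Finset.mem_map, Finset.mem_range, addRightEmbedding_apply]
    constructor
    · intro h
      exact ⟨i - 1, by omega, by omega⟩
    · rintro ⟨a, h, rfl⟩
      omega
  rw [h8, Finset.sum_map, add_comm]
  congr 1
  · simp [FormalMultilinearSeries.ofScalars]
  · refine Finset.sum_congr rfl fun k _ => ?_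
    simp [FormalMultilinearSeries.ofScalars, taylorCoeff]
    ring

end Taylor

/-! ### Holomorphic families in a Banach algebra -/

section Family

variable {Γ : ℝ → ℂ} {R : Type*} [NormedRing R] [NormedAlgebra ℂ R] [CompleteSpace R]
  (hΓ : IsContour Γ) {A : ℂ → R} {U : Set ℂ}

theorem differentiableOn_contourResolvent (hA : DifferentiableOn ℂ A U)
    (hρ : ∀ z ∈ U, contourSet Γ ⊆ resolventSet ℂ (A z)) :
    DifferentiableOn ℂ (fun z => contourResolvent hΓ (A z)) U :=
  DifferentiableOn.inverse (𝕜 := ℂ) (h := fun z => constCLM (A z) - contourVar R hΓ)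
    ((constCLM.differentiable.comp_differentiableOn hA).sub_const _)
    fun z hz => isUnit_constCLM_sub_contourVar hΓ (hρ z hz)

theorem differentiableOn_rieszElem (hA : DifferentiableOn ℂ A U)
    (hρ : ∀ z ∈ U, contourSet Γ ⊆ resolventSet ℂ (A z)) :
    DifferentiableOn ℂ (fun z => rieszElem hΓ (A z)) U := by
  have h := (contourCLM hΓ).differentiable.comp_differentiableOn
    (differentiableOn_contourResolvent hΓ hA hρ)
  exact h.fun_const_smul (-1 / (2 * Real.pi * Complex.I) : ℂ)

/-- The Taylor coefficients of an inverse, as sums over compositions. -/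
theorem taylorCoeff_inverse {S : Type*} [NormedRing S] [NormedAlgebra ℂ S] {u v : ℂ → S}
    (hu : ∀ k : ℕ, ContDiffAt ℂ k u 0) (hv : ∀ k : ℕ, ContDiffAt ℂ k v 0)
    (huv : u * v =ᶠ[𝓝 0] fun _ => 1) (hvu : v 0 * u 0 = 1) (l : ℕ) :
    taylorCoeff l v = v 0 * ∑ c : Composition l, ((-1 : ℂ) ^ c.length) •
        (c.blocks.map fun k => taylorCoeff k u * v 0).prod := by
  induction l using Nat.strong_induction_on with
  | _ l ih =>
  rcases l with _ | l
  · have h0 (c : Composition 0) : c.blocks = [] := (Composition.blocks_eq_nil c).2 rfl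
    rw [taylorCoeff_zero, Fintype.sum_eq_single (default : Composition 0) fun c hc =>
      absurd (Composition.ext ((h0 c).trans (h0 _).symm)) hc]
    have h2 : (default : Composition 0).length = 0 := by rw [← Composition.blocks_length, h0]; rfl
    rw [h0, h2, pow_zero, one_smul, List.map_nil, List.prod_nil, mul_one]
  · have h2 := taylorCoeff_congr huv (l + 1)
    rw [taylorCoeff_const _ (Nat.succ_ne_zero l), taylorCoeff_mul (hu _) (hv _),
      Finset.Nat.sum_antidiagonal_succ, taylorCoeff_zero] at h2
    -- The recursion: the coefficient of order l + 1 in u v = 1 is zero; multiplying by v(0)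
    -- isolates the top coefficient of v. The index in u of each remaining term becomes the first
    -- block of a composition.
    have h4 := congrArg (v 0 * ·) h2
    simp only [mul_add, mul_zero] at h4
    rw [← mul_assoc, hvu, one_mul] at h4
    rw [eq_neg_of_add_eq_zero_left h4, ← mul_neg, sum_composition_succ l fun b =>
      ((-1 : ℂ) ^ b.length) • (b.map fun k => taylorCoeff k u * v 0).prod]
    rw [← Finset.sum_neg_distrib]
    congr 1
    refine Finset.sum_congr rfl fun p hp => ?_
    have hp' := Finset.HasAntidiagonal.mem_antidiagonal.1 hp
    rw [ih p.2 (by omega), ← mul_assoc, ← mul_neg, ← Finset.sum_neg_distrib,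
      Finset.mul_sum]
    refine Finset.sum_congr rfl fun c _ => ?_
    rw [List.map_cons, List.prod_cons, List.length_cons, Composition.blocks_length, pow_succ,
      mul_neg_one, neg_smul, mul_neg, mul_smul_comm]

/-- The Taylor coefficients of the resolvent as sums over compositions. -/
theorem taylorCoeff_contourResolvent (hU : IsOpen U) (h0 : (0 : ℂ) ∈ U)
    (hA : DifferentiableOn ℂ A U) (hρ : ∀ z ∈ U, contourSet Γ ⊆ resolventSet ℂ (A z)) (l : ℕ) :
    taylorCoeff l (fun z => contourResolvent hΓ (A z)) = contourResolvent hΓ (A 0) *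
      ∑ c : Composition l, ((-1 : ℂ) ^ c.length) •
        resolventProd hΓ (A 0) (c.blocks.map fun k => taylorCoeff k A) := by
  have hd := differentiableOn_contourResolvent hΓ hA hρ
  have hc := constCLM.differentiable.comp_differentiableOn hA
  have hc' (k : ℕ) := contDiffAt_of_differentiableOn hU hc h0 k
  have hu (k : ℕ) := contDiffAt_of_differentiableOn hU (hc.sub_const (contourVar R hΓ)) h0 k
  have h1 := taylorCoeff_inverse (u := fun z => constCLM (A z) - contourVar R hΓ)
    (v := fun z => contourResolvent hΓ (A z)) hu
    (fun k => contDiffAt_of_differentiableOn hU hd h0 k) (by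
      filter_upwards [hU.mem_nhds h0] with z hz
      exact Ring.mul_inverse_cancel _ (isUnit_constCLM_sub_contourVar hΓ (hρ z hz)))
    (Ring.inverse_mul_cancel _ (isUnit_constCLM_sub_contourVar hΓ (hρ 0 h0))) l
  rw [h1]
  congr 1
  refine Finset.sum_congr rfl fun c _ => ?_
  congr 1
  rw [resolventProd, List.map_map]
  congr 1
  refine List.map_congr_left fun k hk => ?_
  have hk0 : k ≠ 0 := (c.blocks_pos hk).ne'
  exact congrArg (· * contourResolvent hΓ (A 0)) ((taylorCoeff_sub_const hk0 (hc' k) _).trans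
    (taylorCoeff_clm_comp constCLM (contDiffAt_of_differentiableOn hU hA h0 k)))

/-- The Taylor coefficients of `A'(z) P(z)`, with `P(z)` the Riesz projection. -/
theorem taylorCoeff_deriv_mul_rieszElem (hU : IsOpen U) (h0 : (0 : ℂ) ∈ U)
    (hA : DifferentiableOn ℂ A U) (hρ : ∀ z ∈ U, contourSet Γ ⊆ resolventSet ℂ (A z)) (n : ℕ) :
    taylorCoeff n (fun z => deriv A z * rieszElem hΓ (A z)) =
      (2 * Real.pi * Complex.I : ℂ)⁻¹ • ∑ c : Composition (n + 1),
        ((-1 : ℂ) ^ c.length * (c.blocks.headI : ℂ)) • contourCLM hΓ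
          (resolventProd hΓ (A 0) (c.blocks.map fun k => taylorCoeff k A)) := by
  have hd := differentiableOn_contourResolvent hΓ hA hρ
  have hd' (k : ℕ) := contDiffAt_of_differentiableOn hU hd h0 k
  have hP (k : ℕ) : taylorCoeff k (fun z => rieszElem hΓ (A z)) =
      (-1 / (2 * Real.pi * Complex.I) : ℂ) • contourCLM hΓ (contourResolvent hΓ (A 0) *
      ∑ c : Composition k, ((-1 : ℂ) ^ c.length) •
        resolventProd hΓ (A 0) (c.blocks.map fun k => taylorCoeff k A)) := by
    rw [← taylorCoeff_contourResolvent hΓ hU h0 hA hρ k]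
    exact taylorCoeff_clm_comp ((-1 / (2 * Real.pi * Complex.I) : ℂ) • contourCLM hΓ) (hd' k)
  have h1 := taylorCoeff_mul (k := n)
    (contDiffAt_of_differentiableOn hU (hA.deriv hU) h0 n)
    (contDiffAt_of_differentiableOn hU (differentiableOn_rieszElem hΓ hA hρ) h0 n)
  refine h1.trans ?_
  rw [sum_composition_succ n fun b => ((-1 : ℂ) ^ b.length * (b.headI : ℂ)) • contourCLM hΓ
          (resolventProd hΓ (A 0) (b.map fun k => taylorCoeff k A)), Finset.smul_sum]
  -- The coefficient of order p.1 of A' is (p.1 + 1) A_{p.1 + 1}: the new first block is p.1 + 1,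
  -- and it also appears as the weight.
  refine Finset.sum_congr rfl fun p _ => ?_
  rw [hP, taylorCoeff_deriv, mul_smul_comm, ← contourCLM_const_mul, Finset.mul_sum, Finset.mul_sum,
    map_sum, Finset.smul_sum, Finset.smul_sum]
  refine Finset.sum_congr rfl fun c _ => ?_
  have h2 : resolventProd hΓ (A 0) (((p.1 + 1) :: c.blocks).map fun k => taylorCoeff k A) =
      constCLM (taylorCoeff (p.1 + 1) A) * (contourResolvent hΓ (A 0) *
        resolventProd hΓ (A 0) (c.blocks.map fun k => taylorCoeff k A)) := by
    rw [resolventProd, List.map_cons, List.map_cons, List.prod_cons, mul_assoc]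
    rfl
  rw [h2, mul_smul_comm, mul_smul_comm]
  have h3 (F : C(unitInterval, R)) : contourCLM hΓ (constCLM (((p.1 + 1 : ℕ) : ℂ) •
      taylorCoeff (p.1 + 1) A) * F) = ((p.1 + 1 : ℕ) : ℂ) • contourCLM hΓ
        (constCLM (taylorCoeff (p.1 + 1) A) * F) := by
    rw [contourCLM_const_mul, contourCLM_const_mul, smul_mul_assoc]
  have h4 (a : ℂ) (F : C(unitInterval, R)) : contourCLM hΓ (a • F) = a • contourCLM hΓ F :=
    map_smul _ _ _
  rw [h4, h3, smul_smul, smul_smul, smul_smul, List.length_cons, Composition.blocks_length]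
  congr 1
  simp only [List.headI_cons]
  rw [pow_succ]
  ring

end Family

/-! ### Traces along holomorphic families of projections of finite rank -/

section TraceFamily

variable {K : Type*} [NormedAddCommGroup K] [NormedSpace ℂ K] [CompleteSpace K]
  {X P : ℂ → K →L[ℂ] K} {U : Set ℂ}

/-- Near each point, a holomorphic family of projections is conjugate to a constant one. -/
theorem exists_conjugation (hU : IsOpen U) (hP : DifferentiableOn ℂ P U)
    (hPP : ∀ z ∈ U, P z * P z = P z) {z₀ : ℂ} (hz₀ : z₀ ∈ U) :
    ∃ (V : Set ℂ) (W W' : ℂ → K →L[ℂ] K), IsOpen V ∧ z₀ ∈ V ∧ V ⊆ U ∧ DifferentiableOn ℂ W V ∧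
      DifferentiableOn ℂ W' V ∧ ∀ z ∈ V, P z = W' z * P z₀ * W z := by
  -- W intertwines the projections, W(z)P(z) = P(z₀)W(z), and is invertible near z₀ because W(z₀) =
  -- 1.
  set W : ℂ → K →L[ℂ] K := fun z => P z₀ * P z + (1 - P z₀) * (1 - P z) with hWdef
  have hW : DifferentiableOn ℂ W U := (hP.const_mul _).add ((hP.const_sub _).const_mul _)
  have h0 : W z₀ = 1 := by
    rw [hWdef]
    dsimp only
    rw [idem_one_sub (hPP z₀ hz₀), hPP z₀ hz₀]
    abel
  have hO : IsOpen (U ∩ W ⁻¹' {x | IsUnit x}) := hW.continuousOn.isOpen_inter_preimage hU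
    Units.isOpen
  refine ⟨_, W, fun z => Ring.inverse (W z), hO, ⟨hz₀, ?_⟩, inter_subset_left,
    hW.mono inter_subset_left, (hW.mono inter_subset_left).inverse fun z hz => hz.2, ?_⟩
  · change IsUnit (W z₀)
    rw [h0]
    exact isUnit_one
  · rintro z ⟨hz, hu⟩
    have h1 : W z * P z = P z₀ * W z := by
      simp only [hWdef]
      have h2 := hPP z hz
      have h3 := hPP z₀ hz₀
      have h4 : (1 - P z) * P z = 0 := by rw [sub_mul, one_mul, h2, sub_self]
      have h5 : P z₀ * (1 - P z₀) = 0 := by rw [mul_sub, mul_one, h3, sub_self]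
      rw [add_mul, mul_add, mul_assoc, h2, mul_assoc, h4, ← mul_assoc, h3, ← mul_assoc, h5,
        mul_zero, zero_mul]
    rw [mul_assoc, ← h1, Ring.inverse_mul_cancel_left _ _ hu]

variable (hU : IsOpen U) (hX : DifferentiableOn ℂ X U) (hP : DifferentiableOn ℂ P U)
    (hPP : ∀ z ∈ U, P z * P z = P z) (hf : ∀ z ∈ U, FiniteRank (P z))

include hU hX hP hPP hf in
-- The range of P(z) moves, so the trace is first moved to a fixed space. With P = W' P(z₀) W,
-- cyclicity gives tr(XP) = tr(P(z₀) W X W' P(z₀)), a fixed continuous functional of a holomorphic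
-- family. Moving back after differentiating uses cyclicity for derivatives of products.
theorem finiteRankTrace_family {z₀ : ℂ} (hz₀ : z₀ ∈ U) :
    DifferentiableAt ℂ (fun z => finiteRankTrace (X z * P z)) z₀ ∧
    ∀ k, FiniteRank (iteratedDeriv k (fun z => X z * P z) z₀) ∧
      iteratedDeriv k (fun z => finiteRankTrace (X z * P z)) z₀ =
        finiteRankTrace (iteratedDeriv k (fun z => X z * P z) z₀) := by
  obtain ⟨V, W, W', hV, hzV, hVU, hW, hW', hPW⟩ := exists_conjugation hU hP hPP hz₀
  obtain ⟨θ, hθ⟩ := exists_clm_finiteRankTrace (hPP z₀ hz₀) (hf z₀ hz₀)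
  have hXV := hX.mono hVU
  have hG : DifferentiableOn ℂ (fun z => W z * X z * W' z) V := (hW.mul hXV).mul hW'
  have h1 : ∀ z ∈ V, finiteRankTrace (X z * P z) = θ (W z * X z * W' z) := by
    intro z hz
    rw [hθ, hPW z hz, ← mul_assoc, ← mul_assoc,
      ← finiteRankTrace_mul_comm ((hf z₀ hz₀).mul_left (X z * W' z)) (W z)]
    have h3 : W z * (X z * W' z * P z₀) = (W z * X z * W' z * P z₀) * P z₀ := by
      rw [mul_assoc (W z * X z * W' z), hPP z₀ hz₀]
      simp only [mul_assoc]
    rw [h3, ← finiteRankTrace_mul_comm ((hf z₀ hz₀).mul_left _), ← mul_assoc]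
  have h1' : (fun z => finiteRankTrace (X z * P z)) =ᶠ[𝓝 z₀] fun z => θ (W z * X z * W' z) := by
    filter_upwards [hV.mem_nhds hzV] with z hz using h1 z hz
  have hGd := hG.differentiableAt (hV.mem_nhds hzV)
  refine ⟨(θ.differentiableAt.comp z₀ hGd).congr_of_eventuallyEq h1', fun k => ?_⟩
  -- Repeating P(z₀) in both factors makes each derivative of f end in P(z₀), hence of finite rank.
  set f : ℂ → K →L[ℂ] K := fun z => X z * W' z * P z₀ with hfdef
  set g : ℂ → K →L[ℂ] K := fun z => P z₀ * W z with hgdef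
  have hfk (k : ℕ) : ContDiffAt ℂ k f z₀ :=
    contDiffAt_of_differentiableOn hV ((hXV.mul hW').mul_const _) hzV k
  have hgk (k : ℕ) : ContDiffAt ℂ k g z₀ :=
    contDiffAt_of_differentiableOn hV (hW.const_mul _) hzV k
  have h2 : (fun z => X z * P z) =ᶠ[𝓝 z₀] f * g := by
    filter_upwards [hV.mem_nhds hzV] with z hz
    rw [hPW z hz, Pi.mul_apply, hfdef, hgdef]
    dsimp only
    rw [mul_assoc (X z * W' z), ← mul_assoc (P z₀), hPP z₀ hz₀]
    simp only [mul_assoc]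
  have h3 (i : ℕ) : FiniteRank (iteratedDeriv i f z₀) := by
    have h := iteratedDeriv_clm_comp ((ContinuousLinearMap.mul ℂ (K →L[ℂ] K)).flip (P z₀))
      (contDiffAt_of_differentiableOn hV (hXV.mul hW') hzV i)
    have h' : iteratedDeriv i f z₀ = _ * P z₀ := h
    rw [h']
    exact (hf z₀ hz₀).mul_left _
  rw [h2.iteratedDeriv_eq, h1'.iteratedDeriv_eq]
  refine ⟨finiteRank_iteratedDeriv_mul (hfk k) (hgk k) fun i _ _ => Or.inl (h3 i), ?_⟩
  rw [finiteRankTrace_iteratedDeriv_mul_comm (hfk k) (hgk k) fun i _ _ => Or.inl (h3 i),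
    iteratedDeriv_clm_comp θ (contDiffAt_of_differentiableOn hV hG hzV k), hθ]
  congr 1
  have h := iteratedDeriv_clm_comp ((ContinuousLinearMap.mulLeftRight ℂ (K →L[ℂ] K) (P z₀) (P z₀)))
      (contDiffAt_of_differentiableOn hV hG hzV k)
  rw [ContinuousLinearMap.mulLeftRight_apply] at h
  rw [← h]
  congr 1

include hU hX hP hPP hf in
/-- `(tr (X P))' = tr (X' P)` if `X` commutes with the projections `P`. -/
theorem deriv_finiteRankTrace_family {z₀ : ℂ} (hz₀ : z₀ ∈ U) (hXP : Commute (X z₀) (P z₀)) :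
    deriv (fun z => finiteRankTrace (X z * P z)) z₀ = finiteRankTrace (deriv X z₀ * P z₀) := by
  have h := ((finiteRankTrace_family hU hX hP hPP hf hz₀).2 1).2
  rw [iteratedDeriv_one, iteratedDeriv_one] at h
  have hXd := hX.differentiableAt (hU.mem_nhds hz₀)
  have hPd := hP.differentiableAt (hU.mem_nhds hz₀)
  have h1 : deriv (fun z => P z * P z) z₀ = deriv P z₀ :=
    Filter.EventuallyEq.deriv_eq (by filter_upwards [hU.mem_nhds hz₀] with z hz using hPP z hz)
  have hD : deriv (fun z => P z * P z) z₀ = deriv P z₀ * P z₀ + P z₀ * deriv P z₀ :=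
    deriv_fun_mul hPd hPd
  have hD2 : deriv (fun z => X z * P z) z₀ = deriv X z₀ * P z₀ + X z₀ * deriv P z₀ :=
    deriv_fun_mul hXd hPd
  rw [hD] at h1
  set p := P z₀
  set q := deriv P z₀
  set x := X z₀
  have hp : p * p = p := hPP z₀ hz₀
  have hfp : FiniteRank p := hf z₀ hz₀
  -- Differentiating P² = P gives q = qp + pq, whence pqp = 2pqp. Cyclicity and the commutation of x
  -- with p reduce tr(xq) to traces that contain pqp, so the term with P' drops out.
  have h2 : p * q * p = 0 := by
    have h3 := congrArg (fun y => p * y * p) h1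
    simp only [mul_add, add_mul] at h3
    rw [← mul_assoc p p q, hp, ← mul_assoc p q p, mul_assoc (p * q) p p, hp] at h3
    simpa using h3
  have h4 : finiteRankTrace (x * q * p) = 0 := by
    have h5 : x * q * p = (x * q * p) * p := by rw [mul_assoc _ p p, hp]
    rw [h5, ← finiteRankTrace_mul_comm (hfp.mul_left _) p]
    have h6 : p * (x * q * p) = x * (p * q * p) := by
      rw [← mul_assoc, ← mul_assoc, ← hXP.eq]
      simp only [mul_assoc]
    rw [h6, h2, mul_zero, finiteRankTrace_zero]
  have h7 : finiteRankTrace (x * p * q) = 0 := by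
    rw [hXP.eq, mul_assoc, ← finiteRankTrace_mul_comm hfp (x * q), h4]
  rw [h, hD2]
  have h8 : x * q = x * q * p + x * p * q := by
    conv_lhs => rw [← h1]
    rw [mul_add, mul_assoc, mul_assoc]
  rw [h8, finiteRankTrace_add (hfp.mul_left _)
    ((hfp.mul_left _).add ((hfp.mul_left x).mul_right q)),
    finiteRankTrace_add (hfp.mul_left _) ((hfp.mul_left x).mul_right q), h4, h7, add_zero, add_zero]

include hU hP hPP hf in
-- The rank of a projection is its trace, and with X = 1 the derivative of the trace is tr(0 · P) =
-- 0.
theorem finrank_range_family (hc : IsPreconnected U) {z w : ℂ} (hz : z ∈ U) (hw : w ∈ U) :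
    Module.finrank ℂ (P z).range = Module.finrank ℂ (P w).range := by
  have h1 : DifferentiableOn ℂ (fun _ : ℂ => (1 : K →L[ℂ] K)) U := differentiableOn_const _
  have h2 := hU.is_const_of_deriv_eq_zero hc (f := fun z => finiteRankTrace (1 * P z))
    (fun x hx => (finiteRankTrace_family hU h1 hP hPP hf hx).1.differentiableWithinAt)
    (fun x hx => by
      rw [deriv_finiteRankTrace_family hU h1 hP hPP hf hx (Commute.one_left _), deriv_const,
        zero_mul, finiteRankTrace_zero]
      rfl) hz hw
  simp only [one_mul] at h2
  rw [finiteRankTrace_idem (hPP z hz) (hf z hz), finiteRankTrace_idem (hPP w hw) (hf w hw)] at h2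
  exact_mod_cast h2

end TraceFamily

/-! ### The weighted mean of an eigenvalue group -/

section WeightedMean

variable {K : Type*} [NormedAddCommGroup K] [NormedSpace ℂ K] [CompleteSpace K] {Γ : ℝ → ℂ}
  (hΓ : IsContour Γ) {A : ℂ → K →L[ℂ] K} {β : ℂ} {U : Set ℂ} (hU : IsOpen U)
  (hA : DifferentiableOn ℂ A U) (hρ : ∀ z ∈ U, contourSet Γ ⊆ resolventSet ℂ (A z))
  (hf : ∀ z ∈ U, FiniteRank (rieszElem hΓ (A z)))

include hU hA hρ hf in
theorem differentiableOn_weightedMean : DifferentiableOn ℂ (weightedMean Γ A) U := by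
  intro z hz
  refine DifferentiableAt.differentiableWithinAt (DifferentiableAt.const_mul ?_ _)
  refine (finiteRankTrace_family hU hA (differentiableOn_rieszElem hΓ hA hρ)
    (fun z hz => rieszElem_mul_self hΓ (hρ z hz)) hf hz).1.congr_of_eventuallyEq ?_
  filter_upwards [hU.mem_nhds hz] with w hw
  rw [riesz_eq hΓ (hρ w hw)]

theorem contourIntegral_list_prod {B : K →L[ℂ] K} (hB : contourSet Γ ⊆ resolventSet ℂ B)
    (l : List (K →L[ℂ] K)) :
    contourIntegral Γ (fun ζ => (l.map fun X => X * resolv B ζ).prod) =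
      contourCLM hΓ (resolventProd hΓ B l) := by
  refine contourIntegral_eq hΓ fun t => ?_
  induction l with
  | nil => rfl
  | cons X l ih =>
    rw [List.map_cons, List.prod_cons, ih, resolv_eq, ← contourResolvent_apply hΓ hB t]
    rfl

include hU hA hρ hf in
/-- The Taylor coefficients of the weighted mean of an eigenvalue group. -/
theorem taylorCoeff_weightedMean (h0 : (0 : ℂ) ∈ U) (hβΓ : β ∈ inside Γ)
    (hβ : A 0 * rieszElem hΓ (A 0) = β • rieszElem hΓ (A 0)) {k : ℕ} (hk : k ≠ 0) :
    taylorCoeff k (weightedMean Γ A) = meanCoeff Γ A k := by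
  obtain ⟨n, rfl⟩ := Nat.exists_eq_succ_of_ne_zero hk
  have hP := differentiableOn_rieszElem hΓ hA hρ
  have hPP : ∀ z ∈ U, rieszElem hΓ (A z) * rieszElem hΓ (A z) = rieszElem hΓ (A z) :=
    fun z hz => rieszElem_mul_self hΓ (hρ z hz)
  set b : ℂ → ℂ := fun z => finiteRankTrace (A z * rieszElem hΓ (A z)) with hb
  set τ : List ℕ → ℂ := fun l => finiteRankTrace (contourCLM hΓ
    (resolventProd hΓ (A 0) (l.map fun k => taylorCoeff k A))) with hτ
  have hbd : DifferentiableOn ℂ b U := fun z hz =>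
    (finiteRankTrace_family hU hA hP hPP hf hz).1.differentiableWithinAt
  have hfr {l : List ℕ} (hl : l ≠ []) : FiniteRank (contourCLM hΓ
      (resolventProd hΓ (A 0) (l.map fun k => taylorCoeff k A))) :=
    finiteRank_contourCLM_resolventProd hΓ (hρ 0 h0) hβΓ hβ (hf 0 h0) (by simpa using hl)
  have hne (c : Composition (n + 1)) : c.blocks ≠ [] := fun h => by
    have := (c.blocks_eq_nil).1 h
    omega
  -- the Taylor coefficients of `b`
  have h1 : ((n + 1 : ℕ) : ℂ) • taylorCoeff (n + 1) b = (2 * Real.pi * Complex.I : ℂ)⁻¹ *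
      ∑ c : Composition (n + 1), (c.blocks.headI : ℂ) * ((-1 : ℂ) ^ c.blocks.length * τ c.blocks) := by
    rw [← taylorCoeff_deriv]
    have h2 : deriv b =ᶠ[𝓝 0] fun z => finiteRankTrace (deriv A z * rieszElem hΓ (A z)) := by
      filter_upwards [hU.mem_nhds h0] with z hz
      exact deriv_finiteRankTrace_family hU hA hP hPP hf hz
        (commute_rieszElem hΓ (Commute.refl (A z)))
    have h3 := (finiteRankTrace_family hU (hA.deriv hU) hP hPP hf h0).2 n
    have h4 : taylorCoeff n (deriv b) = finiteRankTrace
        (taylorCoeff n fun z => deriv A z * rieszElem hΓ (A z)) := by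
      rw [taylorCoeff_congr h2, taylorCoeff, taylorCoeff, h3.2, finiteRankTrace_smul h3.1]
      rfl
    rw [h4, taylorCoeff_deriv_mul_rieszElem hΓ hU h0 hA hρ,
      finiteRankTrace_smul (FiniteRank.sum fun c _ => (hfr (hne c)).smul _),
      finiteRankTrace_sum fun c _ => (hfr (hne c)).smul _]
    congr 1
    refine Finset.sum_congr rfl fun c _ => ?_
    rw [finiteRankTrace_smul (hfr (hne c)), hτ, Composition.blocks_length]
    ring
  -- Cyclic invariance replaces the first block by its mean (n + 1)/p. The factor n + 1 then cancels
  -- the one that came from differentiating b.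
  rw [sum_head_mul_composition (Nat.succ_pos n) (F := fun l => (-1 : ℂ) ^ l.length * τ l)
    (fun a l => by
      simp only [hτ, List.length_cons, List.length_append, List.length_nil, List.map_cons,
        List.map_append, List.map_nil, zero_add]
      rw [finiteRankTrace_contourCLM_resolventProd hΓ (hρ 0 h0) hβΓ hβ (hf 0 h0)]),
    smul_eq_mul, mul_left_comm] at h1
  have h5 := mul_left_cancel₀ (Nat.cast_ne_zero.2 (Nat.succ_ne_zero n)) h1
  -- comparison
  have h6 : weightedMean Γ A =ᶠ[𝓝 0]
      fun z => (Module.finrank ℂ (riesz Γ (A 0)).range : ℂ)⁻¹ * b z := by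
    filter_upwards [hU.mem_nhds h0] with z hz
    rw [weightedMean, riesz_eq hΓ (hρ z hz)]
  have h7 := taylorCoeff_clm_comp ((Module.finrank ℂ (riesz Γ (A 0)).range : ℂ)⁻¹ •
    ContinuousLinearMap.id ℂ ℂ) (contDiffAt_of_differentiableOn hU hbd h0 (n + 1))
  rw [taylorCoeff_congr h6]
  refine h7.trans ?_
  change (Module.finrank ℂ (riesz Γ (A 0)).range : ℂ)⁻¹ * taylorCoeff (n + 1) b = _
  rw [h5, meanCoeff]
  have h8 (c : Composition (n + 1)) : contourIntegral Γ (fun ζ =>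
      (c.blocks.map (fun k => powerCoeff A k * resolv (A 0) ζ)).prod) = contourCLM hΓ
      (resolventProd hΓ (A 0) (c.blocks.map fun k => taylorCoeff k A)) := by
    rw [← contourIntegral_list_prod hΓ (hρ 0 h0)]
    simp only [List.map_map]
    rfl
  simp only [h8]
  rw [finiteRankTrace_sum fun c _ => (hfr (hne c)).smul _]
  have h9 (c : Composition (n + 1)) : finiteRankTrace (((-1 : ℂ) ^ c.length / (c.length : ℂ)) •
      contourCLM hΓ (resolventProd hΓ (A 0) (c.blocks.map fun k => taylorCoeff k A))) =
      (c.length : ℂ)⁻¹ * ((-1 : ℂ) ^ c.blocks.length * τ c.blocks) := by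
    rw [finiteRankTrace_smul (hfr (hne c)), Composition.blocks_length, div_eq_mul_inv, hτ]
    ring
  simp only [h9]
  ring

theorem weightedMean_zero (h0 : contourSet Γ ⊆ resolventSet ℂ (A 0))
    (hf : FiniteRank (rieszElem hΓ (A 0))) (hne : rieszElem hΓ (A 0) ≠ 0)
    (hβ : A 0 * rieszElem hΓ (A 0) = β • rieszElem hΓ (A 0)) :
    weightedMean Γ A 0 = β := by
  have h1 : Module.finrank ℂ (rieszElem hΓ (A 0)).range ≠ 0 := by
    intro h
    have : FiniteDimensional ℂ (rieszElem hΓ (A 0)).range := hf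
    have h2 : (rieszElem hΓ (A 0)).range = ⊥ := Submodule.finrank_eq_zero.1 h
    apply hne
    ext x
    have h3 : rieszElem hΓ (A 0) x ∈ (rieszElem hΓ (A 0)).range := ⟨x, rfl⟩
    rw [h2] at h3
    exact (Submodule.mem_bot ℂ).1 h3
  rw [weightedMean, riesz_eq hΓ h0, hβ, finiteRankTrace_smul hf,
    finiteRankTrace_idem (rieszElem_mul_self hΓ h0) hf, mul_comm β, inv_mul_cancel_left₀]
  exact (Nat.cast_ne_zero (R := ℂ)).2 h1

end WeightedMean

/-! ### Series of orthogonal projections -/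

section OrthogonalProjections

variable {H V ι : Type*} [NormedAddCommGroup H] [InnerProductSpace ℂ H] [CompleteSpace H]
  [NormedAddCommGroup V] [InnerProductSpace ℂ V] [CompleteSpace V]
  {G : ι → Submodule ℂ V} [∀ i, (G i).HasOrthogonalProjection]

theorem norm_sum_smul_starProjection_sq (hG : Pairwise fun i j => G i ⟂ G j) (s : Finset ι)
    (c : ι → ℂ) (x : V) : ‖∑ i ∈ s, c i • (G i).starProjection x‖ ^ 2 =
      ∑ i ∈ s, ‖c i‖ ^ 2 * ‖(G i).starProjection x‖ ^ 2 := by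
  have h : OrthogonalFamily ℂ (fun i => G i) fun i => (G i).subtypeₗᵢ := by
    intro i j hij u v
    exact (hG hij).inner_eq u.2 v.2
  have h1 := h.norm_sum (fun i => c i • (G i).orthogonalProjectionOnto x) s
  simp only [norm_smul, mul_pow] at h1
  exact h1

theorem norm_starProjection_sq (U : Submodule ℂ V) [U.HasOrthogonalProjection] (x : V) :
    ((‖U.starProjection x‖ ^ 2 : ℝ) : ℂ) = inner ℂ (U.starProjection x) x := by
  have h := U.inner_starProjection_left_eq_right (U.starProjection x) x
  rw [Submodule.starProjection_eq_self_iff.2 (Submodule.starProjection_apply_mem _ _)] at h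
  rw [h, inner_self_eq_norm_sq_to_K]
  norm_cast

/-- Bessel's inequality for orthogonal projections. -/
theorem sum_norm_starProjection_sq_le (hG : Pairwise fun i j => G i ⟂ G j) (s : Finset ι) (x : V) :
    ∑ i ∈ s, ‖(G i).starProjection x‖ ^ 2 ≤ ‖x‖ ^ 2 := by
  have h1 := norm_sum_smul_starProjection_sq hG s (fun _ => 1) x
  simp only [one_smul, norm_one, one_pow, one_mul] at h1
  set y := ∑ i ∈ s, (G i).starProjection x with hy
  have h2 : ((‖y‖ ^ 2 : ℝ) : ℂ) = inner ℂ y x := by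
    rw [h1, hy, sum_inner, Complex.ofReal_sum]
    exact Finset.sum_congr rfl fun i _ => norm_starProjection_sq _ _
  have h3 : ‖y‖ ^ 2 ≤ ‖y‖ * ‖x‖ := by
    have h4 := norm_inner_le_norm (𝕜 := ℂ) y x
    rw [← h2, Complex.norm_real, Real.norm_of_nonneg (by positivity)] at h4
    exact h4
  rw [← h1]
  rcases (norm_nonneg y).eq_or_lt with h | h
  · rw [← h, zero_pow two_ne_zero]
    positivity
  · have h5 : ‖y‖ ≤ ‖x‖ := by
      rw [sq] at h3
      exact le_of_mul_le_mul_left h3 h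
    gcongr

theorem norm_sum_smul_starProjection_apply_le (hG : Pairwise fun i j => G i ⟂ G j) (s : Finset ι)
    {c : ι → ℂ} {C : ℝ} (hc : ∀ i ∈ s, ‖c i‖ ≤ C) (x : V) :
    ‖∑ i ∈ s, c i • (G i).starProjection x‖ ^ 2 ≤ C ^ 2 *
      ∑ i ∈ s, ‖(G i).starProjection x‖ ^ 2 := by
  rw [norm_sum_smul_starProjection_sq hG, Finset.mul_sum]
  refine Finset.sum_le_sum fun i hi => ?_
  gcongr
  exact hc i hi

theorem norm_sum_smul_starProjection_le (hG : Pairwise fun i j => G i ⟂ G j) (s : Finset ι)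
    {c : ι → ℂ} {C : ℝ} (hc : ∀ i ∈ s, ‖c i‖ ≤ C) (hC : 0 ≤ C) :
    ‖∑ i ∈ s, c i • (G i).starProjection‖ ≤ C := by
  refine ContinuousLinearMap.opNorm_le_bound _ hC fun x => ?_
  rw [sum_apply]
  simp only [smul_apply]
  refine le_of_sq_le_sq ?_ (by positivity)
  rw [mul_pow]
  exact (norm_sum_smul_starProjection_apply_le hG s hc x).trans
    (mul_le_mul_of_nonneg_left (sum_norm_starProjection_sq_le hG s x) (by positivity))

/-- Uniform convergence of a series of orthogonal projections on the range of a compact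
operator. -/
theorem exists_finset_norm_sum_comp_le (hG : Pairwise fun i j => G i ⟂ G j) {L : H →L[ℂ] V}
    (hL : IsCompactOperator L) {ε : ℝ} (hε : 0 < ε) :
    ∃ s : Finset ι, ∀ t : Finset ι, Disjoint t s → ∀ (c : ι → ℂ) (C : ℝ), 0 ≤ C →
      (∀ i ∈ t, ‖c i‖ ≤ C) → ‖(∑ i ∈ t, c i • (G i).starProjection) ∘L L‖ ≤ C * ε := by
  classical
  obtain ⟨K, hK, hLK⟩ := IsCompactOperator.image_closedBall_subset_compact (f := (L : H →ₗ[ℂ] V)) hL 1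
  -- The image of the unit ball has a finite ε/2-net. Bessel's inequality makes the tails small at
  -- the finitely many centres, and the norm bound C controls the distance to a centre. The choice
  -- of `s` does not depend on the coefficients.
  obtain ⟨F, hF, hKF⟩ := Metric.totallyBounded_iff.1 hK.totallyBounded (ε / 2) (half_pos hε)
  have h1 (y : V) : ∃ s : Finset ι, ∀ t : Finset ι, Disjoint t s →
      ∑ i ∈ t, ‖(G i).starProjection y‖ ^ 2 ≤ (ε / 2) ^ 2 := by
    have hs : Summable fun i => ‖(G i).starProjection y‖ ^ 2 :=
      summable_of_sum_le (fun i => by positivity) fun s => sum_norm_starProjection_sq_le hG s y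
    obtain ⟨s, hs⟩ := summable_iff_vanishing_norm.1 hs ((ε / 2) ^ 2) (by positivity)
    exact ⟨s, fun t ht => ((Real.le_norm_self _).trans_lt (hs t ht)).le⟩
  choose s hs using h1
  refine ⟨hF.toFinset.biUnion s, fun t ht c C hC hc => ?_⟩
  have hC' : 0 ≤ C * ε := by positivity
  have hT := norm_sum_smul_starProjection_le hG t hc hC
  have h2 : ∀ x : H, ‖x‖ ≤ 1 → ‖(∑ i ∈ t, c i • (G i).starProjection) (L x)‖ ≤ C * ε := by
    intro x hx
    have hx' : L x ∈ K := hLK ⟨x, by simpa using hx, rfl⟩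
    obtain ⟨y, hy, hxy⟩ := mem_iUnion₂.1 (hKF hx')
    have h3 : ‖(∑ i ∈ t, c i • (G i).starProjection) y‖ ≤ C * (ε / 2) := by
      rw [sum_apply]
      refine le_of_sq_le_sq ?_ (by positivity)
      rw [mul_pow]
      refine (norm_sum_smul_starProjection_apply_le hG t hc y).trans
        (mul_le_mul_of_nonneg_left (hs y t ?_) (by positivity))
      refine Finset.disjoint_of_subset_right ?_ ht
      exact Finset.subset_biUnion_of_mem s (hF.mem_toFinset.2 hy)
    have h4 : ‖(∑ i ∈ t, c i • (G i).starProjection) (L x - y)‖ ≤ C * (ε / 2) :=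
      (ContinuousLinearMap.le_of_opNorm_le _ hT _).trans
        (mul_le_mul_of_nonneg_left (mem_ball_iff_norm.1 hxy).le hC)
    calc _ = ‖(∑ i ∈ t, c i • (G i).starProjection) (L x - y) +
          (∑ i ∈ t, c i • (G i).starProjection) y‖ := by rw [← map_add, sub_add_cancel]
      _ ≤ _ := norm_add_le _ _
      _ ≤ C * ε := by linarith
  refine ContinuousLinearMap.opNorm_le_of_unit_norm hC' fun x hx => h2 x hx.le

variable {G : ι → Submodule ℂ V} [∀ i, (G i).HasOrthogonalProjection]
  (hG : Pairwise fun i j => G i ⟂ G j) (E : V →L[ℂ] H) {L : H →L[ℂ] V}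
  (hL : IsCompactOperator L)

include hG hL in
theorem exists_finset_norm_sum_smul_comp_le {ε C : ℝ} (hC : 0 ≤ C) (hε : 0 < ε) :
    ∃ s : Finset ι, ∀ t : Finset ι, Disjoint t s → ∀ c : ι → ℂ,
      (∀ i, ‖c i‖ ≤ C) → ‖∑ i ∈ t, c i • (E ∘L (G i).starProjection ∘L L)‖ ≤ ε := by
  have hδ : 0 < ε / ((‖E‖ + 1) * (C + 1)) := by positivity
  obtain ⟨s, hs⟩ := exists_finset_norm_sum_comp_le hG hL hδ
  refine ⟨s, fun t ht c hc => ?_⟩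
  have h1 := hs t ht c C hC fun i _ => hc i
  have h2 : ∑ i ∈ t, c i • (E ∘L (G i).starProjection ∘L L) =
      E ∘L ((∑ i ∈ t, c i • (G i).starProjection) ∘L L) := by
    ext x
    simp [sum_apply, map_sum]
  rw [h2]
  calc _ ≤ ‖E‖ * ‖(∑ i ∈ t, c i • (G i).starProjection) ∘L L‖ := ContinuousLinearMap.opNorm_comp_le _ _
    _ ≤ (‖E‖ + 1) * ((C + 1) * (ε / ((‖E‖ + 1) * (C + 1)))) := by
      gcongr
      · linarith
      · exact h1.trans (by gcongr; linarith)
    _ = ε := by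
      have := norm_nonneg E
      field_simp

include hG hL in
theorem summable_smul_comp_starProjection {c : ι → ℂ} {C : ℝ} (hc : ∀ i, ‖c i‖ ≤ C) :
    Summable fun i => c i • (E ∘L (G i).starProjection ∘L L) := by
  refine summable_iff_vanishing_norm.2 fun ε hε => ?_
  obtain ⟨s, hs⟩ := exists_finset_norm_sum_smul_comp_le hG E hL (le_max_left 0 C) (half_pos hε)
  exact ⟨s, fun t ht => (hs t ht c fun i => (hc i).trans (le_max_right _ _)).trans_lt
    (half_lt_self hε)⟩

include hG hL in
-- The tail estimate depends on the coefficients only through a common bound, so locally bounded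
-- coefficients give locally uniform convergence, and Weierstrass' theorem applies.
theorem differentiableOn_tsum_smul_comp {U : Set ℂ} (hU : IsOpen U) {c : ℂ → ι → ℂ}
    (hd : ∀ i, DifferentiableOn ℂ (fun z => c z i) U)
    (hc : ∀ z₀ ∈ U, ∃ C, ∀ᶠ z in 𝓝 z₀, ∀ i, ‖c z i‖ ≤ C) :
    DifferentiableOn ℂ (fun z => ∑' i, c z i • (E ∘L (G i).starProjection ∘L L)) U := by
  classical
  have h1 : TendstoLocallyUniformlyOn
      (fun (s : Finset ι) z => ∑ i ∈ s, c z i • (E ∘L (G i).starProjection ∘L L))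
      (fun z => ∑' i, c z i • (E ∘L (G i).starProjection ∘L L)) atTop U := by
    refine Metric.tendstoLocallyUniformlyOn_iff.2 ?_
    intro ε hε z₀ hz₀
    obtain ⟨C, hC⟩ := hc z₀ hz₀
    obtain ⟨s, hs⟩ := exists_finset_norm_sum_smul_comp_le hG E hL (le_max_left 0 C) (half_pos hε)
    refine ⟨_, mem_nhdsWithin_of_mem_nhds hC, ?_⟩
    filter_upwards [eventually_ge_atTop s] with t ht z hz
    have hz' : ∀ i, ‖c z i‖ ≤ max 0 C := fun i => (hz i).trans (le_max_right _ _)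
    have h2 := (summable_smul_comp_starProjection hG E hL hz').hasSum
    rw [dist_eq_norm]
    refine lt_of_le_of_lt ?_ (half_lt_self hε)
    refine le_of_tendsto (h2.sub_const _).norm ?_
    filter_upwards [eventually_ge_atTop t] with t' ht'
    rw [← Finset.sum_sdiff ht', add_sub_cancel_right]
    exact hs _ (Finset.sdiff_disjoint.mono_right ht) _ hz'
  refine h1.differentiableOn (Eventually.of_forall fun s => ?_) hU
  exact DifferentiableOn.fun_sum fun i _ => (hd i).smul_const _

theorem isCompactOperator_tsum {f : ι → H →L[ℂ] H} (hf : ∀ i, IsCompactOperator (f i)) :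
    IsCompactOperator (∑' i, f i : H →L[ℂ] H) := by
  by_cases h : Summable f
  · refine isCompactOperator_of_tendsto h.hasSum (Eventually.of_forall fun s => ?_)
    exact Submodule.sum_mem (compactOperator (RingHom.id ℂ) H H) (t := s) (f := f) fun i _ => hf i
  · rw [tsum_eq_zero_of_not_summable h]
    exact isCompactOperator_zero

end OrthogonalProjections

/-! ### Compact operators attain their norm -/

section Attain

variable {H V : Type*} [NormedAddCommGroup H] [InnerProductSpace ℂ H] [CompleteSpace H]
  [NormedAddCommGroup V] [InnerProductSpace ℂ V] [CompleteSpace V]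

/-- Expanding ‖L*Lx - ‖L‖²x‖² and using ‖L*Lx‖ ≤ ‖L‖²‖x‖ leaves at most 0: a vector at which the
norm is attained is an eigenvector of L*L. -/
theorem adjoint_apply_eq_of_norm_eq {L : V →L[ℂ] H} {x : V} (h : ‖L x‖ = ‖L‖ * ‖x‖) :
    ContinuousLinearMap.adjoint L (L x) = ((‖L‖ ^ 2 : ℝ) : ℂ) • x := by
  have h1 : ‖ContinuousLinearMap.adjoint L (L x)‖ ≤ ‖L‖ ^ 2 * ‖x‖ := by
    calc _ ≤ ‖ContinuousLinearMap.adjoint L‖ * ‖L x‖ := ContinuousLinearMap.le_opNorm _ _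
      _ = ‖L‖ ^ 2 * ‖x‖ := by rw [LinearIsometryEquiv.norm_map, h]; ring
  have h2 : RCLike.re (inner ℂ (ContinuousLinearMap.adjoint L (L x)) x) = ‖L x‖ ^ 2 := by
    rw [ContinuousLinearMap.adjoint_inner_left, inner_self_eq_norm_sq]
  have h3 := norm_sub_sq (𝕜 := ℂ) (ContinuousLinearMap.adjoint L (L x)) (((‖L‖ ^ 2 : ℝ) : ℂ) • x)
  rw [inner_smul_right] at h3
  have h4 : RCLike.re (((‖L‖ ^ 2 : ℝ) : ℂ) *
      inner ℂ (ContinuousLinearMap.adjoint L (L x)) x) = ‖L‖ ^ 2 * ‖L x‖ ^ 2 := by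
    rw [← h2]
    exact Complex.re_ofReal_mul _ _
  have h5 : ‖((‖L‖ ^ 2 : ℝ) : ℂ) • x‖ = ‖L‖ ^ 2 * ‖x‖ := by
    rw [norm_smul, Complex.norm_real, Real.norm_of_nonneg (by positivity)]
  rw [h4, h5, h] at h3
  have h6 : ‖ContinuousLinearMap.adjoint L (L x)‖ ^ 2 ≤ (‖L‖ ^ 2 * ‖x‖) ^ 2 := by gcongr
  have h7 : ‖ContinuousLinearMap.adjoint L (L x) - ((‖L‖ ^ 2 : ℝ) : ℂ) • x‖ ^ 2 ≤ 0 := by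
    rw [h3]
    nlinarith
  exact sub_eq_zero.1 (norm_eq_zero.1 (pow_eq_zero_iff two_ne_zero |>.1
    (le_antisymm h7 (by positivity))))

theorem exists_norm_apply_eq {L : V →L[ℂ] H} (hL : IsCompactOperator L) (hc : 0 < ‖L‖) :
    ∃ x, ‖x‖ = 1 ∧ ‖L x‖ = ‖L‖ := by
  obtain ⟨K, hK, hLK⟩ := IsCompactOperator.image_closedBall_subset_compact
    (f := (L : V →ₗ[ℂ] H)) hL 1
  have h1 (k : ℕ) : ∃ x, ‖x‖ < 1 ∧ ‖L‖ - 1 / ((k : ℝ) + 1) < ‖L x‖ :=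
    L.exists_lt_apply_of_lt_opNorm (sub_lt_self _ (by positivity))
  choose u hu1 hu2 using h1
  obtain ⟨y, -, φ, hφ, hy⟩ := hK.tendsto_subseq (x := fun k => L (u k)) fun k =>
    hLK ⟨u k, by simpa using (hu1 k).le, rfl⟩
  have hle (x : V) (hx : ‖x‖ < 1) : ‖L x‖ ≤ ‖L‖ :=
    (L.le_opNorm x).trans (mul_le_of_le_one_right hc.le hx.le)
  have h2 : Tendsto (fun k => ‖L (u k)‖) atTop (𝓝 ‖L‖) := by
    have h3 : Tendsto (fun k : ℕ => ‖L‖ - 1 / ((k : ℝ) + 1)) atTop (𝓝 (‖L‖ - 0)) :=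
      tendsto_const_nhds.sub tendsto_one_div_add_atTop_nhds_zero_nat
    rw [sub_zero] at h3
    exact tendsto_of_tendsto_of_tendsto_of_le_of_le h3 tendsto_const_nhds (fun k => (hu2 k).le)
      fun k => hle _ (hu1 k)
  have hyc : ‖y‖ = ‖L‖ := tendsto_nhds_unique hy.norm (h2.comp hφ.tendsto_atTop)
  -- A maximizer u satisfies L*Lu = ‖L‖²u, which dictates this limit of the maximizing sequence.
  -- Expanding ‖u_k - x‖² shows strong convergence along the subsequence.
  set x : V := ((((‖L‖ ^ 2)⁻¹ : ℝ)) : ℂ) • ContinuousLinearMap.adjoint L y with hx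
  have hx1 : ‖x‖ ≤ 1 := by
    rw [hx, norm_smul, Complex.norm_real, Real.norm_of_nonneg (by positivity)]
    have h3 : ‖ContinuousLinearMap.adjoint L y‖ ≤ ‖L‖ * ‖L‖ := by
      calc _ ≤ ‖ContinuousLinearMap.adjoint L‖ * ‖y‖ := ContinuousLinearMap.le_opNorm _ _
        _ = ‖L‖ * ‖L‖ := by rw [LinearIsometryEquiv.norm_map, hyc]
    calc _ ≤ (‖L‖ ^ 2)⁻¹ * (‖L‖ * ‖L‖) := by gcongr
      _ = 1 := by field_simp
  have h4 : Tendsto (fun k => 2 - 2 * ((‖L‖ ^ 2)⁻¹ * RCLike.re (inner ℂ (L (u (φ k))) y))) atTop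
      (𝓝 (2 - 2 * ((‖L‖ ^ 2)⁻¹ * RCLike.re (inner ℂ y y)))) :=
    (((RCLike.continuous_re.tendsto _).comp (hy.inner tendsto_const_nhds)).const_mul _
      |>.const_mul _).const_sub _
  have h5 : 2 - 2 * ((‖L‖ ^ 2)⁻¹ * RCLike.re (inner ℂ y y)) = 0 := by
    rw [inner_self_eq_norm_sq, hyc]
    field_simp
    norm_num
  rw [h5] at h4
  have h6 : Tendsto (fun k => ‖u (φ k) - x‖ ^ 2) atTop (𝓝 0) := by
    refine squeeze_zero (fun k => by positivity) (fun k => ?_) h4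
    have h7 := norm_sub_sq (𝕜 := ℂ) (u (φ k)) x
    have h8 : RCLike.re (inner ℂ (u (φ k)) x) =
        (‖L‖ ^ 2)⁻¹ * RCLike.re (inner ℂ (L (u (φ k))) y) := by
      rw [hx, inner_smul_right, ContinuousLinearMap.adjoint_inner_right]
      exact Complex.re_ofReal_mul _ _
    rw [h7, h8]
    have h9 : ‖u (φ k)‖ ^ 2 ≤ 1 := pow_le_one₀ (norm_nonneg _) (hu1 _).le
    have h10 : ‖x‖ ^ 2 ≤ 1 := pow_le_one₀ (norm_nonneg _) hx1
    linarith
  have h11 : Tendsto (fun k => u (φ k)) atTop (𝓝 x) := by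
    rw [tendsto_iff_norm_sub_tendsto_zero]
    have h12 := h6.sqrt
    simpa [Real.sqrt_sq (norm_nonneg _)] using h12
  have h13 : L x = y := tendsto_nhds_unique ((L.continuous.tendsto x).comp h11) hy
  have h14 := L.le_opNorm x
  rw [h13, hyc] at h14
  refine ⟨x, le_antisymm hx1 ?_, h13 ▸ hyc⟩
  exact (le_mul_iff_one_le_right hc).1 h14

theorem norm_starProjection_add_smul_sq {U W : Submodule ℂ V} [U.HasOrthogonalProjection]
    [W.HasOrthogonalProjection] (h : U ⟂ W) (c : ℂ) (x : V) :
    ‖U.starProjection x + c • W.starProjection x‖ ^ 2 =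
      ‖U.starProjection x‖ ^ 2 + ‖c‖ ^ 2 * ‖W.starProjection x‖ ^ 2 := by
  have h1 := norm_add_sq (𝕜 := ℂ) (U.starProjection x) (c • W.starProjection x)
  rw [inner_smul_right, h.inner_eq (Submodule.starProjection_apply_mem _ _)
    (Submodule.starProjection_apply_mem _ _), mul_zero, map_zero, mul_zero, add_zero, norm_smul,
    mul_pow] at h1
  exact h1

theorem norm_starProjection_sq_add_le {U W : Submodule ℂ V} [U.HasOrthogonalProjection]
    [W.HasOrthogonalProjection] (h : U ⟂ W) (x : V) :
    ‖U.starProjection x‖ ^ 2 + ‖W.starProjection x‖ ^ 2 ≤ ‖x‖ ^ 2 := by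
  rw [Submodule.norm_sq_eq_add_norm_sq_starProjection x U]
  have h1 : W.starProjection x = W.starProjection (Uᗮ.starProjection x) := by
    rw [Submodule.starProjection_orthogonal_val, map_sub]
    have h2 : W.starProjection (U.starProjection x) = 0 :=
      (Submodule.starProjection_apply_eq_zero_iff _).2 (h (Submodule.starProjection_apply_mem _ _))
    rw [h2, sub_zero]
  rw [h1]
  gcongr
  exact Submodule.norm_starProjection_apply_le _ _

/-- Take a unit vector x at which E S attains its norm. Then a = Sx must have norm at least 1,
whereas S strictly shrinks any component in W since τ < 1. So x has none, and a lies in U. -/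
theorem exists_norm_apply_eq_of_le {E : V →L[ℂ] H} (hE : IsCompactOperator E) {U W : Submodule ℂ V}
    [U.HasOrthogonalProjection] [W.HasOrthogonalProjection] (h : U ⟂ W) {τ κ : ℝ} (h0 : 0 ≤ τ)
    (h1 : τ < 1) (hκ : 0 < κ) (hEκ : ∀ v, ‖E v‖ ≤ κ * ‖v‖)
    (hle : κ ≤ ‖E ∘L (U.starProjection + ((√τ : ℝ) : ℂ) • W.starProjection)‖) :
    ∃ a ∈ U, ‖a‖ = 1 ∧ ‖E a‖ = κ := by
  obtain ⟨x, hx, hxL⟩ := exists_norm_apply_eq (hE.comp_clm _) (hκ.trans_le hle)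
  set a := (U.starProjection + ((√τ : ℝ) : ℂ) • W.starProjection) x with ha
  have hEa : κ ≤ ‖E a‖ := hle.trans_eq hxL.symm
  have h2 : 1 ≤ ‖a‖ := (le_mul_iff_one_le_right hκ).1 (hEa.trans (hEκ a))
  have h5 : ‖a‖ ^ 2 = ‖U.starProjection x‖ ^ 2 + τ * ‖W.starProjection x‖ ^ 2 := by
    have h6 := norm_starProjection_add_smul_sq h ((√τ : ℝ) : ℂ) x
    rw [Complex.norm_real, Real.norm_of_nonneg (Real.sqrt_nonneg _), Real.sq_sqrt h0] at h6
    exact h6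
  have h7 := norm_starProjection_sq_add_le h x
  rw [hx, one_pow] at h7
  have h9 : ‖W.starProjection x‖ = 0 := by
    by_contra h
    have h10 : 0 < ‖W.starProjection x‖ := lt_of_le_of_ne (norm_nonneg _) (Ne.symm h)
    nlinarith [pow_pos h10 2]
  have h11 : a = U.starProjection x := by
    rw [ha, add_apply, smul_apply, norm_eq_zero.1 h9, smul_zero, add_zero]
  have ha1 : ‖a‖ = 1 := by
    refine le_antisymm ?_ h2
    rw [h9] at h5 h7
    rw [← abs_of_nonneg (norm_nonneg a), ← sq_le_one_iff_abs_le_one]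
    linarith
  refine ⟨a, h11 ▸ Submodule.starProjection_apply_mem _ _, ha1, le_antisymm ?_ hEa⟩
  have h12 := hEκ a
  rwa [ha1, mul_one] at h12

end Attain

/-! ### Perturbation of selfadjoint operators -/

section Selfadjoint

variable {H : Type*} [NormedAddCommGroup H] [InnerProductSpace ℂ H] [CompleteSpace H]
  {B : H →L[ℂ] H}

/-- The resolvent is normal, so its norm is its spectral radius, and its spectrum consists of the
inverses of b - ζ with b in the spectrum of B. -/
theorem norm_ringInverse_le (hB : IsSelfAdjoint B) {ζ : ℂ} (hζ : ζ ∈ resolventSet ℂ B) {d : ℝ}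
    (hd : 0 < d) (hdist : ∀ b ∈ spectrum ℂ B, d ≤ dist ζ b) :
    ‖Ring.inverse (B - algebraMap ℂ (H →L[ℂ] H) ζ)‖ ≤ d⁻¹ := by
  obtain ⟨u, hu⟩ := mem_resolventSet_iff.1 hζ
  have hn : IsStarNormal (B - algebraMap ℂ (H →L[ℂ] H) ζ) := by
    refine ⟨?_⟩
    rw [star_sub, hB.star_eq, ← algebraMap_star_comm]
    exact ((Commute.refl B).sub_left (Algebra.commutes _ B)).sub_right
      ((Algebra.commutes _ _).symm)
  rw [← hu] at hn ⊢
  rw [Ring.inverse_unit]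
  have hn' : IsStarNormal ((u⁻¹ : (H →L[ℂ] H)ˣ) : H →L[ℂ] H) := by
    have := hn
    infer_instance
  have h1 := IsStarNormal.spectralRadius_eq_nnnorm ((u⁻¹ : (H →L[ℂ] H)ˣ) : H →L[ℂ] H)
  have h2 : spectralRadius ℂ ((u⁻¹ : (H →L[ℂ] H)ˣ) : H →L[ℂ] H) ≤ ENNReal.ofReal d⁻¹ := by
    refine iSup₂_le fun w hw => ?_
    rw [← spectrum.map_inv, Set.mem_inv, hu] at hw
    have h3 := (spectrum.add_mem_add_iff (s := ζ)).2 hw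
    rw [add_sub_cancel] at h3
    have h4 := hdist _ h3
    rw [dist_comm, dist_eq_norm, add_sub_cancel_right, norm_inv] at h4
    have hw0 : 0 < ‖w‖ := inv_pos.1 (hd.trans_le h4)
    rw [← enorm_eq_nnnorm, ← ofReal_norm]
    exact ENNReal.ofReal_le_ofReal ((le_inv_comm₀ hd hw0).1 h4)
  rw [h1, ← enorm_eq_nnnorm, ← ofReal_norm] at h2
  exact (ENNReal.ofReal_le_ofReal_iff (inv_nonneg.2 hd.le)).1 h2

theorem mem_resolventSet_of_norm_sub_lt (hB : IsSelfAdjoint B) {ζ : ℂ} (hζ : ζ ∈ resolventSet ℂ B)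
    {d : ℝ} (hdist : ∀ b ∈ spectrum ℂ B, d ≤ dist ζ b) {B' : H →L[ℂ] H} (h : ‖B' - B‖ < d) :
    ζ ∈ resolventSet ℂ B' := by
  have hd : 0 < d := (norm_nonneg _).trans_lt h
  have h1 := norm_ringInverse_le hB hζ hd hdist
  rcases subsingleton_or_nontrivial (H →L[ℂ] H) with hsub | hsub
  · exact mem_resolventSet_iff.2 ⟨1, Subsingleton.elim _ _⟩
  rw [mem_resolventSet_iff] at hζ ⊢
  obtain ⟨u, hu⟩ := hζ
  rw [← hu, Ring.inverse_unit] at h1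
  have h2 : ‖B' - B‖ < ‖((u⁻¹ : (H →L[ℂ] H)ˣ) : H →L[ℂ] H)‖⁻¹ := by
    refine h.trans_le ?_
    rw [le_inv_comm₀ hd (Units.norm_pos _)]
    exact h1
  have h3 := (u.add _ h2).isUnit
  rw [Units.val_add, hu] at h3
  convert h3 using 1
  abel

variable {Γ : ℝ → ℂ} (hΓ : IsContour Γ) {β : ℂ}

/-- The Riesz projection for an isolated point of the spectrum of a selfadjoint operator maps into
the eigenspace. -/
theorem mul_rieszElem_eq_smul (hB : IsSelfAdjoint B) (hρ : contourSet Γ ⊆ resolventSet ℂ B)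
    (hβ : ∀ b ∈ spectrum ℂ B, b ∈ inside Γ → b = β) (hf : FiniteRank (rieszElem hΓ B)) :
    B * rieszElem hΓ B = β • rieszElem hΓ B := by
  have hP := isSpectralProjection_rieszElem hΓ hρ
  have hfd : FiniteDimensional ℂ (rieszElem hΓ B).range := hf
  have hs : (B : H →ₗ[ℂ] H).IsSymmetric := hB.isSymmetric
  have hT := hs.restrict_invariant hP.inv_range
  -- On the finite-dimensional range the restriction is symmetric, hence diagonalizable, and β is
  -- its only possible eigenvalue. No nilpotent part remains, so the pole at β is simple.
  have h1 := hT.orthogonalComplement_iSup_eigenspaces_eq_bot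
  have h2 : (⨆ μ, Module.End.eigenspace ((B : H →ₗ[ℂ] H).restrict hP.inv_range) μ) ≤
      Module.End.eigenspace ((B : H →ₗ[ℂ] H).restrict hP.inv_range) β := by
    refine iSup_le fun μ => ?_
    by_cases hμ : Module.End.eigenspace ((B : H →ₗ[ℂ] H).restrict hP.inv_range) μ = ⊥
    · rw [hμ]
      exact bot_le
    · have h3 : Module.End.HasEigenvalue ((B : H →ₗ[ℂ] H).restrict hP.inv_range) μ := hμ
      have h4 := h3.mem_spectrum
      rw [hP.spectrum_range] at h4
      rw [hβ μ h4.1 h4.2]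
  have h5 := Submodule.orthogonal_le h2
  rw [h1, le_bot_iff, Submodule.orthogonal_eq_bot_iff] at h5
  ext x
  have h6 : (⟨rieszElem hΓ B x, ⟨x, rfl⟩⟩ : (rieszElem hΓ B).range) ∈
      Module.End.eigenspace ((B : H →ₗ[ℂ] H).restrict hP.inv_range) β := by
    rw [h5]
    trivial
  exact congrArg Subtype.val (Module.End.mem_eigenspace_iff.1 h6)

theorem rieszElem_ne_zero (hρ : contourSet Γ ⊆ resolventSet ℂ B) (hβ : β ∈ spectrum ℂ B)
    (hβΓ : β ∈ inside Γ) : rieszElem hΓ B ≠ 0 := by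
  intro h0
  have hP := isSpectralProjection_rieszElem hΓ hρ
  have h1 : β ∈ spectrum ℂ B ∩ inside Γ := ⟨hβ, hβΓ⟩
  rw [← hP.spectrum_range] at h1
  have h2 : Subsingleton (rieszElem hΓ B).range := by
    refine ⟨fun a b => ?_⟩
    obtain ⟨_, x, rfl⟩ := a
    obtain ⟨_, y, rfl⟩ := b
    refine Subtype.ext ?_
    change rieszElem hΓ B x = rieszElem hΓ B y
    rw [h0]
    rfl
  rw [spectrum.of_subsingleton] at h1
  exact h1

/-- If B were invertible, the identity would be compact. For A⁰(0) this places 0 in the spectrum,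
and so exterior to Γ, which makes the Riesz projections compact. -/
theorem zero_mem_spectrum_of_isCompactOperator (hB : IsCompactOperator B)
    (hH : ¬ FiniteDimensional ℂ H) : (0 : ℂ) ∈ spectrum ℂ B := by
  by_contra h
  have h1 : (0 : ℂ) ∈ resolventSet ℂ B := not_not.1 h
  obtain ⟨u, hu⟩ := mem_resolventSet_iff.1 h1
  rw [map_zero, sub_zero] at hu
  have h2 : IsCompactOperator (((u⁻¹ : (H →L[ℂ] H)ˣ) : H →L[ℂ] H) ∘ B) := hB.clm_comp _
  refine hH (FiniteDimensional.of_isCompactOperator_id (𝕜 := ℂ) ?_)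
  convert h2 using 1
  funext x
  exact (congrArg (fun T : H →L[ℂ] H => T x) (hu ▸ u.inv_mul)).symm

end Selfadjoint

/-- The distance between a contour and a closed set. -/
theorem sInf_infDist_pos {Γ : ℝ → ℂ} (hΓ : IsContour Γ) {S : Set ℂ} (hS : IsClosed S)
    (hne : S.Nonempty) (hd : Disjoint (contourSet Γ) S) :
    0 < sInf ((fun ζ => Metric.infDist ζ S) '' contourSet Γ) ∧ ∀ ζ ∈ contourSet Γ, ∀ b ∈ S,
      sInf ((fun ζ => Metric.infDist ζ S) '' contourSet Γ) ≤ dist ζ b := by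
  have hc : IsCompact ((fun ζ => Metric.infDist ζ S) '' contourSet Γ) :=
    (isCompact_contourSet hΓ).image (Metric.continuous_infDist_pt S)
  have hn : ((fun ζ => Metric.infDist ζ S) '' contourSet Γ).Nonempty :=
    ⟨_, Γ 0, ⟨0, by simp, rfl⟩, rfl⟩
  refine ⟨?_, fun ζ hζ b hb => (csInf_le hc.bddBelow ⟨ζ, hζ, rfl⟩).trans
    (Metric.infDist_le_dist_of_mem hb)⟩
  obtain ⟨ζ, hζ, h⟩ := hc.sInf_mem hn
  rw [← h]
  exact (hS.notMem_iff_infDist_pos hne).1 fun h' => hd.le_bot ⟨hζ, h'⟩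

/-! ### Compactness from finite-dimensional approximation -/

section CompactApprox

variable {H V : Type*} [NormedAddCommGroup H] [InnerProductSpace ℂ H] [CompleteSpace H]
  [NormedAddCommGroup V] [InnerProductSpace ℂ V] [CompleteSpace V]

theorem isCompactOperator_of_approx {X Y : Type*} [NormedAddCommGroup X] [NormedSpace ℂ X]
    [NormedAddCommGroup Y] [NormedSpace ℂ Y] [CompleteSpace Y] {L : X →L[ℂ] Y}
    (h : ∀ ε > 0, ∃ T : X →L[ℂ] Y, IsCompactOperator T ∧ ‖L - T‖ ≤ ε) : IsCompactOperator L := by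
  have h1 : L ∈ closure {T : X →L[ℂ] Y | IsCompactOperator T} := by
    refine Metric.mem_closure_iff.2 fun ε hε => ?_
    obtain ⟨T, hT, hLT⟩ := h (ε / 2) (half_pos hε)
    exact ⟨T, hT, by rw [dist_eq_norm]; linarith⟩
  have h2 : IsClosed {T : X →L[ℂ] Y | IsCompactOperator T} := isClosed_setOfPred_isCompactOperator
  rw [h2.closure_eq] at h1
  exact h1

theorem isCompactOperator_starProjection_comp (W : Submodule ℂ V) [FiniteDimensional ℂ W]
    {X : Type*} [NormedAddCommGroup X] [NormedSpace ℂ X] (S : X →L[ℂ] V) :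
    IsCompactOperator (W.starProjection ∘L S) :=
  (isCompactOperator_of_locallyCompactSpace_dom (W.orthogonalProjectionOnto ∘L S)).clm_comp
    W.subtypeL

/-- An operator that is small on subspaces of finite codimension is compact, and so is its
adjoint. -/
theorem isCompactOperator_and_adjoint_of_small {E : V →L[ℂ] H}
    (h : ∀ ε > 0, ∃ (m : ℕ) (T : V →L[ℂ] (Fin m → ℂ)), ∀ v, T v = 0 → ‖E v‖ ≤ ε * ‖v‖) :
    IsCompactOperator E ∧ IsCompactOperator (ContinuousLinearMap.adjoint E) := by
  have key : ∀ ε > 0, ∃ W : Submodule ℂ V, ∃ _ : FiniteDimensional ℂ W,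
      ‖E - E ∘L W.starProjection‖ ≤ ε := by
    intro ε hε
    obtain ⟨m, T, hT⟩ := h ε hε
    have hcl : IsClosed (T.ker : Set V) := T.isClosed_ker
    have : CompleteSpace T.ker := hcl.completeSpace_coe
    -- T is injective on the orthogonal complement of its kernel. E composed with the projection
    -- onto that complement has finite rank and differs from E by at most ε in norm.
    have hfd : FiniteDimensional ℂ (T.ker)ᗮ := by
      refine Module.Finite.of_injective ((T : V →ₗ[ℂ] (Fin m → ℂ)).domRestrict (T.ker)ᗮ)
        ((injective_iff_map_eq_zero _).2 fun x hx => ?_)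
      have hx' : (x : V) ∈ T.ker := hx
      exact Subtype.ext (inner_self_eq_zero.1 ((Submodule.mem_orthogonal _ _).1 x.2 x hx'))
    refine ⟨(T.ker)ᗮ, hfd, ContinuousLinearMap.opNorm_le_bound _ hε.le fun v => ?_⟩
    have h1 : (E - E ∘L (T.ker)ᗮ.starProjection) v = E (T.ker.starProjection v) := by
      rw [sub_apply, ContinuousLinearMap.comp_apply, ← map_sub,
        Submodule.starProjection_orthogonal_val, sub_sub_cancel]
    rw [h1]
    have h2 : T (T.ker.starProjection v) = 0 := Submodule.starProjection_apply_mem T.ker v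
    exact (hT _ h2).trans (mul_le_mul_of_nonneg_left (Submodule.norm_starProjection_apply_le _ _)
      hε.le)
  constructor
  · refine isCompactOperator_of_approx fun ε hε => ?_
    obtain ⟨W, hW, hE⟩ := key ε hε
    refine ⟨_, ?_, hE⟩
    exact (isCompactOperator_starProjection_comp W (ContinuousLinearMap.id ℂ V)).clm_comp E
  · refine isCompactOperator_of_approx fun ε hε => ?_
    obtain ⟨W, hW, hE⟩ := key ε hε
    refine ⟨_, isCompactOperator_starProjection_comp W (ContinuousLinearMap.adjoint E), ?_⟩
    have h1 : ContinuousLinearMap.adjoint E - W.starProjection ∘L ContinuousLinearMap.adjoint E =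
        ContinuousLinearMap.adjoint (E - E ∘L W.starProjection) := by
      rw [map_sub, ContinuousLinearMap.adjoint_comp]
      congr 2
      exact (isSelfAdjoint_starProjection W).adjoint_eq.symm
    rw [h1, LinearIsometryEquiv.norm_map]
    exact hE

end CompactApprox

/-! ### Fourier series on the unit cell -/

section Fourier

variable {n : ℕ}

theorem continuous_expo (k : Fin n → ℤ) : Continuous (expo k) :=
  (expo_isPeriodicSmooth k).smooth.continuous

theorem expo_add (k l : Fin n → ℤ) (x : Fin n → ℝ) : expo (k + l) x = expo k x * expo l x := by
  rw [expo, expo, expo, ← Complex.exp_add, ← mul_add, ← Finset.sum_add_distrib]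
  congr 3
  funext i
  rw [Pi.add_apply]
  push_cast
  ring

theorem conj_expo (k : Fin n → ℤ) (x : Fin n → ℝ) : conj (expo k x) = expo (-k) x := by
  rw [expo, expo, ← Complex.exp_conj]
  congr 1
  rw [map_mul, map_mul, map_mul, Complex.conj_I, Complex.conj_ofReal, map_ofNat, map_sum]
  simp

theorem norm_expo (k : Fin n → ℤ) (x : Fin n → ℝ) : ‖expo k x‖ = 1 := by
  rw [expo, Complex.norm_exp]
  simp [Complex.mul_re, ← Complex.ofReal_intCast, ← Complex.ofReal_mul, ← Complex.ofReal_sum]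

theorem integral_expo (k : Fin n → ℤ) :
    ∫ x in cell n, expo k x = if k = 0 then 1 else 0 := by
  have hcell : cell n = Set.pi univ (fun _ => Ioc (0 : ℝ) 1) := by ext; simp [cell]
  have h1 : volume.restrict (cell n) =
      Measure.pi fun _ : Fin n => (volume : Measure ℝ).restrict (Ioc 0 1) := by
    rw [hcell, volume_pi, Measure.restrict_pi_pi]
  have h2 (x : Fin n → ℝ) : expo k x = ∏ i, Complex.exp (2 * Real.pi * Complex.I * k i * x i) := by
    rw [expo, ← Complex.exp_sum, Finset.mul_sum]
    simp only [mul_assoc]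
  simp only [h2]
  rw [h1, integral_fintype_prod_eq_prod (f := fun i (t : ℝ) =>
    Complex.exp (2 * Real.pi * Complex.I * k i * t))]
  have h3 (i : Fin n) : ∫ t in Ioc (0 : ℝ) 1, Complex.exp (2 * Real.pi * Complex.I * k i * t) =
      if k i = 0 then 1 else 0 := by
    split_ifs with h
    · simp [h]
    · rw [← intervalIntegral.integral_of_le zero_le_one]
      have hc : (2 * Real.pi * Complex.I * k i : ℂ) ≠ 0 := by
        simp [h, Real.pi_ne_zero]
      rw [integral_exp_mul_complex hc]
      have h4 : Complex.exp (2 * Real.pi * Complex.I * k i * (1 : ℝ)) = 1 := by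
        rw [Complex.exp_eq_one_iff]
        exact ⟨k i, by push_cast; ring⟩
      rw [h4]
      simp
  simp only [h3]
  split_ifs with h
  · simp [h]
  · obtain ⟨i, hi⟩ := Function.ne_iff.1 h
    exact Finset.prod_eq_zero (Finset.mem_univ i) (if_neg hi)

theorem memLp_expo (k : Fin n → ℤ) : MemLp (expo k) 2 (volume.restrict (cell n)) :=
  MemLp.of_bound (continuous_expo k).aestronglyMeasurable 1
    (Eventually.of_forall fun x => (norm_expo k x).le)

/-- The exponential `e^{2πi k·x}` as an element of `L²(Y)`. -/
def expoL2 (k : Fin n → ℤ) : L2 n := (memLp_expo k).toLp _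

theorem coeFn_expoL2 (k : Fin n → ℤ) : expoL2 k =ᵐ[volume.restrict (cell n)] expo k :=
  (memLp_expo k).coeFn_toLp

theorem fcoeff_eq_inner (u : L2 n) (k : Fin n → ℤ) : fcoeff u k = inner ℂ (expoL2 k) u := by
  rw [fcoeff, L2.inner_def]
  refine integral_congr_ae ?_
  filter_upwards [coeFn_expoL2 k] with x hx
  rw [hx, RCLike.inner_apply, conj_expo]

theorem fcoeff_expoL2 (k l : Fin n → ℤ) : fcoeff (expoL2 k) l = if k = l then 1 else 0 := by
  have h : fcoeff (expoL2 k) l = ∫ x in cell n, expo (k - l) x := by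
    refine integral_congr_ae ?_
    filter_upwards [coeFn_expoL2 k] with x hx
    rw [hx, ← expo_add, sub_eq_add_neg]
  rw [h, integral_expo]
  simp only [sub_eq_zero]

theorem orthonormal_expoL2 : Orthonormal ℂ (expoL2 (n := n)) := by
  rw [orthonormal_iff_ite]
  intro k l
  rw [← fcoeff_eq_inner, fcoeff_expoL2]
  simp only [eq_comm]

theorem eq_of_fcoeff_eq {u v : L2 n} (h : ∀ k, fcoeff u k = fcoeff v k) : u = v := by
  have h1 := hasSum_fcoeff (u - v)
  have h2 : (fun k => ‖fcoeff (u - v) k‖ ^ 2) = fun _ => 0 := by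
    funext k
    rw [fcoeff_eq_inner, inner_sub_right, ← fcoeff_eq_inner, ← fcoeff_eq_inner, h k, sub_self]
    simp
  rw [h2] at h1
  have h3 := h1.unique hasSum_zero
  exact sub_eq_zero.1 (norm_eq_zero.1 (pow_eq_zero_iff two_ne_zero |>.1 h3))

theorem eq_sum_fcoeff {u : L2 n} {s : Finset (Fin n → ℤ)} (h : ∀ k ∉ s, fcoeff u k = 0) :
    u = ∑ k ∈ s, fcoeff u k • expoL2 k := by
  refine eq_of_fcoeff_eq fun l => ?_
  rw [fcoeff_eq_inner (∑ k ∈ s, fcoeff u k • expoL2 k), inner_sum]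
  simp only [inner_smul_right, ← fcoeff_eq_inner, fcoeff_expoL2, mul_ite, mul_one, mul_zero]
  rw [Finset.sum_ite_eq' s l]
  split_ifs with hl
  · rfl
  · exact h l hl

theorem expoL2_mem_meanZero {k : Fin n → ℤ} (hk : k ≠ 0) : expoL2 k ∈ meanZero n := by
  have h := fcoeff_expoL2 k 0
  rw [if_neg hk] at h
  have h' : ∫ x in cell n, (expoL2 k : L2 n) x = 0 := by simpa [fcoeff, expo] using h
  exact h'

theorem not_finiteDimensional_L2per (hn : n ≠ 0) : ¬ FiniteDimensional ℂ (L2per n) := by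
  intro hf
  have h1 : LinearIndependent ℂ fun k : {k : Fin n → ℤ // k ≠ 0} =>
      (⟨expoL2 k.1, expoL2_mem_meanZero k.2⟩ : L2per n) := by
    refine LinearIndependent.of_comp (meanZero n).subtype ?_
    exact orthonormal_expoL2.linearIndependent.comp _ Subtype.val_injective
  have h2 : Finite {k : Fin n → ℤ // k ≠ 0} := h1.finite
  have h3 : Function.Injective fun m : ℕ =>
      (⟨fun _ => (m + 1 : ℤ), fun h => by
        have := congrFun h ⟨0, Nat.pos_of_ne_zero hn⟩
        simp only [Pi.zero_apply] at this
        omega⟩ : {k : Fin n → ℤ // k ≠ 0}) := by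
    intro a b hab
    have := congrFun (congrArg Subtype.val hab) ⟨0, Nat.pos_of_ne_zero hn⟩
    simp only at this
    omega
  exact not_injective_infinite_finite _ h3

theorem hasSum_fcoeff_grad (u : H1per n) :
    HasSum (fun k => (2 * Real.pi) ^ 2 * ((∑ j, (k j : ℝ) ^ 2) * ‖fcoeff (H1per.fn u : L2 n) k‖ ^ 2))
      (‖u‖ ^ 2) := by
  have h2 : HasSum (fun k => ∑ j, ‖fcoeff (H1per.grad u j) k‖ ^ 2) (‖H1per.grad u‖ ^ 2) := by
    rw [PiLp.norm_sq_eq_of_L2]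
    exact hasSum_sum fun j _ => hasSum_fcoeff _
  refine h2.congr_fun fun k => ?_
  rw [Finset.sum_mul, Finset.mul_sum]
  refine Finset.sum_congr rfl fun j _ => ?_
  simp only [fcoeff_grad u.isWeakGrad j k, norm_mul, Complex.norm_I, Complex.norm_real,
    Complex.norm_intCast, Real.norm_eq_abs, abs_of_pos Real.pi_pos, RCLike.norm_ofNat, mul_one]
  rw [mul_pow _ ‖_‖, mul_pow _ |_|, sq_abs]
  ring

/-- Poincaré's inequality for functions without Fourier modes in a box. -/
theorem norm_embed_le_of_fcoeff_eq_zero (u : H1per n) {N : ℕ} (hN : 0 < N)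
    (h : ∀ k : Fin n → ℤ, (∀ i, |k i| < N) → fcoeff (H1per.fn u : L2 n) k = 0) :
    ‖embed n u‖ ≤ 1 / (2 * Real.pi * N) * ‖u‖ := by
  have hN' : (0 : ℝ) < N := Nat.cast_pos.2 hN
  have h1 := hasSum_fcoeff (H1per.fn u : L2 n)
  have h3 : (2 * Real.pi * N) ^ 2 * ‖(H1per.fn u : L2 n)‖ ^ 2 ≤ ‖u‖ ^ 2 := by
    refine hasSum_le (fun k => ?_) (h1.mul_left _) (hasSum_fcoeff_grad u)
    by_cases hk : ∀ i, |k i| < N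
    · rw [h k hk]
      simp
    · push Not at hk
      obtain ⟨j, hj⟩ := hk
      have hj' : (N : ℝ) ≤ |(k j : ℝ)| := by
        rw [← Int.cast_abs]
        exact_mod_cast hj
      have h4 : (N : ℝ) ^ 2 ≤ ∑ i, (k i : ℝ) ^ 2 := by
        refine le_trans ?_ (Finset.single_le_sum (f := fun i => (k i : ℝ) ^ 2)
          (fun _ _ => by positivity) (Finset.mem_univ j))
        rw [← sq_abs (k j : ℝ)]
        gcongr
      rw [mul_pow _ (N : ℝ), mul_assoc]
      gcongr
  rw [← mul_pow] at h3
  have h4 := le_of_sq_le_sq h3 (norm_nonneg _)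
  rw [one_div, inv_mul_eq_div, le_div_iff₀ (by positivity), mul_comm]
  exact h4

theorem isCompactOperator_embed (n : ℕ) :
    IsCompactOperator (embed n) ∧ IsCompactOperator (invLaplace n) := by
  refine isCompactOperator_and_adjoint_of_small fun ε hε => ?_
  obtain ⟨N, hN⟩ := exists_nat_gt (1 / (2 * Real.pi * ε))
  have hN0 : 0 < N := by
    rw [← Nat.cast_pos (α := ℝ)]
    exact lt_trans (by positivity) hN
  have hfin : {k : Fin n → ℤ | ∀ i, |k i| < N}.Finite := by
    refine (Set.Finite.pi' (t := fun _ : Fin n => Ioo (-(N : ℤ)) N)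
      fun _ => Set.finite_Ioo _ _).subset fun k hk i => ?_
    exact abs_lt.1 (hk i)
  obtain ⟨m, f, -, hf⟩ := hfin.fin_param
  -- T collects the Fourier coefficients in the box |k_i| < N. On its kernel Poincaré's constant
  -- improves to 1/(2πN), which is at most ε by the choice of N.
  refine ⟨m, ContinuousLinearMap.pi fun i =>
    (innerSL ℂ (expoL2 (f i))).comp ((meanZero n).subtypeL.comp (embed n)), fun v hv => ?_⟩
  refine (norm_embed_le_of_fcoeff_eq_zero v hN0 fun k hk => ?_).trans ?_
  · have : k ∈ range f := by
      rw [hf]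
      exact hk
    obtain ⟨i, rfl⟩ := this
    have h1 := congrFun hv i
    rw [fcoeff_eq_inner]
    exact h1
  · gcongr
    rw [div_le_iff₀ (by positivity)]
    rw [div_lt_iff₀ (by positivity)] at hN
    linarith

/-- The case of equality in Poincaré's inequality. -/
theorem fcoeff_eq_zero_of_norm_embed_eq {u : H1per n} (h : ‖u‖ = 2 * Real.pi * ‖embed n u‖)
    {k : Fin n → ℤ} (hk : ∑ j, (k j : ℝ) ^ 2 ≠ 1) : fcoeff (H1per.fn u : L2 n) k = 0 := by
  have h1 := (hasSum_fcoeff_grad u).sub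
    ((hasSum_fcoeff (H1per.fn u : L2 n)).mul_left ((2 * Real.pi) ^ 2))
  have h2 : ‖u‖ ^ 2 - (2 * Real.pi) ^ 2 * ‖(H1per.fn u : L2 n)‖ ^ 2 = 0 := by
    rw [h, mul_pow]
    exact sub_self _
  rw [h2] at h1
  have h3 (k : Fin n → ℤ) : 0 ≤ (2 * Real.pi) ^ 2 * ((∑ j, (k j : ℝ) ^ 2) *
      ‖fcoeff (H1per.fn u : L2 n) k‖ ^ 2) -
        (2 * Real.pi) ^ 2 * ‖fcoeff (H1per.fn u : L2 n) k‖ ^ 2 := by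
    rw [← mul_sub, ← sub_one_mul]
    by_cases hk : k = 0
    · rw [hk, fcoeff_zero]
      simp
    · obtain ⟨j, hj⟩ := Function.ne_iff.1 hk
      have hkj : (1 : ℝ) ≤ |(k j : ℝ)| := by
        rw [← Int.cast_abs]
        exact_mod_cast Int.one_le_abs hj
      have h4 : (1 : ℝ) ≤ ∑ i, (k i : ℝ) ^ 2 := by
        refine le_trans ?_ (Finset.single_le_sum (f := fun i => (k i : ℝ) ^ 2)
          (fun _ _ => by positivity) (Finset.mem_univ j))
        rw [← sq_abs (k j : ℝ)]
        nlinarith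
      have := sub_nonneg.2 h4
      positivity
  have h5 := congrFun ((hasSum_zero_iff_of_nonneg h3).1 h1) k
  simp only [Pi.zero_apply] at h5
  rw [← mul_sub, ← sub_one_mul] at h5
  have h6 : (2 * Real.pi) ^ 2 ≠ 0 := by positivity
  simpa [h6, sub_eq_zero, hk] using h5

end Fourier

/-! ### Integration by parts and test functions in D -/

section TestFunctions

variable {n : ℕ}

theorem integral_cell_eq_Icc (f : (Fin n → ℝ) → ℂ) :
    ∫ x in cell n, f x = ∫ x in Icc 0 1, f x := by
  have hcell : cell n = Set.pi univ (fun _ => Ioc (0 : ℝ) 1) := by ext; simp [cell]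
  refine setIntegral_congr_set ?_
  rw [hcell]
  exact Measure.univ_pi_Ioc_ae_eq_Icc

/-- The derivatives of a periodic function have mean zero. -/
theorem integral_partialDeriv_eq_zero {ψ : (Fin n → ℝ) → ℂ} (hψ : IsPeriodicSmooth ψ) (j : Fin n) :
    ∫ x in cell n, partialDeriv j ψ x = 0 := by
  rcases n with _ | n
  · exact j.elim0
  rw [integral_cell_eq_Icc]
  have hd : Differentiable ℝ ψ := hψ.smooth.differentiable (by simp)
  -- The divergence theorem for the field whose only nonzero component is ψ in direction j; by
  -- periodicity the two opposite faces cancel.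
  have h1 := integral_divergence_of_hasFDerivAt_off_countable' (0 : Fin (n + 1) → ℝ) 1
    zero_le_one (fun i => if i = j then ψ else 0)
    (fun i x => if i = j then fderiv ℝ ψ x else 0) ∅ countable_empty
    (fun i => by
      split_ifs
      · exact hd.continuous.continuousOn
      · exact continuousOn_const)
    (fun x _ i => by
      by_cases h : i = j
      · simp only [if_pos h]
        exact (hd x).hasFDerivAt
      · simp only [if_neg h]
        exact hasFDerivAt_const (0 : ℂ) x)
    (by
      refine Continuous.integrableOn_Icc (continuous_finsetSum _ fun i _ => ?_)
      by_cases h : i = j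
      · subst h
        simp only [if_pos]
        exact hψ.continuous_partialDeriv i
      · simp only [if_neg h]
        exact continuous_const)
  have h2 (x : Fin (n + 1) → ℝ) :
      ∑ i, (if i = j then fderiv ℝ ψ x else 0) (Pi.single i 1) = partialDeriv j ψ x := by
    rw [Finset.sum_eq_single j]
    · simp [partialDeriv]
    · intro i _ hi
      simp [hi]
    · simp
  simp only [h2] at h1
  rw [h1]
  refine Finset.sum_eq_zero fun i _ => ?_
  by_cases h : i = j
  · simp only [if_pos h]
    rw [sub_eq_zero]
    refine integral_congr_ae (Eventually.of_forall fun x => ?_)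
    have h3 := hψ.periodic (Pi.single i 1) (i.insertNth ((0 : Fin (n + 1) → ℝ) i) x)
    dsimp only
    rw [← h3]
    congr 1
    funext l
    refine Fin.succAboveCases i ?_ (fun l => ?_) l
    · simp
    · simp
  · simp [if_neg h]

theorem HasCompactSupport.integral_mul_partialDeriv {φ ψ : (Fin n → ℝ) → ℂ} (hφ : ContDiff ℝ ∞ φ)
    (hc : HasCompactSupport φ) (hψ : ContDiff ℝ ∞ ψ) (j : Fin n) :
    ∫ x, φ x * partialDeriv j ψ x = - ∫ x, partialDeriv j φ x * ψ x := by
  have h1 : Continuous (partialDeriv j φ) :=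
    (hφ.continuous_fderiv (by simp)).clm_apply continuous_const
  have h2 : Continuous (partialDeriv j ψ) :=
    (hψ.continuous_fderiv (by simp)).clm_apply continuous_const
  refine integral_mul_fderiv_eq_neg_fderiv_mul_of_integrable ?_ ?_ ?_
    (fun x _ => hφ.differentiable (by simp) x) (fun x _ => hψ.differentiable (by simp) x)
  · exact (h1.mul hψ.continuous).integrable_of_hasCompactSupport
      (HasCompactSupport.mul_right (hc.fderiv_apply ℝ _))
  · exact (hφ.continuous.mul h2).integrable_of_hasCompactSupport hc.mul_right
  · exact (hφ.continuous.mul hψ.continuous).integrable_of_hasCompactSupport hc.mul_right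

theorem setIntegral_eq_integral_of_tsupport_subset {S : Set (Fin n → ℝ)} {φ : (Fin n → ℝ) → ℂ}
    (h : tsupport φ ⊆ S) : ∫ x in S, φ x = ∫ x, φ x :=
  setIntegral_eq_integral_of_forall_compl_eq_zero fun _ hx =>
    image_eq_zero_of_notMem_tsupport fun h' => hx (h h')

theorem tsupport_partialDeriv_subset (φ : (Fin n → ℝ) → ℂ) (j : Fin n) :
    tsupport (partialDeriv j φ) ⊆ tsupport φ :=
  tsupport_fderiv_apply_subset ℝ _

theorem IsInclusionDomain.subset_cell {D : Set (Fin n → ℝ)} (hD : IsInclusionDomain D) :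
    D ⊆ cell n := fun _ hx i => Ioo_subset_Ioc_self (hD.closure_subset (subset_closure hx) i)

/-- Test functions in `D`, corrected to mean zero, belong to `W₂`. -/
theorem exists_mem_W2 {D : Set (Fin n → ℝ)} (hD : IsInclusionDomain D) {φ : (Fin n → ℝ) → ℂ}
    (hφ : ContDiff ℝ ∞ φ) (hc : HasCompactSupport φ) (hs : tsupport φ ⊆ D) :
    ∃ v ∈ W2 D, (H1per.fn v : L2 n) =ᵐ[volume.restrict (cell n)]
      fun x => φ x - ∫ y in D, φ y := by
  have hcell := hs.trans hD.subset_cell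
  have hcont (f : (Fin n → ℝ) → ℂ) (hf : Continuous f) (hfc : HasCompactSupport f) :
      MemLp f 2 (volume.restrict (cell n)) := by
    obtain ⟨C, hC⟩ := hfc.exists_bound_of_continuous hf
    exact MemLp.of_bound hf.aestronglyMeasurable C (Eventually.of_forall hC)
  have hdc (j : Fin n) : Continuous (partialDeriv j φ) :=
    (hφ.continuous_fderiv (by simp)).clm_apply continuous_const
  have hm := hcont φ hφ.continuous hc
  have hg (j : Fin n) := hcont (partialDeriv j φ) (hdc j) (hc.fderiv_apply ℝ _)
  set m : ℂ := ∫ y in D, φ y with hmdef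
  have hm' : MemLp (fun x => φ x - m) 2 (volume.restrict (cell n)) := hm.sub (memLp_const m)
  have hu0 : hm'.toLp _ ∈ meanZero n := by
    have h1 : ∫ x in cell n, (hm'.toLp _ : L2 n) x = 0 := by
      rw [integral_congr_ae hm'.coeFn_toLp, integral_sub (hm.integrable (by norm_num))
        (integrable_const m), setIntegral_eq_integral_of_tsupport_subset hcell, hmdef,
        setIntegral_eq_integral_of_tsupport_subset hs, integral_const, measureReal_def,
        Measure.restrict_apply_univ, volume_cell]
      simp
    exact h1
  have hgrad : IsWeakGrad (hm'.toLp _) (fun j => (hg j).toLp _) := by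
    intro ψ hψ j
    have h1 : ∫ x in cell n, (hm'.toLp _ : L2 n) x * partialDeriv j ψ x =
        ∫ x in cell n, (φ x * partialDeriv j ψ x - m * partialDeriv j ψ x) := by
      refine integral_congr_ae ?_
      filter_upwards [hm'.coeFn_toLp] with x hx
      rw [hx, sub_mul]
    have h2 : ∫ x in cell n, ((hg j).toLp _ : L2 n) x * ψ x =
        ∫ x in cell n, partialDeriv j φ x * ψ x := by
      refine integral_congr_ae ?_
      filter_upwards [(hg j).coeFn_toLp] with x hx
      rw [hx]
    have h3 : Integrable (fun x => φ x * partialDeriv j ψ x) (volume.restrict (cell n)) :=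
      ((hφ.continuous.mul (hψ.continuous_partialDeriv j)).integrable_of_hasCompactSupport
        hc.mul_right).restrict
    have h4 : Integrable (fun x => m * partialDeriv j ψ x) (volume.restrict (cell n)) := by
      refine Integrable.const_mul ?_ m
      have hI := (hψ.continuous_partialDeriv j).integrableOn_Icc (a := 0) (b := 1)
        (μ := volume)
      exact IntegrableOn.mono_set hI fun x hx => ⟨fun i => (hx i).1.le, fun i => (hx i).2⟩
    have h5 : tsupport (fun x => φ x * partialDeriv j ψ x) ⊆ cell n :=
      (tsupport_mul_subset_left).trans hcell
    have h6 : tsupport (fun x => partialDeriv j φ x * ψ x) ⊆ cell n :=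
      (tsupport_mul_subset_left).trans ((tsupport_partialDeriv_subset φ j).trans hcell)
    refine h1.trans (Eq.trans ?_ (congrArg Neg.neg h2).symm)
    rw [integral_sub h3 h4, integral_const_mul, integral_partialDeriv_eq_zero hψ, mul_zero,
      sub_zero, setIntegral_eq_integral_of_tsupport_subset h5,
      setIntegral_eq_integral_of_tsupport_subset h6]
    exact HasCompactSupport.integral_mul_partialDeriv hφ hc hψ.smooth j
  let v : H1per n := (⟨(⟨hm'.toLp _, hu0⟩, WithLp.toLp 2 fun j => (hg j).toLp _), hgrad⟩ :
    ↥(gradGraph n))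
  have hv : (H1per.fn v : L2 n) =ᵐ[volume.restrict (cell n)] fun x => φ x - m := hm'.coeFn_toLp
  refine ⟨v, ?_, hv⟩
  refine Submodule.le_topologicalClosure _ (Submodule.subset_span ?_)
  refine ⟨(hm.toLp _, fun j => (hg j).toLp _), subset_closure ⟨φ, hφ, hc, hs, hm.coeFn_toLp,
    fun j => (hg j).coeFn_toLp⟩, ?_⟩
  have h7 : ∫ y in D, (hm.toLp _ : L2 n) y = m := by
    refine integral_congr_ae ?_
    exact ae_mono (Measure.restrict_mono hD.subset_cell le_rfl) hm.coeFn_toLp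
  filter_upwards [hv, hm.coeFn_toLp] with x hx hx'
  rw [hx, hx']
  exact congrArg (φ x - ·) h7.symm

end TestFunctions

/-! ### Unique continuation for trigonometric polynomials -/

section TrigPoly

variable {n : ℕ}

theorem analyticOnNhd_expo (k : Fin n → ℤ) : AnalyticOnNhd ℝ (expo k) univ := by
  intro x _
  unfold expo
  have (i : Fin n) : AnalyticAt ℝ (fun x : Fin n → ℝ => ((x i : ℝ) : ℂ)) x :=
    (Complex.ofRealCLM.comp (ContinuousLinearMap.proj (R := ℝ) i : (Fin n → ℝ) →L[ℝ] ℝ)).analyticAt x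
  have h2 : AnalyticAt ℝ (fun x : Fin n → ℝ => 2 * Real.pi * Complex.I *
      ∑ i, (k i : ℂ) * (x i : ℂ)) x :=
    analyticAt_const.mul (Finset.analyticAt_fun_sum _ fun i _ => analyticAt_const.mul (this i))
  have h3 : AnalyticAt ℝ Complex.exp (2 * Real.pi * Complex.I * ∑ i, (k i : ℂ) * (x i : ℂ)) :=
    analyticAt_cexp.restrictScalars
  exact AnalyticAt.fun_comp (f := fun x : Fin n → ℝ => (2 * Real.pi * Complex.I *
    ∑ i, (k i : ℂ) * (x i : ℂ) : ℂ)) h3 h2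

/-- A trigonometric polynomial that vanishes almost everywhere in a nonempty open subset of the cell
is zero. -/
theorem eq_zero_of_trigPoly {D : Set (Fin n → ℝ)} (hD : IsOpen D) (hne : D.Nonempty)
    (hcell : D ⊆ cell n) {u : L2 n} {s : Finset (Fin n → ℤ)} (hs : ∀ k ∉ s, fcoeff u k = 0)
    (hu : ∀ᵐ x ∂volume.restrict (cell n), x ∈ D → u x = 0) : u = 0 := by
  set p : (Fin n → ℝ) → ℂ := fun x => ∑ k ∈ s, fcoeff u k * expo k x with hp
  have hup : u =ᵐ[volume.restrict (cell n)] p := by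
    have h1 : (∑ k ∈ s, fcoeff u k • expoL2 k : L2 n) =ᵐ[volume.restrict (cell n)] p := by
      have h2 : ∀ᵐ x ∂volume.restrict (cell n), ∀ k ∈ s,
          (fcoeff u k • expoL2 k : L2 n) x = fcoeff u k * expo k x := by
        refine (Finset.eventually_all s).2 fun k _ => ?_
        filter_upwards [Lp.coeFn_smul (fcoeff u k) (expoL2 k), coeFn_expoL2 k] with x hx hx'
        rw [hx, Pi.smul_apply, hx', smul_eq_mul]
      filter_upwards [Lp.coeFn_finsetSum s fun k => fcoeff u k • expoL2 k, h2] with x hx hx'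
      rw [hx, Finset.sum_apply]
      exact Finset.sum_congr rfl hx'
    exact (congrArg (fun w : L2 n => (w : (Fin n → ℝ) → ℂ)) (eq_sum_fcoeff hs)).eventuallyEq.trans h1
  have hpc : Continuous p := continuous_finsetSum _ fun k _ => (continuous_expo k).const_mul _
  have h0 : ∀ x ∈ D, p x = 0 := by
    have hO : IsOpen (D ∩ p ⁻¹' {0}ᶜ) := hD.inter (isOpen_compl_singleton.preimage hpc)
    have hnull : volume (D ∩ p ⁻¹' {0}ᶜ) = 0 := by
      have h1 : ∀ᵐ x ∂volume.restrict (cell n), x ∈ D → p x = 0 := by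
        filter_upwards [hu, hup] with x hx hx' hxD
        rw [← hx', hx hxD]
      rw [ae_restrict_iff' (measurableSet_cell n)] at h1
      refine measure_mono_null ?_ h1
      rintro x ⟨hx, hx'⟩ h
      exact hx' (h (hcell hx) hx)
    have hempty := (hO.measure_eq_zero_iff volume).1 hnull
    intro x hx
    by_contra h
    exact (hempty ▸ (⟨hx, h⟩ : x ∈ D ∩ p ⁻¹' {0}ᶜ) : x ∈ (∅ : Set (Fin n → ℝ)))
  have hpa : AnalyticOnNhd ℝ p univ := fun x hx =>
    Finset.analyticAt_fun_sum _ fun k _ => analyticAt_const.mul (analyticOnNhd_expo k x hx)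
  obtain ⟨x₀, hx₀⟩ := hne
  have hp0 : p = fun _ => 0 := hpa.eq_of_eventuallyEq (z₀ := x₀)
    (fun x _ => analyticAt_const) (by filter_upwards [hD.mem_nhds hx₀] with x hx using h0 x hx)
  refine Lp.ext (hup.trans ?_)
  rw [hp0]
  exact (Lp.coeFn_zero _ _ _).symm

end TrigPoly

/-! ### Orthogonality of the resonance spaces -/

section Resonance

variable {n : ℕ} {D : Set (Fin n → ℝ)}

theorem conj_gradForm (S : Set (Fin n → ℝ)) (u v : H1per n) :
    conj (gradForm S u v) = gradForm S v u := by
  unfold gradForm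
  rw [map_sum]
  refine Finset.sum_congr rfl fun j _ => ?_
  rw [← integral_conj]
  refine integral_congr_ae (Eventually.of_forall fun x => ?_)
  dsimp only
  rw [map_mul, Complex.conj_conj, mul_comm]

theorem conj_resonanceForm (D : Set (Fin n → ℝ)) (u v : H1per n) :
    conj (resonanceForm D u v) = resonanceForm D v u := by
  unfold resonanceForm
  rw [map_sub, map_mul, map_mul, conj_gradForm, conj_gradForm, map_div₀, map_one, map_ofNat]

/-- The form of T is Hermitian and the eigenvalues are real, so (ν - ν')⟨u, v⟩ = 0 as for any
symmetric operator. -/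
theorem isOrtho_resonanceSpace {ν ν' : ℝ} (h : ν ≠ ν') :
    resonanceSpace D ν ⟂ resonanceSpace D ν' := by
  rw [Submodule.isOrtho_iff_inner_eq]
  intro u hu v hv
  have h1 := hu.2 v hv.1
  have h2 := hv.2 u hu.1
  rw [← conj_resonanceForm, h1, map_mul, inner_conj_symm, Complex.conj_ofReal, ← sub_eq_zero,
    ← sub_mul, ← Complex.ofReal_sub] at h2
  exact (mul_eq_zero.1 h2).resolve_left (Complex.ofReal_ne_zero.2 (sub_ne_zero.2 h))

theorem isOrtho_topologicalClosure {V : Type*} [NormedAddCommGroup V] [InnerProductSpace ℂ V]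
    {U W : Submodule ℂ V} (h : U ⟂ W) : U.topologicalClosure ⟂ W.topologicalClosure := by
  have key {U W : Submodule ℂ V} (h : U ⟂ W) : U.topologicalClosure ⟂ W :=
    Submodule.topologicalClosure_minimal _ h (Submodule.isClosed_orthogonal W)
  exact (key (key h).symm).symm

theorem isOrtho_W1_W3 (D : Set (Fin n → ℝ)) : W1 D ⟂ W3 D :=
  (Submodule.isOrtho_orthogonal_right _).mono_left le_sup_left

theorem resonanceSpace_le_W3 (D : Set (Fin n → ℝ)) (ν : ℝ) : resonanceSpace D ν ≤ W3 D :=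
  fun _ hu => hu.1

/-- The orthogonal family made up of `W₁` and the eigenspaces of `T`. -/
def resonanceFamily (D : Set (Fin n → ℝ)) : Option ℝ → Submodule ℂ (H1per n)
  | none => W1 D
  | some ν => resonanceSpace D ν

theorem pairwise_isOrtho_resonanceFamily (D : Set (Fin n → ℝ)) : Pairwise fun i j =>
    (resonanceFamily D i).topologicalClosure ⟂ (resonanceFamily D j).topologicalClosure := by
  intro i j hij
  refine isOrtho_topologicalClosure ?_
  rcases i with _ | ν <;> rcases j with _ | ν'
  · exact absurd rfl hij
  · exact (isOrtho_W1_W3 D).mono_right (resonanceSpace_le_W3 D ν')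
  · exact ((isOrtho_W1_W3 D).mono_right (resonanceSpace_le_W3 D ν)).symm
  · exact isOrtho_resonanceSpace fun h => hij (congrArg some h)

/-! ### Strictness in Poincaré's inequality -/

/-- Equality in Poincaré's inequality fails on `W₃ ∖ {0}`. -/
theorem eq_zero_of_mem_W3 (hD : IsInclusionDomain D) {a : H1per n} (ha : a ∈ W3 D)
    (h : ‖a‖ = 2 * Real.pi * ‖embed n a‖) : a = 0 := by
  by_contra ha0
  have hpi := Real.pi_pos
  have hnE : ‖embed n‖ = 1 / (2 * Real.pi) := by
    refine le_antisymm (LinearMap.mkContinuous_norm_le _ (by positivity) _) ?_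
    have h1 := (embed n).le_opNorm a
    rw [h] at h1
    have h2 : 0 < ‖embed n a‖ := by
      have : 0 < ‖a‖ := norm_pos_iff.2 ha0
      rw [h] at this
      exact pos_of_mul_pos_right this (by positivity)
    rw [div_le_iff₀ (by positivity)]
    refine le_of_mul_le_mul_right ?_ h2
    linarith
  -- Since E attains its norm at a, the vector a is an eigenvector of E*E. This turns orthogonality
  -- to W₂ in H¹ into orthogonality in L².
  have h1 : ContinuousLinearMap.adjoint (embed n) (embed n a) = ((‖embed n‖ ^ 2 : ℝ) : ℂ) • a := by
    refine adjoint_apply_eq_of_norm_eq ?_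
    rw [hnE, h]
    field_simp
  have h2 (v : H1per n) (hv : v ∈ W2 D) : inner ℂ (embed n v) (embed n a) = 0 := by
    rw [← ContinuousLinearMap.adjoint_inner_right, h1, inner_smul_right]
    have h3 : inner ℂ v a = 0 :=
      (Submodule.mem_orthogonal _ _).1 ha v ((le_sup_right : W2 D ≤ W1 D ⊔ W2 D) hv)
    rw [h3, mul_zero]
  set u : L2 n := (H1per.fn a : L2 n) with hu
  have hmean : ∫ x in cell n, u x = 0 := (H1per.fn a).2
  -- The constants subtracted from the test functions do not matter because u has mean zero, so u
  -- annihilates all test functions in D.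
  have h4 : ∀ᵐ x ∂volume.restrict (cell n), x ∈ D → u x = 0 := by
    refine hD.isOpen.ae_eq_zero_of_integral_contDiff_smul_eq_zero
      ((L2.integrable u).locallyIntegrable.locallyIntegrableOn _) fun g hg hgc hgs => ?_
    have hφ : ContDiff ℝ ∞ fun x => (g x : ℂ) := Complex.ofRealCLM.contDiff.comp hg
    have hts : tsupport (fun x => (g x : ℂ)) = tsupport g := by
      unfold tsupport
      congr 1
      ext x
      simp
    obtain ⟨v, hv, hvφ⟩ := exists_mem_W2 hD hφ (by rwa [HasCompactSupport, hts]) (hts ▸ hgs)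
    have h5 := h2 v hv
    have h6 : ∫ x in cell n, u x * conj ((H1per.fn v : L2 n) x) = 0 := by
      rw [← h5]
      exact (L2.inner_def (𝕜 := ℂ) (H1per.fn v : L2 n) u).symm
    set m : ℂ := ∫ y in D, (g y : ℂ)
    have h7 : ∫ x in cell n, u x * conj ((H1per.fn v : L2 n) x) =
        ∫ x in cell n, (u x * g x - u x * conj m) := by
      refine integral_congr_ae ?_
      filter_upwards [hvφ] with x hx
      rw [hx, map_sub, Complex.conj_ofReal, mul_sub]
    rw [h7, integral_sub (integrable_mul_continuous u hφ.continuous)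
      ((L2.integrable u).mul_const _), integral_mul_const, hmean, zero_mul, sub_zero] at h6
    rw [← h6]
    refine integral_congr_ae (Eventually.of_forall fun x => ?_)
    dsimp only
    rw [Complex.real_smul, mul_comm]
  have hfin : {k : Fin n → ℤ | ∑ j, (k j : ℝ) ^ 2 = 1}.Finite := by
    refine (Set.Finite.pi' (t := fun _ : Fin n => Icc (-1 : ℤ) 1)
      fun _ => Set.finite_Icc _ _).subset fun k hk i => ?_
    have h5 : (k i : ℝ) ^ 2 ≤ 1 := by
      rw [← (hk : ∑ j, (k j : ℝ) ^ 2 = 1)]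
      exact Finset.single_le_sum (f := fun i => (k i : ℝ) ^ 2) (fun _ _ => by positivity)
        (Finset.mem_univ i)
    have h6 : k i ^ 2 ≤ 1 := by exact_mod_cast h5
    exact abs_le.1 (sq_le_one_iff_abs_le_one _ |>.1 h6)
  have hu0 : u = 0 := eq_zero_of_trigPoly hD.isOpen hD.nonempty hD.subset_cell
    (s := hfin.toFinset) (fun k hk => fcoeff_eq_zero_of_norm_embed_eq h (by simpa using hk)) h4
  apply ha0
  have h5 : embed n a = 0 := Subtype.ext hu0
  rw [h5, norm_zero, mul_zero] at h
  exact norm_eq_zero.1 h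

/-- The operator `P_{W₃} + √τ Q₁`. -/
def weightOp (D : Set (Fin n → ℝ)) (τ : ℝ) : H1per n →L[ℂ] H1per n :=
  proj (W3 D) + ((√τ : ℝ) : ℂ) • proj (W1 D)

theorem topologicalClosure_W3 (D : Set (Fin n → ℝ)) : (W3 D).topologicalClosure = W3 D :=
  (Submodule.isClosed_orthogonal _).submodule_topologicalClosure_eq

/-- Otherwise compactness would give a unit vector of W₃ with equality in Poincaré's inequality. The
gap obtained here is what makes the disc of convergence larger than r*. -/
theorem norm_embed_comp_weightOp_lt (hD : IsInclusionDomain D) {τ : ℝ} (h0 : 0 ≤ τ) (h1 : τ < 1) :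
    ‖embed n ∘L weightOp D τ‖ < 1 / (2 * Real.pi) := by
  have hpi := Real.pi_pos
  by_contra! hge
  obtain ⟨a, ha, ha1, hEa⟩ := exists_norm_apply_eq_of_le (isCompactOperator_embed n).1
    (isOrtho_topologicalClosure (isOrtho_W1_W3 D).symm) h0 h1 (by positivity) H1per.poincare hge
  rw [topologicalClosure_W3] at ha
  have h12 : ‖a‖ = 2 * Real.pi * ‖embed n a‖ := by
    rw [hEa, ha1]
    field_simp
  have h13 := eq_zero_of_mem_W3 hD ha h12
  rw [h13, norm_zero] at ha1
  exact zero_ne_one ha1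

end Resonance

/-! ### A weighted norm bound for sums of projections -/

section WeightedBound

variable {H V ι : Type*} [NormedAddCommGroup H] [InnerProductSpace ℂ H] [CompleteSpace H]
  [NormedAddCommGroup V] [InnerProductSpace ℂ V] [CompleteSpace V]
  {G : ι → Submodule ℂ V} [∀ i, (G i).HasOrthogonalProjection]

/-- A bound for `E (∑ cᵢ Pᵢ) E*` in terms of the norm of `E (P_U + √τ P_{i₀})`, where all the ranges
but the one of index `i₀` are contained in `U`. -/
theorem norm_comp_sum_comp_adjoint_le (hG : Pairwise fun i j => G i ⟂ G j) {U : Submodule ℂ V}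
    [U.HasOrthogonalProjection] {i₀ : ι} (hU : ∀ i ≠ i₀, G i ≤ U) (hU₀ : G i₀ ⟂ U) {τ C : ℝ}
    (hτ : 0 < τ) (hτC : τ⁻¹ ≤ C) {s : Finset ι} {c : ι → ℂ} (hc₀ : c i₀ = 1)
    (hc : ∀ i ∈ s, i ≠ i₀ → ‖c i‖ ≤ C) (E : V →L[ℂ] H) :
    ‖E ∘L (∑ i ∈ s, c i • (G i).starProjection) ∘L ContinuousLinearMap.adjoint E‖ ≤
      C * ‖E ∘L (U.starProjection + ((√τ : ℝ) : ℂ) • (G i₀).starProjection)‖ ^ 2 := by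
  classical
  set S : V →L[ℂ] V := U.starProjection + ((√τ : ℝ) : ℂ) • (G i₀).starProjection with hS
  have hC : 0 ≤ C := (inv_pos.2 hτ).le.trans hτC
  have hSa : ContinuousLinearMap.adjoint S = S := by
    have h1 : IsSelfAdjoint S := (isSelfAdjoint_starProjection U).add
      (IsSelfAdjoint.smul (Complex.conj_ofReal _) (isSelfAdjoint_starProjection (G i₀)))
    exact h1.adjoint_eq
  let w : ι → ℂ := fun i => if i = i₀ then ((√τ : ℝ) : ℂ) else 1
  have hSp (i : ι) : S ∘L (G i).starProjection = w i • (G i).starProjection := by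
    by_cases hi : i = i₀
    · subst hi
      rw [hS, ContinuousLinearMap.add_comp, ContinuousLinearMap.smul_comp,
        hU₀.symm.starProjection_comp_starProjection, zero_add,
        Submodule.starProjection_comp_starProjection_of_le le_rfl]
      simp only [w, if_pos]
    · rw [hS, ContinuousLinearMap.add_comp, ContinuousLinearMap.smul_comp,
        (hG (Ne.symm hi)).starProjection_comp_starProjection, smul_zero, add_zero]
      simp only [w, if_neg hi, one_smul]
      ext x
      exact Submodule.starProjection_eq_self_iff.2 (hU i hi (Submodule.starProjection_apply_mem _ _))
  have hpS (i : ι) : (G i).starProjection ∘L S = w i • (G i).starProjection := by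
    have h1 := congrArg ContinuousLinearMap.adjoint (hSp i)
    have h2 : conj (w i) = w i := by
      simp only [w]
      split_ifs <;> simp
    rw [ContinuousLinearMap.adjoint_comp, map_smulₛₗ, hSa, h2,
      (isSelfAdjoint_starProjection (G i)).adjoint_eq] at h1
    exact h1
  -- The factors √τ on the two sides multiply to τ on the range of index `i₀`, so the coefficient 1
  -- there becomes τ⁻¹, which is still at most C.
  let c' : ι → ℂ := fun i => if i = i₀ then ((τ⁻¹ : ℝ) : ℂ) else c i
  have h1 : (∑ i ∈ s, c i • (G i).starProjection) =
      S ∘L (∑ i ∈ s, c' i • (G i).starProjection) ∘L S := by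
    rw [ContinuousLinearMap.finsetSum_comp, ContinuousLinearMap.comp_finsetSum]
    refine Finset.sum_congr rfl fun i _ => ?_
    rw [ContinuousLinearMap.smul_comp, ContinuousLinearMap.comp_smul, hpS,
      ContinuousLinearMap.comp_smul, hSp, smul_smul, smul_smul]
    congr 1
    by_cases hi : i = i₀
    · subst hi
      simp only [w, c', if_pos, hc₀]
      rw [mul_assoc, ← Complex.ofReal_mul, Real.mul_self_sqrt hτ.le, ← Complex.ofReal_mul,
        inv_mul_cancel₀ hτ.ne', Complex.ofReal_one]
    · simp only [w, c', if_neg hi, mul_one]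
  have h2 : ‖∑ i ∈ s, c' i • (G i).starProjection‖ ≤ C := by
    refine norm_sum_smul_starProjection_le hG s (fun i hi => ?_) hC
    by_cases h : i = i₀
    · simp only [c', if_pos h, Complex.norm_real, Real.norm_of_nonneg (inv_pos.2 hτ).le]
      exact hτC
    · simp only [c', if_neg h]
      exact hc i hi h
  have h3 : E ∘L (∑ i ∈ s, c i • (G i).starProjection) ∘L ContinuousLinearMap.adjoint E =
      (E ∘L S) ∘L (∑ i ∈ s, c' i • (G i).starProjection) ∘L
        ContinuousLinearMap.adjoint (E ∘L S) := by
    rw [ContinuousLinearMap.adjoint_comp, hSa, h1]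
    rfl
  rw [h3]
  calc _ ≤ ‖E ∘L S‖ * (‖∑ i ∈ s, c' i • (G i).starProjection‖ *
        ‖ContinuousLinearMap.adjoint (E ∘L S)‖) :=
        (ContinuousLinearMap.opNorm_comp_le _ _).trans (mul_le_mul_of_nonneg_left
          (ContinuousLinearMap.opNorm_comp_le _ _) (norm_nonneg _))
    _ ≤ ‖E ∘L S‖ * (C * ‖E ∘L S‖) := by
      rw [LinearIsometryEquiv.norm_map]
      gcongr
    _ = _ := by ring

end WeightedBound

/-! ### Families of the form z a + b + z f(z) -/

section AffineFamily

variable {F ι : Type*} [NormedAddCommGroup F] [NormedSpace ℂ F]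

theorem zero_smul_add_add_zero_smul (a b c : F) : (0 : ℂ) • a + b + (0 : ℂ) • c = b := by
  rw [zero_smul, zero_smul, zero_add, add_zero]

theorem differentiableOn_smul_add_add_smul (a b : F) {f : ℂ → F} {U : Set ℂ}
    (hf : DifferentiableOn ℂ f U) : DifferentiableOn ℂ (fun z => z • a + b + z • f z) U :=
  ((differentiableOn_id.smul_const a).add_const b).add (differentiableOn_id.fun_smul hf)

theorem norm_smul_add_add_smul_sub (z : ℂ) (a b c c' : F) :
    ‖(z • a + b + z • c) - ((0 : ℂ) • a + b + (0 : ℂ) • c')‖ = ‖z‖ * ‖a + c‖ := by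
  rw [zero_smul_add_add_zero_smul, ← norm_smul, smul_add]
  congr 1
  abel

theorem norm_smul_add_add_tsum_sub_le {H ι : Type*} [NormedAddCommGroup H] [NormedSpace ℂ H] (z : ℂ)
    (a b : H →L[ℂ] H) {f f' : ι → H →L[ℂ] H} (hf : Summable f) {C : ℝ}
    (h : ∀ s : Finset ι, ‖a + ∑ i ∈ s, f i‖ ≤ C) :
    ‖(z • a + b + z • ∑' i, f i) - ((0 : ℂ) • a + b + (0 : ℂ) • ∑' i, f' i)‖ ≤ ‖z‖ * C := by
  refine (norm_smul_add_add_smul_sub z a b _ _).le.trans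
    (mul_le_mul_of_nonneg_left ?_ (norm_nonneg z))
  exact le_of_tendsto (hf.hasSum.const_add a).norm (Eventually.of_forall h)

variable {H V : Type*} [NormedAddCommGroup H] [NormedSpace ℂ H] [NormedAddCommGroup V]
  [NormedSpace ℂ V]

theorem comp_add_sum_comp (E : V →L[ℂ] H) (L : H →L[ℂ] V) (X : V →L[ℂ] V) (s : Finset ι)
    (c : ι → ℂ) (Y : ι → V →L[ℂ] V) : E ∘L X ∘L L + ∑ i ∈ s, c i • (E ∘L Y i ∘L L) =
      E ∘L (X + ∑ i ∈ s, c i • Y i) ∘L L := by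
  rw [ContinuousLinearMap.add_comp, ContinuousLinearMap.comp_add,
    ContinuousLinearMap.finsetSum_comp, ContinuousLinearMap.comp_finsetSum]
  congr 1
  refine Finset.sum_congr rfl fun i _ => ?_
  rw [ContinuousLinearMap.smul_comp, ContinuousLinearMap.comp_smul]

theorem isCompactOperator_smul_add_add_smul (E : V →L[ℂ] H) {L : H →L[ℂ] V}
    (hL : IsCompactOperator L) (X X' : V →L[ℂ] V) (z : ℂ) {T : H →L[ℂ] H}
    (hT : IsCompactOperator T) :
    IsCompactOperator (z • (E ∘L X ∘L L) + E ∘L X' ∘L L + z • T : H →L[ℂ] H) := by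
  have h (X : V →L[ℂ] V) : IsCompactOperator (E ∘L X ∘L L) := hL.clm_comp (E ∘L X)
  exact (((h _).smul z).add (h _)).add (hT.smul z)

end AffineFamily

/-! ### Holomorphy and size of A⁰(z) - A⁰(0) -/

section Family

variable {n : ℕ} {D : Set (Fin n → ℝ)}

/-- The coefficient `[(1/2 + ν) + z (1/2 - ν)]⁻¹`. -/
def resonanceCoeff (z : ℂ) (ν : ℝ) : ℂ := ((1 / 2 + (ν : ℂ)) + z * (1 / 2 - (ν : ℂ)))⁻¹

/-- The triangle inequality gives (1/2 + ν) - |z|(1/2 - ν), which increases with ν. So the lowest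
eigenvalue is the worst case. -/
theorem le_norm_resonanceDenom {μ ν : ℝ} (hμν : μ ≤ ν) (hν : ν ≤ 1 / 2) (z : ℂ) :
    (1 / 2 + μ) - ‖z‖ * (1 / 2 - μ) ≤ ‖(1 / 2 + (ν : ℂ)) + z * (1 / 2 - (ν : ℂ))‖ := by
  have h1 : (1 / 2 - (ν : ℂ)) = ((1 / 2 - ν : ℝ) : ℂ) := by push_cast; ring
  have h2 : (1 / 2 + (ν : ℂ)) = ((1 / 2 + ν : ℝ) : ℂ) := by push_cast; ring
  have h3 := norm_sub_le_norm_add ((1 / 2 + ν : ℝ) : ℂ) (z * ((1 / 2 - ν : ℝ) : ℂ))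
  rw [norm_mul, Complex.norm_real, Complex.norm_real,
    Real.norm_of_nonneg (by linarith : 0 ≤ 1 / 2 - ν)] at h3
  rw [h1, h2]
  refine le_trans ?_ h3
  have h4 := le_abs_self (1 / 2 + ν)
  rw [Real.norm_eq_abs]
  nlinarith [norm_nonneg z]

theorem norm_resonanceCoeff_le {μ ν : ℝ} (hμν : μ ≤ ν) (hν : ν ≤ 1 / 2) {z : ℂ}
    (hz : 0 < (1 / 2 + μ) - ‖z‖ * (1 / 2 - μ)) :
    ‖resonanceCoeff z ν‖ ≤ ((1 / 2 + μ) - ‖z‖ * (1 / 2 - μ))⁻¹ := by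
  rw [resonanceCoeff, norm_inv]
  exact inv_anti₀ hz (le_norm_resonanceDenom hμν hν z)

variable {μ : ℝ} (hμ : IsLeast {ν | IsResonance D ν} μ) (hμ₁ : -1 / 2 < μ) (hμ₂ : μ < 0)

theorem pairwise_isOrtho_innerResonance (D : Set (Fin n → ℝ)) :
    Pairwise fun i j : InnerResonance D => (resonanceSpace D i.1).topologicalClosure ⟂
      (resonanceSpace D j.1).topologicalClosure := fun _ _ hij =>
  isOrtho_topologicalClosure (isOrtho_resonanceSpace fun h => hij (Subtype.ext h))

include hμ in
theorem summable_resonanceTerm {z : ℂ} (hz : 0 < (1 / 2 + μ) - ‖z‖ * (1 / 2 - μ)) :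
    Summable (resonanceTerm D z) :=
  summable_smul_comp_starProjection (pairwise_isOrtho_innerResonance D) (embed n)
    (isCompactOperator_embed n).2 (c := fun i => resonanceCoeff z i.1)
    fun i => norm_resonanceCoeff_le (hμ.2 i.2.1) i.2.2.2.le hz

include hμ hμ₂ in
theorem differentiableOn_A :
    DifferentiableOn ℂ (A D) {z | 0 < (1 / 2 + μ) - ‖z‖ * (1 / 2 - μ)} := by
  have hO : IsOpen {z : ℂ | 0 < (1 / 2 + μ) - ‖z‖ * (1 / 2 - μ)} :=
    isOpen_lt continuous_const (by fun_prop)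
  have h1 := differentiableOn_tsum_smul_comp (pairwise_isOrtho_innerResonance D) (embed n)
    (isCompactOperator_embed n).2 hO (c := fun z i => resonanceCoeff z i.1)
    (fun i => by
      refine DifferentiableOn.fun_inv (by fun_prop) fun z hz h0 => ?_
      have h2 := le_norm_resonanceDenom (hμ.2 i.2.1) i.2.2.2.le z
      rw [h0, norm_zero] at h2
      exact absurd hz (not_lt.2 h2))
    (fun z₀ hz₀ => by
      have hz₀' : 0 < (1 / 2 + μ) - ‖z₀‖ * (1 / 2 - μ) := hz₀
      refine ⟨(((1 / 2 + μ) - ‖z₀‖ * (1 / 2 - μ)) / 2)⁻¹, ?_⟩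
      have hcont : Continuous fun z : ℂ => (1 / 2 + μ) - ‖z‖ * (1 / 2 - μ) := by fun_prop
      filter_upwards [hcont.continuousAt.eventually_const_lt (half_lt_self hz₀')] with z hz i
      refine (norm_resonanceCoeff_le (hμ.2 i.2.1) i.2.2.2.le ((half_pos hz₀').trans hz)).trans ?_
      exact inv_anti₀ (half_pos hz₀') hz.le)
  exact differentiableOn_smul_add_add_smul (F := L2per n →L[ℂ] L2per n)
    (embed n ∘L P1 D ∘L invLaplace n) (embed n ∘L P2 D ∘L invLaplace n) h1

theorem A_zero (D : Set (Fin n → ℝ)) : A D 0 = embed n ∘L P2 D ∘L invLaplace n :=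
  zero_smul_add_add_zero_smul (F := L2per n →L[ℂ] L2per n) (embed n ∘L P1 D ∘L invLaplace n)
    (embed n ∘L P2 D ∘L invLaplace n) (∑' i, resonanceTerm D 0 i)

theorem isSelfAdjoint_A_zero (D : Set (Fin n → ℝ)) : IsSelfAdjoint (A D 0) := by
  rw [A_zero]
  exact (isSelfAdjoint_starProjection _).conj_adjoint (embed n)

theorem isCompactOperator_A (D : Set (Fin n → ℝ)) (z : ℂ) : IsCompactOperator (A D z) := by
  have h (i : InnerResonance D) : IsCompactOperator (resonanceTerm D z i) :=
    ((isCompactOperator_embed n).2.clm_comp (embed n ∘L proj (resonanceSpace D i.1))).smul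
      (resonanceCoeff z i.1)
  exact isCompactOperator_smul_add_add_smul (embed n) (isCompactOperator_embed n).2 _ _ z
    (isCompactOperator_tsum h)

include hμ hμ₁ hμ₂ in
theorem norm_comp_P1_add_sum_resonanceTerm_le {z : ℂ} (hz : 0 < (1 / 2 + μ) - ‖z‖ * (1 / 2 - μ))
    (s : Finset (InnerResonance D)) :
    ‖embed n ∘L P1 D ∘L invLaplace n + ∑ i ∈ s, resonanceTerm D z i‖ ≤
      ((1 / 2 + μ) - ‖z‖ * (1 / 2 - μ))⁻¹ * ‖embed n ∘L weightOp D (1 / 2 + μ)‖ ^ 2 := by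
  classical
  let c : Option ℝ → ℂ := fun i => i.elim 1 (resonanceCoeff z)
  let s' : Finset (Option ℝ) := s.image fun i => some i.1
  have hs' : (some (1 / 2) : Option ℝ) ∉ s' := by
    simp only [s', Finset.mem_image, not_exists, not_and]
    intro i _ h
    exact i.2.2.2.ne (Option.some_injective _ h)
  have hs'' : (none : Option ℝ) ∉ insert (some (1 / 2)) s' := by
    simp [s']
  -- For ν = 1/2 the resonance coefficient is 1, so the eigenspace for 1/2 joins the orthogonal
  -- family on equal terms. W₁ is then the only member outside W₃.
  have hc1 : c (some (1 / 2)) = 1 := by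
    change resonanceCoeff z (1 / 2) = 1
    rw [resonanceCoeff]
    push_cast
    norm_num
  have h2 : ∑ i ∈ insert none (insert (some (1 / 2)) s'), c i • proj (resonanceFamily D i) =
      P1 D + ∑ i ∈ s, resonanceCoeff z i.1 • proj (resonanceSpace D i.1) := by
    rw [Finset.sum_insert hs'', Finset.sum_insert hs', ← add_assoc, Finset.sum_image
      (fun i _ j _ h => Subtype.ext (Option.some_injective _ h)), hc1, one_smul]
    change (1 : ℂ) • proj (W1 D) + _ + _ = _
    rw [one_smul]
    rfl
  have h3 : embed n ∘L P1 D ∘L invLaplace n + ∑ i ∈ s, resonanceTerm D z i =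
      embed n ∘L (∑ i ∈ insert none (insert (some (1 / 2)) s'), c i • proj (resonanceFamily D i)) ∘L
        ContinuousLinearMap.adjoint (embed n) := by
    rw [h2]
    exact comp_add_sum_comp (embed n) (invLaplace n) (P1 D) s (fun i => resonanceCoeff z i.1)
      fun i => proj (resonanceSpace D i.1)
  rw [h3]
  refine norm_comp_sum_comp_adjoint_le (pairwise_isOrtho_resonanceFamily D)
    (U := (W3 D).topologicalClosure) (i₀ := none) ?_ ?_ (by linarith) ?_ rfl ?_ (embed n)
  · intro i hi
    rcases i with _ | ν
    · exact absurd rfl hi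
    · exact Submodule.topologicalClosure_mono (resonanceSpace_le_W3 D ν)
  · exact isOrtho_topologicalClosure (isOrtho_W1_W3 D)
  · refine inv_anti₀ hz ?_
    nlinarith [norm_nonneg z]
  · intro i hi h0
    rcases i with _ | ν
    · exact absurd rfl h0
    · have h4 : μ ≤ ν ∧ ν ≤ 1 / 2 := by
        rw [Finset.mem_insert, Finset.mem_insert, Finset.mem_image] at hi
        rcases hi with h | h | ⟨i, _, h⟩
        · exact absurd h h0
        · rw [Option.some_injective _ h]
          constructor <;> linarith
        · rw [← Option.some_injective _ h]
          exact ⟨hμ.2 i.2.1, i.2.2.2.le⟩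
      exact norm_resonanceCoeff_le h4.1 h4.2 hz

include hμ hμ₁ hμ₂ in
theorem norm_A_sub_le {z : ℂ} (hz : 0 < (1 / 2 + μ) - ‖z‖ * (1 / 2 - μ)) :
    ‖A D z - A D 0‖ ≤ ‖z‖ * (((1 / 2 + μ) - ‖z‖ * (1 / 2 - μ))⁻¹ *
      ‖embed n ∘L weightOp D (1 / 2 + μ)‖ ^ 2) := by
  exact norm_smul_add_add_tsum_sub_le z (embed n ∘L P1 D ∘L invLaplace n)
    (embed n ∘L P2 D ∘L invLaplace n) (summable_resonanceTerm hμ hz)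
    (norm_comp_P1_add_sum_resonanceTerm_le hμ hμ₁ hμ₂ hz)

end Family

/-! ### Perturbation of an isolated eigenvalue group -/

section EigenvalueGroup

theorem disjoint_contourSet {Γ : ℝ → ℂ} {β : ℂ} {S : Set ℂ} (hβΓ : β ∈ inside Γ)
    (hS : ∀ b ∈ S, b ≠ β → b ∈ outside Γ) : Disjoint (contourSet Γ) S := by
  refine Set.disjoint_left.2 fun ζ hζ hζS => ?_
  by_cases h : ζ = β
  · exact hβΓ.1 (h ▸ hζ)
  · exact (hS ζ hζS h).1 hζ

variable {H : Type*} [NormedAddCommGroup H] [InnerProductSpace ℂ H] [CompleteSpace H]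
  {A : ℂ → H →L[ℂ] H} {Γ : ℝ → ℂ} {β : ℂ}

theorem sInf_infDist_spectrum_pos {B : H →L[ℂ] H} (hΓ : IsContour Γ) (hβ : β ∈ spectrum ℂ B)
    (hβΓ : β ∈ inside Γ) (hΓ' : ∀ b ∈ spectrum ℂ B, b ≠ β → b ∈ outside Γ) :
    0 < sInf ((fun ζ => Metric.infDist ζ (spectrum ℂ B)) '' contourSet Γ) :=
  (sInf_infDist_pos hΓ (spectrum.isClosed B) ⟨β, hβ⟩ (disjoint_contourSet hβΓ hΓ')).1

/-- Perturbation of an isolated group of eigenvalues of a holomorphic family of compact operators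
that is selfadjoint at `0`. -/
theorem eigenvalueGroup (hΓ : IsContour Γ) (hH : ¬ FiniteDimensional ℂ H) (hs : IsSelfAdjoint (A 0))
    (hc : ∀ z, IsCompactOperator (A z)) (hβ : β ∈ spectrum ℂ (A 0)) (hβ₀ : β ≠ 0)
    (hβΓ : β ∈ inside Γ) (hΓ' : ∀ b ∈ spectrum ℂ (A 0), b ≠ β → b ∈ outside Γ) {r R : ℝ}
    (hr : 0 < r) (hrR : r < R) (hA : DifferentiableOn ℂ A (Metric.ball 0 R))
    (hAn : ∀ z ∈ Metric.ball (0 : ℂ) R,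
      ‖A z - A 0‖ < sInf ((fun ζ => Metric.infDist ζ (spectrum ℂ (A 0))) '' contourSet Γ)) :
    (∀ z : ℂ, ‖z‖ < r →
      contourSet Γ ⊆ resolventSet ℂ (A 0) ∧ contourSet Γ ⊆ resolventSet ℂ (A z) ∧
      spectrum ℂ (A z) = spectrum ℂ (A z) ∩ inside Γ ∪ spectrum ℂ (A z) ∩ outside Γ) ∧
    (∀ z : ℂ, ‖z‖ < r → ∀ P : H →L[ℂ] H,
      IsSpectralProjection (A z) (inside Γ) P ↔ P = riesz Γ (A z)) ∧
    DifferentiableOn ℂ (fun z => riesz Γ (A z)) (Metric.ball 0 r) ∧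
    (∀ z : ℂ, ‖z‖ < r → FiniteDimensional ℂ (riesz Γ (A z)).range ∧
      Nonempty ((riesz Γ (A z)).range ≃L[ℂ] (riesz Γ (A 0)).range)) ∧
    TendstoUniformlyOn
      (fun N z => β + ∑ k ∈ Finset.Icc 1 N, z ^ k * meanCoeff Γ A k)
      (weightedMean Γ A) Filter.atTop (Metric.ball 0 r) := by
  have hdisj := disjoint_contourSet hβΓ hΓ'
  have hρ0 : contourSet Γ ⊆ resolventSet ℂ (A 0) := fun ζ hζ =>
    not_not.1 (Set.disjoint_left.1 hdisj hζ)
  have hdist := (sInf_infDist_pos hΓ (spectrum.isClosed (A 0)) ⟨β, hβ⟩ hdisj).2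
  have hρ : ∀ z ∈ Metric.ball (0 : ℂ) R, contourSet Γ ⊆ resolventSet ℂ (A z) := fun z hz ζ hζ =>
    mem_resolventSet_of_norm_sub_lt hs (hρ0 hζ) (hdist ζ hζ) (hAn z hz)
  have h0 : (0 : ℂ) ∈ outside Γ :=
    hΓ' 0 (zero_mem_spectrum_of_isCompactOperator (hc 0) hH) hβ₀.symm
  have hf : ∀ z ∈ Metric.ball (0 : ℂ) R, FiniteRank (rieszElem hΓ (A z)) := fun z hz =>
    finiteDimensional_range_rieszElem hΓ (hρ z hz) h0 (hc z)
  have hR0 : (0 : ℂ) ∈ Metric.ball (0 : ℂ) R := Metric.mem_ball_self (hr.trans hrR)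
  have hmem {z : ℂ} (hz : ‖z‖ < r) : z ∈ Metric.ball (0 : ℂ) R :=
    mem_ball_zero_iff.2 (hz.trans hrR)
  have hP := differentiableOn_rieszElem hΓ hA hρ
  have hβP : A 0 * rieszElem hΓ (A 0) = β • rieszElem hΓ (A 0) :=
    mul_rieszElem_eq_smul hΓ hs hρ0 (fun b hb hb' => by
      by_contra h
      exact Set.disjoint_left.1 (disjoint_inside_outside Γ) hb' (hΓ' b hb h)) (hf 0 hR0)
  refine ⟨fun z hz => ⟨hρ0, hρ z (hmem hz), ?_⟩, fun z hz P => ?_, ?_, fun z hz => ?_, ?_⟩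
  · rw [← Set.inter_union_distrib_left]
    refine (Set.inter_eq_left.2 fun w hw => hΓ.simple w fun h => ?_).symm
    exact hw (hρ z (hmem hz) h)
  · exact isSpectralProjection_iff hΓ (hρ z (hmem hz))
  · refine (hP.mono (Metric.ball_subset_ball hrR.le)).congr fun z hz => ?_
    exact riesz_eq hΓ (hρ z (hmem (mem_ball_zero_iff.1 hz)))
  · rw [riesz_eq hΓ (hρ z (hmem hz)), riesz_eq hΓ hρ0]
    have h1 : FiniteDimensional ℂ (rieszElem hΓ (A z)).range := hf z (hmem hz)
    have h2 : FiniteDimensional ℂ (rieszElem hΓ (A 0)).range := hf 0 hR0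
    refine ⟨h1, ⟨ContinuousLinearEquiv.ofFinrankEq ?_⟩⟩
    exact finrank_range_family Metric.isOpen_ball hP
      (fun z hz => rieszElem_mul_self hΓ (hρ z hz)) hf (convex_ball 0 R).isPreconnected
      (hmem hz) hR0
  -- The weighted mean is holomorphic on the larger disc of radius R, so its Taylor series converges
  -- uniformly on the whole open disc of radius r.
  · have h1 := tendstoUniformlyOn_taylor hr hrR
      (differentiableOn_weightedMean hΓ Metric.isOpen_ball hA hρ hf)
    refine h1.congr (Eventually.of_forall fun N z _ => ?_)
    dsimp only
    rw [weightedMean_zero hΓ hρ0 (hf 0 hR0) (rieszElem_ne_zero hΓ hρ0 hβ hβΓ) hβP]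
    congr 1
    refine Finset.sum_congr rfl fun k hk => ?_
    rw [taylorCoeff_weightedMean hΓ Metric.isOpen_ball hA hρ hf hR0 hβΓ hβP
      (Nat.one_le_iff_ne_zero.1 (Finset.mem_Icc.1 hk).1)]

end EigenvalueGroup

/-- Comparison of the radius obtained from a bound `θ < 1/(2π)` with the radius `r*`. -/
theorem radius_bounds {d τ κ θ : ℝ} (hd : 0 < d) (hτ : 0 < τ) (hκ : 0 < κ) (hθ₀ : 0 ≤ θ)
    (hθ : θ < 1 / (2 * Real.pi)) {r : ℝ}
    (hr : r = 4 * Real.pi ^ 2 * d * (τ / κ) / (1 / κ + 4 * Real.pi ^ 2 * d)) :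
    0 < r ∧ r < d * τ / (θ ^ 2 + d * κ) ∧ ∀ x, 0 ≤ x → x < d * τ / (θ ^ 2 + d * κ) →
      0 < τ - x * κ ∧ x * ((τ - x * κ)⁻¹ * θ ^ 2) < d := by
  have hpi := Real.pi_pos
  have h1 : 0 < θ ^ 2 + d * κ := by positivity
  have h2 : θ ^ 2 * (4 * Real.pi ^ 2) < 1 := by
    rw [lt_div_iff₀ (by positivity)] at hθ
    have h3 : (θ * (2 * Real.pi)) ^ 2 < 1 := by
      rw [sq_lt_one_iff₀ (by positivity)]
      exact hθ
    nlinarith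
  have h4 : r = d * τ * (4 * Real.pi ^ 2) / (1 + d * κ * (4 * Real.pi ^ 2)) := by
    rw [hr]
    field_simp
  refine ⟨by rw [hr]; positivity, ?_, fun x hx hxR => ?_⟩
  · rw [h4, div_lt_div_iff₀ (by positivity) h1]
    have h5 : 0 < d * τ := by positivity
    have h6 : (4 * Real.pi ^ 2) * (θ ^ 2 + d * κ) < 1 + d * κ * (4 * Real.pi ^ 2) := by
      linarith
    calc d * τ * (4 * Real.pi ^ 2) * (θ ^ 2 + d * κ) =
        d * τ * ((4 * Real.pi ^ 2) * (θ ^ 2 + d * κ)) := by ring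
      _ < _ := by gcongr
  · rw [lt_div_iff₀ h1] at hxR
    -- The larger radius dτ/(θ² + dκ) is the solution of xθ² = d(τ - xκ), the borderline of the
    -- perturbation estimate; θ = 1/(2π) would give r* itself.
    have h5 : x * θ ^ 2 < d * (τ - x * κ) := by linarith
    have h6 : 0 < τ - x * κ := by
      have : 0 ≤ x * θ ^ 2 := by positivity
      exact pos_of_mul_pos_right (this.trans_lt h5) hd.le
    refine ⟨h6, ?_⟩
    rw [mul_left_comm, inv_mul_eq_div, div_lt_iff₀ h6]
    exact h5

end

end HighContrast

open HighContrast in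
theorem theorem6p2 {n : ℕ} (hn : n = 2 ∨ n = 3) {D : Set (Fin n → ℝ)} (hD : IsInclusionDomain D)
    {μ : ℝ} (hμ : IsLeast {ν | IsResonance D ν} μ) (hμ₁ : -1 / 2 < μ) (hμ₂ : μ < 0)
    {Γ : ℝ → ℂ} (hΓ : IsContour Γ)
    {β : ℂ} (hβ : β ∈ spectrum ℂ (A D 0)) (hβ₀ : β ≠ 0) (hβΓ : β ∈ inside Γ)
    (hΓ' : ∀ b ∈ spectrum ℂ (A D 0), b ≠ β → b ∈ outside Γ)
    {d zstar rstar : ℝ}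
    (hd : d = sInf ((fun ζ => Metric.infDist ζ (spectrum ℂ (A D 0))) '' contourSet Γ))
    (hz : zstar = (μ + 1 / 2) / (μ - 1 / 2))
    (hr : rstar = 4 * Real.pi ^ 2 * d * |zstar| / (1 / (1 / 2 - μ) + 4 * Real.pi ^ 2 * d)) :
    -- the series defining `A(z)` converges, and `Γ` separates the spectrum of `A(z)`
    (∀ z : ℂ, ‖z‖ < rstar → Summable (resonanceTerm D z) ∧
      contourSet Γ ⊆ resolventSet ℂ (A D 0) ∧ contourSet Γ ⊆ resolventSet ℂ (A D z) ∧
      spectrum ℂ (A D z) = spectrum ℂ (A D z) ∩ inside Γ ∪ spectrum ℂ (A D z) ∩ outside Γ) ∧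
    -- the contour integral is the spectral projection `P(z)` for the part inside `Γ`, and `P(z)`
    -- is holomorphic
    (∀ z : ℂ, ‖z‖ < rstar → ∀ P : L2per n →L[ℂ] L2per n,
      IsSpectralProjection (A D z) (inside Γ) P ↔ P = riesz Γ (A D z)) ∧
    DifferentiableOn ℂ (fun z => riesz Γ (A D z)) (Metric.ball 0 rstar) ∧
    -- the invariant subspaces are isomorphic, and of finite dimension
    (∀ z : ℂ, ‖z‖ < rstar → FiniteDimensional ℂ (riesz Γ (A D z)).range ∧
      Nonempty ((riesz Γ (A D z)).range ≃L[ℂ] (riesz Γ (A D 0)).range)) ∧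
    -- the power series of the weighted mean of the eigenvalue group converges uniformly
    TendstoUniformlyOn
      (fun N z => β + ∑ k ∈ Finset.Icc 1 N, z ^ k * meanCoeff Γ (A D) k)
      (weightedMean Γ (A D)) Filter.atTop (Metric.ball 0 rstar) := by
  have hd0 : 0 < d := by
    rw [hd]
    exact sInf_infDist_spectrum_pos hΓ hβ hβΓ hΓ'
  have hτ : 0 < 1 / 2 + μ := by linarith
  have hκ : 0 < 1 / 2 - μ := by linarith
  have hzabs : |zstar| = (1 / 2 + μ) / (1 / 2 - μ) := by
    rw [hz, abs_div, abs_of_pos (by linarith : 0 < μ + 1 / 2),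
      abs_of_neg (by linarith : μ - 1 / 2 < 0), neg_sub, add_comm]
  rw [hzabs] at hr
  obtain ⟨hr0, hrR, hR⟩ := radius_bounds (θ := ‖embed n ∘L weightOp D (1 / 2 + μ)‖) hd0 hτ hκ
    (ContinuousLinearMap.opNorm_nonneg _)
    (norm_embed_comp_weightOp_lt hD hτ.le (by linarith : 1 / 2 + μ < 1)) hr
  have hmain := eigenvalueGroup hΓ (not_finiteDimensional_L2per (by omega))
    (isSelfAdjoint_A_zero D) (isCompactOperator_A D) hβ hβ₀ hβΓ hΓ' hr0 hrR
    ((differentiableOn_A hμ hμ₂).mono fun z hz =>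
      (hR ‖z‖ (norm_nonneg z) (mem_ball_zero_iff.1 hz)).1)
    (fun z hz => by
      obtain ⟨h1, h2⟩ := hR ‖z‖ (norm_nonneg z) (mem_ball_zero_iff.1 hz)
      rw [← hd]
      exact (norm_A_sub_le hμ hμ₁ hμ₂ h1).trans_lt h2)
  refine ⟨fun z hz' => ⟨summable_resonanceTerm hμ (hR ‖z‖ (norm_nonneg z) (hz'.trans hrR)).1,
    hmain.1 z hz'⟩, hmain.2⟩
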